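/- Let $d\ge 1$. Let $h:[0,\infty)\to[0,\infty)$ be convex, $C^1$ on $[0,\infty)$ and $C^\infty$ on $(0,\infty)$, with $h(0)=0$ and $\lim_{s\to\infty}s\,h''(s)=+\infty$; put $\tilde h(s)=s\,h(1/s)$. Let $V\in C^2(\mathbb R^d)$ be non-negative. Let $\mathcal P_2^{ac}$ be the set of probability densities on $\mathbb R^d$ with finite second moment, identified with the corresponding measures, let $W_2$ be the $L^2$-Wasserstein distance, and for a density $\rho$ put $\mathcal E(\rho)=\int_{\mathbb R^d}[h(\rho)+V\rho]\,dx\in[0,\infty]$. Fix $\overline\rho\in\mathcal P_2^{ac}$ whose support $K$ is convex and compact, and $\rho^0\in\mathcal P_2^{ac}$. A discretization $\boxplus=(\mathscr T,\tau)$ consists of a finite simplicial decomposition $\mathscr T$ of $K$, with $d$-simplices $\Delta_1,\dots,\Delta_M$, and a time step $\tau>0$. Let $\overline\rho_{\mathscr T}$ be the piecewise constant density with value $\frac1{|\Delta_m|}\int_{\Delta_m}\overline\rho\,d\omega$ on $\Delta_m$, and let $\mathcal A_{\mathscr T}$ be the set of continuous maps $G:K\to\mathbb R^d$ that on each $\Delta_m$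 are affine, $G(\omega)=A_m\omega+b_m$, with $\det A_m>0$. For $G,G'\in\mathcal A_{\mathscr T}$ put $$\mathbf E_\boxplus(G;G')=\frac1{2\tau}\int_K\|G-G'\|^2\,\overline\rho_{\mathscr T}\,d\omega+\int_K\Big[\tilde h\Big(\frac{\det \mathrm DG}{\overline\rho_{\mathscr T}}\Big)+V\circ G\Big]\overline\rho_{\mathscr T}\,d\omega .$$ A discrete solution is a sequence $(G_\boxplus^n)_{n\ge0}$ in $\mathcal A_{\mathscr T}$ such that, for each $n\ge1$, $G_\boxplus^n$ is a global minimizer of $\mathbf E_\boxplus(\,\cdot\,;G_\boxplus^{n-1})$ on $\mathcal A_{\mathscr T}$. Assume that, for each $n\ge1$, $G^n_\boxplus$ is injective on $K$ up to a Lebesgue null set. Define $$\rho_\boxplus^n=(G_\boxplus^n)_\#\overline\rho_{\mathscr T}\quad(n\ge0),\qquad \mathbf v_\boxplus^n=\frac{\mathrm{id}-G_\boxplus^{n-1}\circ(G_\boxplus^n)^{-1}}{\tau}\quad(n\ge1),$$ where $\mathbf v_\boxplus^n$ is defined $\rho_\boxplus^n$-almost everywhere, and let $\tilde\rho_\boxplus(t)=\rho_\boxplus^n$,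 $\tilde{\mathbf v}_\boxplus(t)=\mathbf v_\boxplus^n$ for $t\in((n-1)\tau,n\tau]$ (and $\tilde\rho_\boxplus(0)=\rho^0_\boxplus$). Let a sequence of discretizations with discrete solutions be given such that the time steps $\tau$ and the maximal diameters of the simplices tend to $0$ (written $\boxplus\to0$), $\rho_\boxplus^0\to\rho^0$ narrowly, and $\sup_\boxplus\mathcal E(\rho_\boxplus^0)<\infty$. Then there are a subsequence, a (jointly measurable) curve $\rho_*:[0,\infty)\to\mathcal P_2^{ac}$ and a velocity field $\mathbf v_*\in L^2([0,\infty)\times\mathbb R^d;\rho_*)$, i.e. $\int_0^\infty\!\int\|\mathbf v_*\|^2\rho_*\,dx\,dt<\infty$, such that, along the subsequence: 1. $\tilde\rho_\boxplus(t)\to\rho_*(t)$ narrowly for every $t\ge0$; 2. $\rho_*$ is Hölder-$\frac12$-continuous in $W_2$: there is $C$ with $W_2(\rho_*(s),\rho_*(t))\le C|t-s|^{1/2}$ for all $s,t\ge0$; 3. $\tilde{\mathbf v}_\boxplus\tilde\rho_\boxplus\overset{*}{\rightharpoonup}\mathbf v_*\rho_*$, in the sense that $$\int_0^\infty\!\!\int_{\mathbb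 R^d}\psi\cdot\tilde{\mathbf v}_\boxplus\,\tilde\rho_\boxplus\,dx\,dt\to\int_0^\infty\!\!\int_{\mathbb R^d}\psi\cdot\mathbf v_*\,\rho_*\,dx\,dt$$ for every bounded continuous $\psi:\mathbb R\times\mathbb R^d\to\mathbb R^d$ that vanishes for all $t\ge T$, for some $T$; 4. the continuity equation $\partial_t\rho_*+\nabla\cdot(\rho_*\mathbf v_*)=0$ holds in the sense of distributions on $(0,\infty)\times\mathbb R^d$, i.e. $\int_0^\infty\!\int(\partial_t\varphi+\nabla\varphi\cdot\mathbf v_*)\rho_*\,dx\,dt=0$ for all $\varphi\in C_c^\infty((0,\infty)\times\mathbb R^d)$. -/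

import Mathlib

open MeasureTheory Set Filter Topology
open scoped ENNReal NNReal BoundedContinuousFunction RealInnerProductSpace

noncomputable section

namespace LagrangianScheme

/-- The Euclidean space `ℝ^d`. -/
abbrev Space (d : ℕ) := EuclideanSpace ℝ (Fin d)

/-! ### Densities, push-forward, Wasserstein distance, narrow convergence -/

/-- `ρ` is a probability density with respect to Lebesgue measure, with finite second moment. -/
structure IsProbDensity {d : ℕ} (ρ : Space d → ℝ) : Prop where
  integrable : Integrable ρ
  nonneg : ∀ᵐ x, 0 ≤ ρ x
  mass : ∫ x, ρ x = 1
  second_moment : Integrable (fun x => ‖x‖ ^ 2 * ρ x)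

/-- The measure `ρ(x) dx`. -/
def densityMeasure {d : ℕ} (ρ : Space d → ℝ) : Measure (Space d) :=
  volume.withDensity (fun x => ENNReal.ofReal (ρ x))

/-- The Lebesgue density of the push-forward of the measure `ρ(x) dx` under `T`
(for maps `T` whose push-forward measure is absolutely continuous). -/
def pushDensity {d : ℕ} (T : Space d → Space d) (ρ : Space d → ℝ) : Space d → ℝ :=
  fun x => (((densityMeasure ρ).map T).rnDeriv volume x).toReal

/-- The `L²`-Wasserstein distance of two probability measures: infimum of the quadratic cost over
all couplings. -/
def wasserstein2 {d : ℕ} (μ ν : Measure (Space d)) : ℝ≥0∞ :=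
  (⨅ π : {π : Measure (Space d × Space d) // π.map Prod.fst = μ ∧ π.map Prod.snd = ν},
    ∫⁻ z, ‖z.1 - z.2‖ₑ ^ 2 ∂(π : Measure (Space d × Space d))) ^ (1 / 2 : ℝ)

/-- Narrow convergence of the measures `ρ k (x) dx` to `σ(x) dx`. -/
def NarrowTendsto {d : ℕ} (ρ : ℕ → Space d → ℝ) (σ : Space d → ℝ) : Prop :=
  ∀ f : Space d →ᵇ ℝ,
    Tendsto (fun k => ∫ x, f x ∂densityMeasure (ρ k)) atTop (𝓝 (∫ x, f x ∂densityMeasure σ))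

/-- The measure `ρ(t, x) dt dx` on `(0, ∞) × ℝ^d`. -/
def spaceTimeMeasure {d : ℕ} (ρ : ℝ → Space d → ℝ) : Measure (ℝ × Space d) :=
  ((volume.restrict (Ioi (0 : ℝ))).prod (volume : Measure (Space d))).withDensity
    (fun p => ENNReal.ofReal (ρ p.1 p.2))

/-- The integral `∫∫ φ(t,x) · v(t,x) ρ(t,x) dx dt` over `(0, ∞) × ℝ^d`. -/
def momentum {d : ℕ} (ρ : ℝ → Space d → ℝ) (v : ℝ → Space d → Space d)
    (φ : ℝ × Space d → Space d) : ℝ :=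
  ∫ p, ⟪φ p, v p.1 p.2⟫ ∂spaceTimeMeasure ρ

/-- The continuity equation `∂ₜρ + ∇·(ρ v) = 0` on `(0, ∞) × ℝ^d` in the sense of distributions.
The integrand is `∂ₜφ(t,x) + ∇φ(t,x) · v(t,x)`. -/
def ContinuityEquation {d : ℕ} (ρ : ℝ → Space d → ℝ) (v : ℝ → Space d → Space d) : Prop :=
  ∀ φ : ℝ × Space d → ℝ, ContDiff ℝ (⊤ : ℕ∞) φ → HasCompactSupport φ →
    tsupport φ ⊆ Ioi (0 : ℝ) ×ˢ (univ : Set (Space d)) →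
    ∫ p, fderiv ℝ φ p ((1 : ℝ), v p.1 p.2) ∂spaceTimeMeasure ρ = 0

/-! ### Energies -/

/-- The conditions on the internal energy density `h` on `[0, ∞)`. -/
structure IsInternalEnergy (h : ℝ → ℝ) : Prop where
  nonneg : ∀ r, 0 ≤ r → 0 ≤ h r
  convex : ConvexOn ℝ (Ici 0) h
  contDiffOn_one : ContDiffOn ℝ 1 h (Ici 0)
  contDiffOn_infty : ContDiffOn ℝ (⊤ : ℕ∞) h (Ioi 0)
  zero : h 0 = 0
  growth : Tendsto (fun s => s * deriv (deriv h) s) atTop atTop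

/-- The energy `∫ (h(ρ) + V ρ) dx` of a density. -/
def energy {d : ℕ} (h : ℝ → ℝ) (V : Space d → ℝ) (ρ : Space d → ℝ) : ℝ≥0∞ :=
  ∫⁻ x, ENNReal.ofReal (h (ρ x) + V x * ρ x)

/-- The energy density in Lagrangian coordinates, `s ↦ s h(1/s)`. -/
def hTilde (h : ℝ → ℝ) (s : ℝ) : ℝ := s * h s⁻¹

/-- The energy `∫_K [hTilde(det DG / ρ) + V ∘ G] ρ dω` of a Lagrangian map `G`
relative to the reference density `ρ`. -/
def lagrangianEnergy {d : ℕ} (h : ℝ → ℝ) (V : Space d → ℝ) (K : Set (Space d))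
    (ρ : Space d → ℝ) (G : Space d → Space d) : ℝ≥0∞ :=
  ∫⁻ ω in K, ENNReal.ofReal ((hTilde h ((fderiv ℝ G ω).det / ρ ω) + V (G ω)) * ρ ω)

/-! ### The fully discrete scheme -/

/-- A spatio-temporal discretization: a finite simplicial decomposition of `K` and a time step. -/
structure Discretization {d : ℕ} (K : Set (Space d)) where
  mesh : Geometry.SimplicialComplex ℝ (Space d)
  finite_faces : mesh.faces.Finite
  space_eq : mesh.space = K
  τ : ℝ
  τ_pos : 0 < τ

namespace Discretization

variable {d : ℕ} {K : Set (Space d)}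

/-- The (vertex sets of the) `d`-simplices of the mesh. -/
def simplices (D : Discretization K) : Finset (Finset (Space d)) :=
  D.finite_faces.toFinset.filter (fun s => s.card = d + 1)

/-- The maximal diameter of the simplices of the mesh. -/
def meshSize (D : Discretization K) : ℝ :=
  sSup ((fun s : Finset (Space d) => Metric.diam (convexHull ℝ (s : Set (Space d)))) ''
    D.mesh.faces)

/-- The piecewise constant approximation of the reference density `ρbar`: on each `d`-simplex it
is the mean value of `ρbar` over that simplex. -/
def refDensity (D : Discretization K) (ρbar : Space d → ℝ) : Space d → ℝ := fun ω =>
  ∑ s ∈ D.simplices, (interior (convexHull ℝ (s : Set (Space d)))).indicator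
    (fun _ => (∫ x in convexHull ℝ (s : Set (Space d)), ρbar x) /
      volume.real (convexHull ℝ (s : Set (Space d)))) ω

/-- The ansatz space: maps that are continuous on `K`, and on each `d`-simplex of the mesh affine
and orientation preserving. Only the values of the maps on `K` matter. -/
def ansatz (D : Discretization K) : Set (Space d → Space d) :=
  {G | ContinuousOn G K ∧ ∀ s ∈ D.simplices, ∃ (A : Space d →ₗ[ℝ] Space d) (b : Space d),
    0 < LinearMap.det A ∧ ∀ ω ∈ convexHull ℝ (s : Set (Space d)), G ω = A ω + b}

/-- The functional `(1/2τ) ‖G - G'‖² + E(G)`, with the norm of `L²(K; ρ)` and the Lagrangian energy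
`E` relative to `ρ`, where `ρ` is the piecewise constant reference density. -/
def functional (D : Discretization K) (h : ℝ → ℝ) (V : Space d → ℝ) (ρbar : Space d → ℝ)
    (G G' : Space d → Space d) : ℝ≥0∞ :=
  ENNReal.ofReal (1 / (2 * D.τ)) *
      (∫⁻ ω in K, ENNReal.ofReal (‖G ω - G' ω‖ ^ 2 * D.refDensity ρbar ω)) +
    lagrangianEnergy h V K (D.refDensity ρbar) G

/-- `G 0, G 1, …` is produced by successive global minimization of the functional. -/
structure IsDiscreteSolution (D : Discretization K) (h : ℝ → ℝ) (V : Space d → ℝ)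
    (ρbar : Space d → ℝ) (G : ℕ → Space d → Space d) : Prop where
  mem_ansatz : ∀ n, G n ∈ D.ansatz
  isMinimizer : ∀ n, ∀ F ∈ D.ansatz,
    D.functional h V ρbar (G (n + 1)) (G n) ≤ D.functional h V ρbar F (G n)

/-- The discrete densities: push-forward of the piecewise constant reference density. -/
def density (D : Discretization K) (ρbar : Space d → ℝ) (G : ℕ → Space d → Space d) (n : ℕ) :
    Space d → ℝ :=
  pushDensity (G n) (D.refDensity ρbar)

/-- The discrete velocities `(id - G (n-1) ∘ (G n)⁻¹) / τ`, for `n ≥ 1`, with `(G n)⁻¹` mapping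
the image of `K` under `G n` to `K`. The values outside of that image are irrelevant. -/
def velocity (D : Discretization K) (G : ℕ → Space d → Space d) (n : ℕ) : Space d → Space d :=
  fun x => D.τ⁻¹ • (x - G (n - 1) (Function.invFunOn (G n) K x))

/-- The index `n` with `t ∈ ((n-1)τ, nτ]`, for `t ≥ 0`. -/
def timeIndex (D : Discretization K) (t : ℝ) : ℕ := ⌈t / D.τ⌉₊

/-- Piecewise constant in time interpolation of the densities. -/
def densityInterp (D : Discretization K) (ρbar : Space d → ℝ) (G : ℕ → Space d → Space d)
    (t : ℝ) : Space d → ℝ :=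
  D.density ρbar G (D.timeIndex t)

/-- Piecewise constant in time interpolation of the velocities. -/
def velocityInterp (D : Discretization K) (G : ℕ → Space d → Space d) (t : ℝ) :
    Space d → Space d :=
  D.velocity G (D.timeIndex t)

end Discretization

end LagrangianScheme

end

namespace LagrangianScheme

/-! ### Superlinear convex functions -/

namespace IsInternalEnergy

variable {h : ℝ → ℝ}

/-! The argument is Lagrangian. On `K`, with the discretized reference density as probability
measure, the maps G^n form a process whose law at step n is ρ^n and whose increments, divided by τ,
are the velocities. Comparing each minimizer with its predecessor and summing gives
`energy_dissipation`: Lagrangian energies stay below the initial energy, and the squared L²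
increments sum to at most a constant times τ. At step 0 the Lagrangian energy is at most the
Eulerian one, even if the map overlaps itself, because h(s)/s is nondecreasing
(`lagrangianEnergy_le_energy`). At later steps injectivity up to null sets makes the two energies
equal, so all densities have bounded energy (`energy_density_le`). Minimality enters only through
this comparison; no Euler-Lagrange equation is needed.

The bound on the increments (`ActionBound`) makes the curves of laws Hölder-1/2 up to an error of
one time step. Tightness propagates from the initial laws, and extraction at rational times yields
narrow convergence at every time (`exists_tendsto_interp`). Superlinearity of h gives
equi-integrability, so the limits have densities (`absolutelyContinuous_of_tendsto`). The joint laws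
of the positions at two times converge to a coupling of cost at most C|t - s| (`exists_coupling`),
whence the W₂ estimate and the second moments.

The velocities are bounded in L² spaces that vary with k. For a fixed test field the norms in these
spaces converge, so the momenta, as functionals on test fields, have a subsequential limit that is
bounded for the L² norm of the limit curve; Riesz represents it (`exists_weak_limit`,
`exists_limit_velocity`). Along the path of each label, the integral of ∂ₜφ + ∇φ·v telescopes up to
τ² plus a squared increment per step. The total error is O(τ) (`norm_integral_fderiv_le`), and the
equation passes to the limit (`continuityEquation_of_tendsto`). -/

lemma div_self_mono (hh : IsInternalEnergy h) {a b : ℝ} (ha : 0 ≤ a) (hab : a ≤ b) :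
    h a / a ≤ h b / b := by
  rcases ha.eq_or_lt with rfl | ha'
  · rw [div_zero]
    exact div_nonneg (hh.nonneg b hab) hab
  have hb : 0 < b := ha'.trans_le hab
  have h1 : 0 ≤ 1 - a / b := by rw [sub_nonneg, div_le_one hb]; exact hab
  -- Convexity on the segment from 0 to b, at a = (a/b)·b, with h(0) = 0.
  have := hh.convex.2 (mem_Ici.2 le_rfl) (mem_Ici.2 hb.le) h1 (by positivity : 0 ≤ a / b) (by ring)
  simp only [smul_eq_mul, mul_zero, zero_add, hh.zero] at this
  rw [div_mul_cancel₀ _ hb.ne'] at this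
  rw [div_le_div_iff₀ ha' hb]
  calc h a * b ≤ a / b * h b * b := by gcongr
    _ = h b * a := by field_simp

/-- Once s h''(s) ≥ 1, the function h' - log is nondecreasing, so h' grows at least like log. -/
lemma deriv_tendsto_atTop (hh : IsInternalEnergy h) : Tendsto (deriv h) atTop atTop := by
  obtain ⟨s₀, hs₀⟩ := eventually_atTop.1 (hh.growth.eventually_ge_atTop 1)
  set s₁ := max s₀ 1 with hs₁
  have hpos : 0 < s₁ := lt_of_lt_of_le one_pos (le_max_right _ _)
  have hd : ContDiffOn ℝ (⊤ : ℕ∞) (deriv h) (Ioi 0) :=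
    hh.contDiffOn_infty.deriv_of_isOpen isOpen_Ioi (by simp)
  have hd' : ∀ s, s₁ ≤ s → DifferentiableAt ℝ (deriv h) s := fun s hs =>
    (hd.differentiableOn (by simp)).differentiableAt (Ioi_mem_nhds (hpos.trans_le hs))
  have hmono : MonotoneOn (fun s => deriv h s - Real.log s) (Ici s₁) := by
    have hdiff : ∀ s, s₁ ≤ s → HasDerivAt (fun s => deriv h s - Real.log s)
        (deriv (deriv h) s - s⁻¹) s := fun s hs =>
      (hd' s hs).hasDerivAt.sub (Real.hasDerivAt_log (hpos.trans_le hs).ne')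
    refine monotoneOn_of_deriv_nonneg (convex_Ici _)
      (fun s hs => (hdiff s hs).continuousAt.continuousWithinAt)
      (fun s hs => (hdiff s (interior_subset hs)).differentiableAt.differentiableWithinAt)
      (fun s hs => ?_)
    have hs' : s₁ ≤ s := interior_subset hs
    rw [(hdiff s hs').deriv, sub_nonneg, inv_le_iff_one_le_mul₀' (hpos.trans_le hs')]
    exact hs₀ s ((le_max_left _ _).trans hs')
  refine tendsto_atTop_mono' atTop (f₁ := fun s => (deriv h s₁ - Real.log s₁) + Real.log s) ?_
    (tendsto_atTop_add_const_left _ _ Real.tendsto_log_atTop)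
  filter_upwards [eventually_ge_atTop s₁] with s hs
  have := hmono (mem_Ici.2 le_rfl) (mem_Ici.2 hs) hs
  simp only at this
  linarith

/-- The internal energy grows superlinearly. -/
lemma exists_mul_le (hh : IsInternalEnergy h) (R : ℝ) :
    ∃ s₀, 0 < s₀ ∧ ∀ s, s₀ ≤ s → R * s ≤ h s := by
  obtain ⟨a, ha⟩ := eventually_atTop.1 (hh.deriv_tendsto_atTop.eventually_ge_atTop (2 * |R|))
  set b := max a 1 with hb
  have hpos : 0 < b := lt_of_lt_of_le one_pos (le_max_right _ _)
  -- Slope at least 2|R| beyond b gives h(s) ≥ 2|R|(s - b), which is at least |R|s once s ≥ 2b.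
  refine ⟨2 * b, by positivity, fun s hs => ?_⟩
  have hdiff : ∀ s, b ≤ s → DifferentiableAt ℝ h s := fun s hs =>
    (hh.contDiffOn_infty.differentiableOn (by simp)).differentiableAt
      (Ioi_mem_nhds (hpos.trans_le hs))
  have hbs : b ≤ s := by linarith
  have := (convex_Ici b).mul_sub_le_image_sub_of_le_deriv
    (fun s hs => (hdiff s hs).continuousAt.continuousWithinAt)
    (fun s hs => (hdiff s (interior_subset hs)).differentiableWithinAt)
    (C := 2 * |R|) (fun s hs => ha s ((le_max_left _ _).trans (interior_subset hs)))
    b (mem_Ici.2 le_rfl) s (mem_Ici.2 hbs) hbs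
  have h0 := hh.nonneg b hpos.le
  have h1 : R * s ≤ |R| * s := mul_le_mul_of_nonneg_right (le_abs_self R) (by linarith)
  have h2 : 0 ≤ |R| * (s - 2 * b) := mul_nonneg (abs_nonneg R) (by linarith)
  nlinarith

/-- Nothing is assumed about h on negative numbers, so measurability is only available after
truncation. -/
lemma measurable_comp_max (hh : IsInternalEnergy h) : Measurable fun r => h (max r 0) := by
  have : Continuous fun r => h (max r 0) :=
    hh.contDiffOn_one.continuousOn.comp_continuous (by fun_prop) (fun r => by simp)
  exact this.measurable

end IsInternalEnergy

/-! ### Weak compactness of functionals with converging norms -/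

/-- A sequence of functionals `L k` that is bounded by seminorms `N k` which converge to the norm of
a Hilbert space has a subsequence that converges to an element of that Hilbert space. -/
theorem exists_weak_limit {𝓧 H : Type*} [AddCommGroup 𝓧] [Module ℝ 𝓧]
    [NormedAddCommGroup H] [InnerProductSpace ℝ H] [CompleteSpace H] [SecondCountableTopology H]
    (e : 𝓧 →ₗ[ℝ] H) (he' : ∀ u : H, ∀ r > 0, ∃ x, ‖u - e x‖ < r)
    (L : ℕ → 𝓧 →ₗ[ℝ] ℝ) (N : ℕ → 𝓧 → ℝ) (C : ℝ)
    (hL : ∀ k x, |L k x| ≤ C * N k x) (hN : ∀ x, Tendsto (fun k => N k x) atTop (𝓝 ‖e x‖)) :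
    ∃ φ : ℕ → ℕ, StrictMono φ ∧ ∃ v : H, ∀ x,
      Tendsto (fun j => L (φ j) x) atTop (𝓝 ⟪v, e x⟫) := by
  have he : DenseRange e := Metric.denseRange_iff.2 fun u r hr => by
    simpa only [dist_eq_norm] using he' u r hr
  obtain ⟨u, hu⟩ : ∃ u : ℕ → 𝓧, DenseRange (fun i => e (u i)) := by
    obtain ⟨s, hsc, hs⟩ := TopologicalSpace.exists_countable_dense (range e)
    have hne : s.Nonempty := hs.nonempty_iff.2 ⟨⟨e 0, mem_range_self 0⟩⟩
    obtain ⟨w, hw⟩ := hsc.exists_eq_range hne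
    choose u hu using fun i => (w i).2
    refine ⟨u, ?_⟩
    have h1 : DenseRange w := by rw [DenseRange, ← hw]; exact hs
    have h2 : DenseRange (Subtype.val : range e → H) := by
      rw [DenseRange, Subtype.range_coe]; exact he
    have := h2.comp h1 continuous_subtype_val
    convert this using 1
    ext i; exact hu i
  have hbdd : ∀ x, ∃ B, ∀ k, |L k x| ≤ B := fun x => by
    obtain ⟨B, hB⟩ := ((hN x).const_mul C).bddAbove_range
    exact ⟨B, fun k => (hL k x).trans (hB (mem_range_self k))⟩
  choose B hB using hbdd
  -- Tychonoff on a countable product of intervals replaces the diagonal extraction.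
  have hcomp : IsCompact (univ.pi fun i => Icc (-B (u i)) (B (u i))) :=
    isCompact_univ_pi fun i => isCompact_Icc
  obtain ⟨l, -, φ, hφ, hl⟩ := hcomp.tendsto_subseq (x := fun k i => L k (u i))
    (fun k => mem_univ_pi.2 fun i => abs_le.1 (hB (u i) k))
  rw [tendsto_pi_nhds] at hl
  refine ⟨φ, hφ, ?_⟩
  have hcauchy : ∀ x, ∃ r, Tendsto (fun j => L (φ j) x) atTop (𝓝 r) := fun x => by
    apply cauchySeq_tendsto_of_complete
    rw [Metric.cauchySeq_iff]
    intro ε hε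
    obtain ⟨i, hi⟩ := hu.exists_dist_lt (e x) (ε := ε / 4 / (|C| + 1)) (by positivity)
    -- Closeness in H controls `L` only in the tail, where the seminorms of `x - u i` are near their
    -- limit.
    have h1 : ∀ᶠ j in atTop, |L (φ j) (x - u i)| < ε / 4 := by
      have h2 := ((hN (x - u i)).comp hφ.tendsto_atTop).const_mul C
      have h3 : C * ‖e (x - u i)‖ < ε / 4 := by
        rw [map_sub, ← dist_eq_norm]
        calc C * dist (e x) (e (u i)) ≤ (|C| + 1) * dist (e x) (e (u i)) := by
              gcongr; linarith [le_abs_self C]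
          _ < (|C| + 1) * (ε / 4 / (|C| + 1)) := by gcongr
          _ = ε / 4 := by field_simp
      filter_upwards [h2.eventually_lt_const h3] with j hj
      exact (hL _ _).trans_lt hj
    obtain ⟨a, ha⟩ := eventually_atTop.1 h1
    obtain ⟨b, hb⟩ := Metric.cauchySeq_iff.1 (hl i).cauchySeq (ε / 4) (by positivity)
    refine ⟨max a b, fun m hm n hn => ?_⟩
    have e1 := ha m ((le_max_left _ _).trans hm)
    have e2 := ha n ((le_max_left _ _).trans hn)
    have e3 := hb m ((le_max_right _ _).trans hm) n ((le_max_right _ _).trans hn)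
    simp only [map_sub, Function.comp_apply, Real.dist_eq, abs_lt] at e1 e2 e3 ⊢
    constructor <;> linarith [e1.1, e1.2, e2.1, e2.2, e3.1, e3.2]
  choose r hr using hcauchy
  let Λ : 𝓧 →ₗ[ℝ] ℝ :=
    { toFun := r
      map_add' := fun x y => tendsto_nhds_unique (hr (x + y)) (by
        simpa only [map_add] using (hr x).add (hr y))
      map_smul' := fun c x => tendsto_nhds_unique (hr (c • x)) (by
        simpa only [map_smul, RingHom.id_apply] using (hr x).const_smul c) }
  have hΛ : ∀ x, ‖Λ x‖ ≤ C * ‖e x‖ := fun x =>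
    le_of_tendsto_of_tendsto' (hr x).norm (((hN x).comp hφ.tendsto_atTop).const_mul C)
      fun j => hL _ _
  -- The bound by ‖e x‖ lets the limit factor through `e` and extend to H from its dense range;
  -- Riesz then gives the vector.
  refine ⟨(InnerProductSpace.toDual ℝ H).symm (Λ.extendOfNorm e), fun x => ?_⟩
  rw [InnerProductSpace.toDual_symm_apply, LinearMap.extendOfNorm_eq he ⟨C, hΛ⟩]
  exact hr x

/-! ### Geometry of the mesh -/

/-- At most d points lie in a proper affine subspace, which is a null set. -/
lemma volume_convexHull_of_card_le {d : ℕ} {s : Finset (Space d)} (hs : s.card ≤ d) :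
    volume (convexHull ℝ (s : Set (Space d))) = 0 := by
  classical
  rcases s.eq_empty_or_nonempty with rfl | hne
  · simp
  obtain ⟨n, hn⟩ : ∃ n, s.card = n + 1 := ⟨s.card - 1, by have := hne.card_pos; omega⟩
  refine measure_mono_null (convexHull_subset_affineSpan _)
    (Measure.addHaar_affineSubspace volume _ fun htop => ?_)
  have h1 := AffineSubspace.vectorSpan_eq_top_of_affineSpan_eq_top ℝ (Space d) (Space d) htop
  have h2 := finrank_vectorSpan_image_finset_le ℝ (id : Space d → Space d) s hn
  rw [Finset.image_id, h1, finrank_top, finrank_euclideanSpace_fin] at h2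
  omega

/-- A step function, as a density, on pairwise arbitrary measurable sets. -/
lemma densityMeasure_sum_indicator {d : ℕ} {ι : Type*} (S : Finset ι) (U : ι → Set (Space d))
    (hU : ∀ i ∈ S, MeasurableSet (U i)) (c : ι → ℝ) (hc : ∀ i ∈ S, 0 ≤ c i) :
    densityMeasure (fun x => ∑ i ∈ S, (U i).indicator (fun _ => c i) x) =
      ∑ i ∈ S, ENNReal.ofReal (c i) • volume.restrict (U i) := by
  ext A hA
  rw [densityMeasure, withDensity_apply _ hA, Measure.finsetSum_apply]
  have : ∀ x, ENNReal.ofReal (∑ i ∈ S, (U i).indicator (fun _ => c i) x) =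
      ∑ i ∈ S, (U i).indicator (fun _ => ENNReal.ofReal (c i)) x := fun x => by
    rw [ENNReal.ofReal_sum_of_nonneg fun i hi => indicator_nonneg (fun _ _ => hc i hi) x]
    refine Finset.sum_congr rfl fun i _ => ?_
    by_cases hx : x ∈ U i <;> simp [hx]
  simp_rw [this]
  rw [lintegral_finsetSum _ fun i hi => measurable_const.indicator (hU i hi)]
  refine Finset.sum_congr rfl fun i hi => ?_
  rw [lintegral_indicator_const (hU i hi), Measure.restrict_apply (hU i hi), Measure.smul_apply,
    Measure.restrict_apply hA, smul_eq_mul, inter_comm]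

namespace Discretization

variable {d : ℕ} {K : Set (Space d)} (D : Discretization K)

lemma mem_simplices {s : Finset (Space d)} :
    s ∈ D.simplices ↔ s ∈ D.mesh.faces ∧ s.card = d + 1 := by
  simp [simplices]

lemma convexHull_subset {s : Finset (Space d)} (hs : s ∈ D.simplices) :
    convexHull ℝ (s : Set (Space d)) ⊆ K := by
  rw [← D.space_eq]
  exact D.mesh.convexHull_subset_space (D.mem_simplices.1 hs).1

/-- The open cells of the mesh. -/
def cell (s : Finset (Space d)) : Set (Space d) := interior (convexHull ℝ (s : Set (Space d)))

lemma isOpen_cell (s : Finset (Space d)) : IsOpen (cell s) := isOpen_interior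

lemma measurableSet_cell (s : Finset (Space d)) : MeasurableSet (cell s) :=
  (isOpen_cell s).measurableSet

lemma isClosed_convexHull_finset (s : Finset (Space d)) :
    IsClosed (convexHull ℝ (s : Set (Space d))) :=
  (s.finite_toSet.isCompact_convexHull ℝ).isClosed

lemma cell_subset_convexHull (s : Finset (Space d)) :
    cell s ⊆ convexHull ℝ (s : Set (Space d)) := interior_subset

lemma cell_subset {s : Finset (Space d)} (hs : s ∈ D.simplices) : cell s ⊆ K :=
  interior_subset.trans (D.convexHull_subset hs)

lemma volume_convexHull_diff_cell (s : Finset (Space d)) :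
    volume (convexHull ℝ (s : Set (Space d)) \ cell s) = 0 := by
  have := (convex_convexHull ℝ (s : Set (Space d))).addHaar_frontier volume
  rwa [frontier, (isClosed_convexHull_finset s).closure_eq] at this

lemma cell_ae_eq (s : Finset (Space d)) :
    (convexHull ℝ (s : Set (Space d)) : Set (Space d)) =ᵐ[volume] cell s :=
  (ae_le_set.2 (volume_convexHull_diff_cell s)).antisymm
    (cell_subset_convexHull s).eventuallyLE

/-- Two distinct d-simplices of the mesh meet inside the hull of their at most d common vertices, a
null set; an open null set is empty. -/
lemma disjoint_cell {s t : Finset (Space d)} (hs : s ∈ D.simplices) (ht : t ∈ D.simplices)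
    (hst : s ≠ t) : Disjoint (cell s) (cell t) := by
  classical
  rw [D.mem_simplices] at hs ht
  rw [disjoint_iff_inter_eq_empty]
  have hopen : IsOpen (cell s ∩ cell t) := (isOpen_cell s).inter (isOpen_cell t)
  rw [← hopen.measure_eq_zero_iff (μ := (volume : Measure (Space d)))]
  have hcard : (s ∩ t).card ≤ d := by
    by_contra! hlt
    have h1 : s ∩ t = s := Finset.eq_of_subset_of_card_le Finset.inter_subset_left (by omega)
    have h2 : s ∩ t = t := Finset.eq_of_subset_of_card_le Finset.inter_subset_right (by omega)
    exact hst (h1.symm.trans h2)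
  refine measure_mono_null ?_ (volume_convexHull_of_card_le hcard)
  rw [Finset.coe_inter]
  exact (inter_subset_inter interior_subset interior_subset).trans
    (D.mesh.inter_subset_convexHull hs.1 ht.1)

lemma volume_diff_iUnion_convexHull :
    volume (K \ ⋃ s ∈ D.simplices, convexHull ℝ (s : Set (Space d))) = 0 := by
  have hsub : K \ ⋃ s ∈ D.simplices, convexHull ℝ (s : Set (Space d)) ⊆
      ⋃ s ∈ D.finite_faces.toFinset.filter (fun s => s.card ≠ d + 1),
        convexHull ℝ (s : Set (Space d)) := by
    rintro x ⟨hx, hx'⟩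
    rw [← D.space_eq, Geometry.SimplicialComplex.mem_space_iff] at hx
    obtain ⟨s, hs, hxs⟩ := hx
    refine mem_biUnion (x := s) ?_ hxs
    simp only [Finset.coe_filter, mem_ofPred_eq, Set.Finite.mem_toFinset, hs, true_and]
    intro hc
    exact hx' (mem_biUnion (x := s) (D.mem_simplices.2 ⟨hs, hc⟩) hxs)
  refine measure_mono_null hsub ((measure_biUnion_null_iff (Finset.countable_toSet _)).2
    fun s hs => volume_convexHull_of_card_le ?_)
  simp only [Finset.coe_filter, mem_ofPred_eq, Set.Finite.mem_toFinset] at hs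
  have := (D.mesh.indep hs.1).card_le_finrank_succ
  rw [Fintype.card_coe] at this
  have h2 := Submodule.finrank_le (vectorSpan ℝ (range ((↑) : s → Space d)))
  rw [finrank_euclideanSpace_fin] at h2
  omega

lemma ae_mem_cell : ∀ᵐ x ∂volume.restrict K, x ∈ ⋃ s ∈ D.simplices, cell s := by
  have h1 : volume (K \ ⋃ s ∈ D.simplices, cell s) = 0 := by
    refine measure_mono_null (t := (K \ ⋃ s ∈ D.simplices, convexHull ℝ (s : Set (Space d))) ∪
      ⋃ s ∈ D.simplices, convexHull ℝ (s : Set (Space d)) \ cell s) ?_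
      (measure_union_null D.volume_diff_iUnion_convexHull
        ((measure_biUnion_null_iff (Finset.countable_toSet _)).2
          fun s _ => volume_convexHull_diff_cell s))
    rintro x ⟨hx, hx'⟩
    by_cases h : x ∈ ⋃ s ∈ D.simplices, convexHull ℝ (s : Set (Space d))
    · right
      obtain ⟨s, hs, hxs⟩ := mem_iUnion₂.1 h
      exact mem_biUnion (x := s) hs ⟨hxs, fun hc => hx' (mem_biUnion (x := s) hs hc)⟩
    · exact Or.inl ⟨hx, h⟩
  have hm : MeasurableSet (⋃ s ∈ D.simplices, cell s) :=
    .biUnion (Finset.countable_toSet _) fun s _ => measurableSet_cell s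
  rw [ae_iff, Measure.restrict_apply (by exact hm.compl)]
  convert h1 using 2
  ext x; simp [and_comm]

/-- If `K` is the support of a measure with a density, it is covered by the `d`-simplices. -/
lemma exists_mem_convexHull {ρbar : Space d → ℝ} (hK : (densityMeasure ρbar).support = K)
    {x : Space d} (hx : x ∈ K) : ∃ s ∈ D.simplices, x ∈ convexHull ℝ (s : Set (Space d)) := by
  by_contra! hno
  have hclosed : IsClosed (⋃ s ∈ D.simplices, convexHull ℝ (s : Set (Space d))) :=
    Set.Finite.isClosed_biUnion (Finset.finite_toSet _) fun s _ => isClosed_convexHull_finset s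
  rw [← hK, Measure.mem_support_iff_forall] at hx
  -- The complement of the closed union of d-simplices would be a neighbourhood of a support point,
  -- hence of positive mass, yet the remaining faces are null.
  have h1 := hx _ (hclosed.isOpen_compl.mem_nhds (by simpa using hno))
  refine h1.ne' ?_
  have hac : densityMeasure ρbar ≪ volume := withDensity_absolutelyContinuous _ _
  refine measure_mono_null (t := (K \ ⋃ s ∈ D.simplices, convexHull ℝ (s : Set (Space d))) ∪ Kᶜ) ?_
    (measure_union_null (hac D.volume_diff_iUnion_convexHull) ?_)
  · intro y hy
    by_cases hyK : y ∈ K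
    · exact Or.inl ⟨hyK, hy⟩
    · exact Or.inr hyK
  · rw [← hK]; exact Measure.measure_compl_support

/-- The mean value of the reference density over a simplex. -/
noncomputable def cellMean (ρbar : Space d → ℝ) (s : Finset (Space d)) : ℝ :=
  (∫ x in convexHull ℝ (s : Set (Space d)), ρbar x) /
    volume.real (convexHull ℝ (s : Set (Space d)))

lemma refDensity_eq (ρbar : Space d → ℝ) : D.refDensity ρbar = fun ω =>
    ∑ s ∈ D.simplices, (cell s).indicator (fun _ => cellMean ρbar s) ω := rfl

/-- On a cell, a step function takes the value that belongs to that cell. -/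
lemma sum_indicator_cell (c : Finset (Space d) → ℝ) {s : Finset (Space d)} (hs : s ∈ D.simplices)
    {ω : Space d} (hω : ω ∈ cell s) :
    ∑ t ∈ D.simplices, (cell t).indicator (fun _ => c t) ω = c s := by
  rw [Finset.sum_eq_single s, indicator_of_mem hω]
  · intro t ht hts
    exact indicator_of_notMem (fun h => disjoint_left.1 (D.disjoint_cell ht hs hts) h hω) _
  · exact fun h => absurd hs h

variable {ρbar : Space d → ℝ}

lemma cellMean_nonneg (hρ : IsProbDensity ρbar) (s : Finset (Space d)) : 0 ≤ cellMean ρbar s :=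
  div_nonneg (integral_nonneg_of_ae (ae_restrict_of_ae hρ.nonneg)) measureReal_nonneg

lemma refDensity_nonneg (hρ : IsProbDensity ρbar) (ω : Space d) : 0 ≤ D.refDensity ρbar ω :=
  Finset.sum_nonneg fun s _ => indicator_nonneg (fun _ _ => cellMean_nonneg hρ s) ω

lemma measurable_refDensity : Measurable (D.refDensity ρbar) := by
  rw [refDensity_eq]
  exact Finset.measurable_sum _ fun s _ => measurable_const.indicator (measurableSet_cell s)

lemma densityMeasure_refDensity (hρ : IsProbDensity ρbar) :
    densityMeasure (D.refDensity ρbar) =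
      ∑ s ∈ D.simplices, ENNReal.ofReal (cellMean ρbar s) • volume.restrict (cell s) :=
  densityMeasure_sum_indicator _ _ (fun s _ => measurableSet_cell s) _
    fun s _ => cellMean_nonneg hρ s

/-- Averaging preserves the mass of each cell, the cells fill `K` up to a null set, and `K` carries
all the mass of `ρbar`. -/
lemma isProbabilityMeasure_refDensity (hρ : IsProbDensity ρbar)
    (hK : (densityMeasure ρbar).support = K) :
    IsProbabilityMeasure (densityMeasure (D.refDensity ρbar)) := by
  refine ⟨?_⟩
  have hval : ∀ s, ENNReal.ofReal (cellMean ρbar s) * volume (cell s) =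
      ENNReal.ofReal (∫ x in cell s, ρbar x) := fun s => by
    have hfin : volume (convexHull ℝ (s : Set (Space d))) ≠ ∞ :=
      (s.finite_toSet.isCompact_convexHull ℝ).measure_lt_top.ne
    rw [← measure_congr (cell_ae_eq s), ← ENNReal.ofReal_toReal hfin,
      ← ENNReal.ofReal_mul (cellMean_nonneg hρ s), ← setIntegral_congr_set (cell_ae_eq s), cellMean]
    congr 1
    -- A null hull causes no trouble: the mean is 0 by the convention on division, and so is the
    -- integral.
    rcases eq_or_ne (volume.real (convexHull ℝ (s : Set (Space d)))) 0 with h0 | h0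
    · have : volume (convexHull ℝ (s : Set (Space d))) = 0 := by
        rwa [measureReal_eq_zero_iff hfin] at h0
      rw [Measure.restrict_eq_zero.2 this]; simp
    · exact div_mul_cancel₀ _ h0
  rw [D.densityMeasure_refDensity hρ, Measure.finsetSum_apply]
  simp only [Measure.smul_apply, Measure.restrict_apply_univ, smul_eq_mul, hval]
  rw [← ENNReal.ofReal_sum_of_nonneg
      fun s _ => integral_nonneg_of_ae (ae_restrict_of_ae hρ.nonneg),
    ← integral_biUnion_finset _ (fun s _ => measurableSet_cell s)
      (fun s hs t ht hst => D.disjoint_cell hs ht hst) fun s _ => hρ.integrable.integrableOn]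
  rw [← ENNReal.ofReal_one, ← hρ.mass]
  congr 1
  change ∫ x in ⋃ s ∈ D.simplices, cell s, ρbar x = ∫ x, ρbar x
  rw [← integral_indicator (Finset.measurableSet_biUnion _ fun s _ => measurableSet_cell s)]
  refine integral_congr_ae ?_
  have hKm : MeasurableSet K := hK ▸ Measure.isClosed_support.measurableSet
  have h1 : ∀ᵐ x, x ∉ K → ρbar x ≤ 0 := by
    have h2 : (densityMeasure ρbar) Kᶜ = 0 := by rw [← hK]; exact Measure.measure_compl_support
    rw [densityMeasure, withDensity_apply_eq_zero' hρ.integrable.aemeasurable.ennreal_ofReal] at h2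
    filter_upwards [measure_eq_zero_iff_ae_notMem.1 h2] with x hx hxK
    by_contra! hpos
    exact hx ⟨by simpa using hpos, hxK⟩
  filter_upwards [h1, hρ.nonneg, (ae_restrict_iff' hKm).1 D.ae_mem_cell] with x hx hx0 hxc
  by_cases hxK : x ∈ K
  · rw [indicator_of_mem (hxc hxK)]
  · rw [le_antisymm (hx hxK) hx0]
    exact indicator_apply_eq_zero.2 fun _ => le_antisymm (hx hxK) hx0

end Discretization

/-! ### Affine pieces of the Lagrangian maps and the push-forward density -/

namespace Discretization

variable {d : ℕ} {K : Set (Space d)} (D : Discretization K) {ρbar : Space d → ℝ}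
  {G : Space d → Space d}

/-- A choice of the affine pieces of a map in the ansatz space. -/
structure AffinePieces (D : Discretization K) (G : Space d → Space d) where
  A : Finset (Space d) → Space d →ₗ[ℝ] Space d
  b : Finset (Space d) → Space d
  det_pos : ∀ s ∈ D.simplices, 0 < LinearMap.det (A s)
  eq : ∀ s ∈ D.simplices, ∀ ω ∈ convexHull ℝ (s : Set (Space d)), G ω = A s ω + b s

variable {D}

lemma nonempty_affinePieces (hG : G ∈ D.ansatz) : Nonempty (D.AffinePieces G) := by
  choose! A b hA using hG.2
  exact ⟨⟨A, b, fun s hs => (hA s hs).1, fun s hs => (hA s hs).2⟩⟩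

namespace AffinePieces

variable (P : D.AffinePieces G) {s : Finset (Space d)}

lemma hasFDerivAt_affine (s : Finset (Space d)) (ω : Space d) :
    HasFDerivAt (fun x => P.A s x + P.b s) (LinearMap.toContinuousLinearMap (P.A s)) ω := by
  have := (LinearMap.toContinuousLinearMap (P.A s)).hasFDerivAt (x := ω)
  exact this.add_const _

lemma hasFDerivAt (hs : s ∈ D.simplices) {ω : Space d} (hω : ω ∈ cell s) :
    HasFDerivAt G (LinearMap.toContinuousLinearMap (P.A s)) ω := by
  refine (P.hasFDerivAt_affine s ω).congr_of_eventuallyEq ?_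
  filter_upwards [(isOpen_cell s).mem_nhds hω] with x hx
  exact P.eq s hs x (cell_subset_convexHull s hx)

lemma det_fderiv (hs : s ∈ D.simplices) {ω : Space d} (hω : ω ∈ cell s) :
    (fderiv ℝ G ω).det = LinearMap.det (P.A s) := by
  rw [(P.hasFDerivAt hs hω).fderiv]; rfl

lemma injOn_affine (hs : s ∈ D.simplices) :
    Function.Injective (fun x => P.A s x + P.b s) := by
  have h1 : Function.Injective (P.A s) :=
    (LinearEquiv.ofIsUnitDet (f := P.A s) (v := Module.finBasis ℝ _) (v' := Module.finBasis ℝ _)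
      (by rw [LinearMap.det_toMatrix]; exact (P.det_pos s hs).ne'.isUnit)).injective
  intro x y hxy
  exact h1 (add_right_cancel hxy)

lemma injOn_cell (P : D.AffinePieces G) (hs : s ∈ D.simplices) : InjOn G (cell s) := by
  intro x hx y hy hxy
  rw [P.eq s hs x (cell_subset_convexHull s hx), P.eq s hs y (cell_subset_convexHull s hy)] at hxy
  exact P.injOn_affine hs hxy

lemma continuousOn_cell (P : D.AffinePieces G) (hs : s ∈ D.simplices) : ContinuousOn G (cell s) :=
  fun _ hω => (P.hasFDerivAt hs hω).continuousAt.continuousWithinAt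

lemma measurableSet_image_cell (P : D.AffinePieces G) (hs : s ∈ D.simplices) :
    MeasurableSet (G '' cell s) :=
  (measurableSet_cell s).image_of_continuousOn_injOn (P.continuousOn_cell hs) (P.injOn_cell hs)

/-- Change of variables with a constant Jacobian. Truncation by `K.indicator` does not matter on a
cell. -/
lemma map_restrict_cell (hs : s ∈ D.simplices) :
    (volume.restrict (cell s)).map (K.indicator G) =
      ENNReal.ofReal (LinearMap.det (P.A s))⁻¹ • volume.restrict (G '' cell s) := by
  set f : Space d → Space d := fun x => P.A s x + P.b s
  have hf : Measurable f :=
    (continuous_iff_continuousAt.2 fun ω => (P.hasFDerivAt_affine s ω).continuousAt).measurable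
  have hGf : EqOn G f (cell s) := fun x hx => P.eq s hs x (cell_subset_convexHull s hx)
  have h1 : (volume.restrict (cell s)).map (K.indicator G) = (volume.restrict (cell s)).map f := by
    refine Measure.map_congr ((ae_restrict_iff' (measurableSet_cell s)).2
      (ae_of_all _ fun x hx => ?_))
    rw [indicator_of_mem (D.cell_subset hs hx), hGf hx]
  have h2 := map_withDensity_abs_det_fderiv_eq_addHaar (volume : Measure (Space d))
    (measurableSet_cell s).nullMeasurableSet
    (fun x _ => (P.hasFDerivAt_affine s x).hasFDerivWithinAt) (P.injOn_affine hs).injOn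
  have h3 : (LinearMap.toContinuousLinearMap (P.A s)).det = LinearMap.det (P.A s) := rfl
  have hpos := P.det_pos s hs
  rw [h3, abs_of_pos hpos, withDensity_const, Measure.map_smul] at h2
  rw [h1, hGf.image_eq, ← h2, smul_smul, ← ENNReal.ofReal_mul (by positivity),
    inv_mul_cancel₀ hpos.ne', ENNReal.ofReal_one, one_smul]

/-- The density of the push-forward. -/
noncomputable def pushStep (P : D.AffinePieces G) (ρbar : Space d → ℝ) : Space d → ℝ := fun x =>
  ∑ s ∈ D.simplices, (G '' cell s).indicator
    (fun _ => cellMean ρbar s / LinearMap.det (P.A s)) x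

/-- The contribution of one cell to the density of the push-forward, in Lagrangian coordinates. -/
noncomputable def cellStep (P : D.AffinePieces G) (ρbar : Space d → ℝ) : Space d → ℝ := fun ω =>
  ∑ s ∈ D.simplices, (cell s).indicator (fun _ => cellMean ρbar s / LinearMap.det (P.A s)) ω

lemma div_det_nonneg (hρ : IsProbDensity ρbar) (hs : s ∈ D.simplices) :
    0 ≤ cellMean ρbar s / LinearMap.det (P.A s) :=
  div_nonneg (cellMean_nonneg hρ s) (P.det_pos s hs).le

lemma measurable_pushStep : Measurable (P.pushStep ρbar) :=
  Finset.measurable_sum _ fun _ hs => measurable_const.indicator (P.measurableSet_image_cell hs)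

lemma measurable_cellStep : Measurable (P.cellStep ρbar) :=
  Finset.measurable_sum _ fun s _ => measurable_const.indicator (measurableSet_cell s)

lemma pushStep_nonneg (hρ : IsProbDensity ρbar) (x : Space d) : 0 ≤ P.pushStep ρbar x :=
  Finset.sum_nonneg fun _ hs => indicator_nonneg (fun _ _ => P.div_det_nonneg hρ hs) x

lemma cellStep_nonneg (hρ : IsProbDensity ρbar) (x : Space d) : 0 ≤ P.cellStep ρbar x :=
  Finset.sum_nonneg fun _ hs => indicator_nonneg (fun _ _ => P.div_det_nonneg hρ hs) x

/-- The cell of ω contributes one term to the density at `G ω`; other cells whose images overlap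
there can only add to it. -/
lemma cellStep_le_pushStep (hρ : IsProbDensity ρbar) {ω : Space d}
    (hω : ω ∈ ⋃ s ∈ D.simplices, cell s) : P.cellStep ρbar ω ≤ P.pushStep ρbar (G ω) := by
  obtain ⟨s, hs, hωs⟩ := mem_iUnion₂.1 hω
  rw [cellStep, D.sum_indicator_cell _ hs hωs]
  refine le_trans ?_ (Finset.single_le_sum
    (fun t ht => indicator_nonneg (fun _ _ => P.div_det_nonneg hρ ht) _) hs)
  rw [indicator_of_mem (mem_image_of_mem G hωs)]

/-- A second cell contributing at `G ω` would supply another preimage. It lies outside `N` because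
`G ω` is not hit from `N`, which contradicts injectivity. -/
lemma cellStep_eq_pushStep {N : Set (Space d)} (hN : InjOn G (K \ N)) {ω : Space d}
    (hω : ω ∈ ⋃ s ∈ D.simplices, cell s) (hωN : ω ∉ N) (hGω : G ω ∉ G '' (K ∩ N)) :
    P.cellStep ρbar ω = P.pushStep ρbar (G ω) := by
  obtain ⟨s, hs, hωs⟩ := mem_iUnion₂.1 hω
  rw [cellStep, D.sum_indicator_cell _ hs hωs, pushStep, Finset.sum_eq_single s,
    indicator_of_mem (mem_image_of_mem G hωs)]
  · refine fun t ht hts => indicator_of_notMem ?_ _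
    rintro ⟨ω', hω', he⟩
    have hK' := D.cell_subset ht hω'
    have hωN' : ω' ∉ N := fun h => hGω ⟨ω', ⟨hK', h⟩, he⟩
    have := hN ⟨hK', hωN'⟩ ⟨D.cell_subset hs hωs, hωN⟩ he
    subst this
    exact disjoint_left.1 (D.disjoint_cell ht hs hts) hω' hωs
  · exact fun h => absurd hs h

/-- On all of `K` the map agrees pointwise with one of finitely many affine maps, each of which
preserves null sets. Covering `K` only up to a null set would not suffice. -/
lemma volume_image_null (P : D.AffinePieces G) (hK : (densityMeasure ρbar).support = K)
    {N : Set (Space d)} (hN : volume N = 0) : volume (G '' (K ∩ N)) = 0 := by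
  have hsub : G '' (K ∩ N) ⊆ ⋃ s ∈ D.simplices, (fun x => P.A s x + P.b s) '' N := by
    rintro _ ⟨ω, ⟨hωK, hωN⟩, rfl⟩
    obtain ⟨s, hs, hωs⟩ := D.exists_mem_convexHull hK hωK
    exact mem_biUnion (x := s) hs ⟨ω, hωN, (P.eq s hs ω hωs).symm⟩
  refine measure_mono_null hsub ((measure_biUnion_null_iff (Finset.countable_toSet _)).2
    fun s _ => addHaar_image_eq_zero_of_differentiableOn_of_addHaar_eq_zero volume
      (fun x _ => (P.hasFDerivAt_affine s x).differentiableAt.differentiableWithinAt) hN)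

end AffinePieces

/-- Maps in the ansatz space are arbitrary outside `K`; setting them to 0 there gives Borel maps
without changing anything for the reference measure. -/
lemma measurable_indicator_of_mem_ansatz (hKc : IsClosed K) (hG : G ∈ D.ansatz) :
    Measurable (K.indicator G) := by
  classical
  rw [← piecewise_eq_indicator]
  exact hG.1.measurable_piecewise continuousOn_const hKc.measurableSet

lemma ae_refDensity_mem_cell (hρ : IsProbDensity ρbar) :
    ∀ᵐ ω ∂densityMeasure (D.refDensity ρbar), ω ∈ ⋃ s ∈ D.simplices, cell s := by
  rw [D.densityMeasure_refDensity hρ, ae_iff, Measure.finsetSum_apply]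
  refine Finset.sum_eq_zero fun s hs => ?_
  rw [Measure.smul_apply]
  have : volume.restrict (cell s) {ω | ω ∉ ⋃ s ∈ D.simplices, cell s} = 0 := by
    rw [← ae_iff, ae_restrict_iff' (measurableSet_cell s)]
    exact ae_of_all _ fun ω hω => mem_biUnion (x := s) hs hω
  rw [this, smul_zero]

lemma ae_refDensity_mem (hρ : IsProbDensity ρbar) :
    ∀ᵐ ω ∂densityMeasure (D.refDensity ρbar), ω ∈ K := by
  filter_upwards [D.ae_refDensity_mem_cell hρ] with ω hω
  obtain ⟨s, hs, hωs⟩ := mem_iUnion₂.1 hω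
  exact D.cell_subset hs hωs

lemma AffinePieces.map_refDensity (P : D.AffinePieces G) (hρ : IsProbDensity ρbar)
    (hKc : IsClosed K) (hG : G ∈ D.ansatz) :
    (densityMeasure (D.refDensity ρbar)).map (K.indicator G) =
      densityMeasure (P.pushStep ρbar) := by
  rw [D.densityMeasure_refDensity hρ,
    Measure.map_finset_sum (measurable_indicator_of_mem_ansatz hKc hG).aemeasurable]
  unfold AffinePieces.pushStep
  rw [densityMeasure_sum_indicator _ _ (fun s hs => P.measurableSet_image_cell hs) _
    fun s hs => P.div_det_nonneg hρ hs]
  refine Finset.sum_congr rfl fun s hs => ?_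
  rw [Measure.map_smul, P.map_restrict_cell hs, smul_smul,
    ← ENNReal.ofReal_mul (cellMean_nonneg hρ s), div_eq_mul_inv]

lemma map_refDensity_eq (hρ : IsProbDensity ρbar) :
    (densityMeasure (D.refDensity ρbar)).map G =
      (densityMeasure (D.refDensity ρbar)).map (K.indicator G) := by
  refine Measure.map_congr ?_
  filter_upwards [D.ae_refDensity_mem hρ] with ω hω
  rw [indicator_of_mem hω]

lemma AffinePieces.pushDensity_ae_eq (P : D.AffinePieces G) (hρ : IsProbDensity ρbar)
    (hKc : IsClosed K) (hG : G ∈ D.ansatz) :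
    pushDensity G (D.refDensity ρbar) =ᵐ[volume] P.pushStep ρbar := by
  have h1 : ((densityMeasure (D.refDensity ρbar)).map G).rnDeriv volume =ᵐ[volume]
      fun x => ENNReal.ofReal (P.pushStep ρbar x) := by
    rw [map_refDensity_eq hρ, P.map_refDensity hρ hKc hG]
    exact Measure.rnDeriv_withDensity _ P.measurable_pushStep.ennreal_ofReal
  filter_upwards [h1] with x hx
  rw [pushDensity, hx, ENNReal.toReal_ofReal (P.pushStep_nonneg hρ x)]

lemma densityMeasure_congr {ρ σ : Space d → ℝ} (h : ρ =ᵐ[volume] σ) :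
    densityMeasure ρ = densityMeasure σ :=
  withDensity_congr_ae (h.mono fun x hx => by simp only [hx])

lemma densityMeasure_pushDensity (hρ : IsProbDensity ρbar) (hKc : IsClosed K)
    (hG : G ∈ D.ansatz) :
    densityMeasure (pushDensity G (D.refDensity ρbar)) =
      (densityMeasure (D.refDensity ρbar)).map (K.indicator G) := by
  obtain ⟨P⟩ := nonempty_affinePieces hG
  rw [densityMeasure_congr (P.pushDensity_ae_eq hρ hKc hG), P.map_refDensity hρ hKc hG]

end Discretization

/-! ### Eulerian and Lagrangian energies; the discrete velocity -/

lemma IsInternalEnergy.measurable_energyDensity {α : Type*} [MeasurableSpace α] {h : ℝ → ℝ}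
    (hh : IsInternalEnergy h) {σ W : α → ℝ} (hσ : Measurable σ) (hσ0 : ∀ x, 0 ≤ σ x)
    (hW : Measurable W) : Measurable fun x => ENNReal.ofReal (h (σ x) / σ x + W x) := by
  have hm : Measurable fun x => h (σ x) := by
    simpa [Function.comp_def, hσ0] using hh.measurable_comp_max.comp hσ
  exact ((hm.div hσ).add hW).ennreal_ofReal

/-- Writing the energy per unit mass makes it an integral against the measure itself, which can be
transported by push-forward. Points of zero density are harmless because h(0) = 0. -/
lemma energy_eq_lintegral {d : ℕ} {h : ℝ → ℝ} (hh : IsInternalEnergy h) {V : Space d → ℝ}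
    (hV : Measurable V) {σ : Space d → ℝ} (hσ : Measurable σ) (hσ0 : ∀ x, 0 ≤ σ x) :
    energy h V σ = ∫⁻ x, ENNReal.ofReal (h (σ x) / σ x + V x) ∂densityMeasure σ := by
  rw [densityMeasure, lintegral_withDensity_eq_lintegral_mul _ hσ.ennreal_ofReal
    (hh.measurable_energyDensity hσ hσ0 hV), energy]
  refine lintegral_congr fun x => ?_
  rw [Pi.mul_apply, ← ENNReal.ofReal_mul (hσ0 x)]
  congr 1
  rcases eq_or_ne (σ x) 0 with h0 | h0
  · simp [h0, hh.zero]
  · field_simp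

lemma energy_congr {d : ℕ} {h : ℝ → ℝ} {V : Space d → ℝ} {ρ σ : Space d → ℝ}
    (hρσ : ρ =ᵐ[volume] σ) : energy h V ρ = energy h V σ :=
  lintegral_congr_ae (hρσ.mono fun x hx => by simp only [hx])

lemma hTilde_div (h : ℝ → ℝ) (a c : ℝ) : hTilde h (a / c) = h (c / a) / (c / a) := by
  rw [hTilde, inv_div, div_div_eq_mul_div, div_mul_eq_mul_div, mul_comm]

namespace Discretization

variable {d : ℕ} {K : Set (Space d)} {D : Discretization K} {ρbar : Space d → ℝ}
  {G : Space d → Space d} {h : ℝ → ℝ} {V : Space d → ℝ}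

lemma refDensity_eq_zero {ω : Space d} (hω : ω ∉ K) : D.refDensity ρbar ω = 0 :=
  Finset.sum_eq_zero fun _ hs => indicator_of_notMem (fun hc => hω (D.cell_subset hs hc)) _

lemma lintegral_refDensity {g : Space d → ℝ≥0∞} (hg : Measurable g) :
    ∫⁻ ω, g ω ∂densityMeasure (D.refDensity ρbar) =
      ∫⁻ ω in K, ENNReal.ofReal (D.refDensity ρbar ω) * g ω := by
  rw [densityMeasure, lintegral_withDensity_eq_lintegral_mul _
    D.measurable_refDensity.ennreal_ofReal hg]
  refine (setLIntegral_eq_of_support_subset fun ω hω => ?_).symm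
  by_contra hK
  simp [refDensity_eq_zero hK] at hω

lemma AffinePieces.lagrangianEnergy_eq (P : D.AffinePieces G) (hh : IsInternalEnergy h)
    (hV : Measurable V) (hρ : IsProbDensity ρbar) (hKc : IsClosed K)
    (hG : G ∈ D.ansatz) :
    lagrangianEnergy h V K (D.refDensity ρbar) G =
      ∫⁻ ω, ENNReal.ofReal (h (P.cellStep ρbar ω) / P.cellStep ρbar ω + V (K.indicator G ω))
        ∂densityMeasure (D.refDensity ρbar) := by
  have hVX : Measurable fun ω => V (K.indicator G ω) :=
    hV.comp (measurable_indicator_of_mem_ansatz hKc hG)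
  rw [lintegral_refDensity (hh.measurable_energyDensity P.measurable_cellStep
    (P.cellStep_nonneg hρ) hVX), lagrangianEnergy]
  refine lintegral_congr_ae ?_
  filter_upwards [D.ae_mem_cell] with ω hω
  obtain ⟨s, hs, hωs⟩ := mem_iUnion₂.1 hω
  rw [← ENNReal.ofReal_mul (D.refDensity_nonneg hρ ω), indicator_of_mem (D.cell_subset hs hωs),
    P.det_fderiv hs hωs, hTilde_div, mul_comm, cellStep, refDensity_eq]
  simp only [D.sum_indicator_cell _ hs hωs]

lemma AffinePieces.energy_eq (P : D.AffinePieces G) (hh : IsInternalEnergy h)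
    (hV : Measurable V) (hρ : IsProbDensity ρbar) (hKc : IsClosed K) (hG : G ∈ D.ansatz) :
    energy h V (pushDensity G (D.refDensity ρbar)) =
      ∫⁻ ω, ENNReal.ofReal (h (P.pushStep ρbar (K.indicator G ω)) /
        P.pushStep ρbar (K.indicator G ω) + V (K.indicator G ω))
        ∂densityMeasure (D.refDensity ρbar) := by
  rw [energy_congr (P.pushDensity_ae_eq hρ hKc hG),
    energy_eq_lintegral hh hV P.measurable_pushStep (P.pushStep_nonneg hρ),
    ← P.map_refDensity hρ hKc hG, lintegral_map _ (measurable_indicator_of_mem_ansatz hKc hG)]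
  exact hh.measurable_energyDensity P.measurable_pushStep (P.pushStep_nonneg hρ) hV

/-- No injectivity is needed: overlaps increase the Eulerian density, and h(s)/s is nondecreasing.
This is what serves step 0, where injectivity is not assumed. -/
lemma lagrangianEnergy_le_energy (hh : IsInternalEnergy h)
    (hV : Measurable V) (hρ : IsProbDensity ρbar) (hKc : IsClosed K)
    (hG : G ∈ D.ansatz) :
    lagrangianEnergy h V K (D.refDensity ρbar) G ≤
      energy h V (pushDensity G (D.refDensity ρbar)) := by
  obtain ⟨P⟩ := nonempty_affinePieces hG
  rw [P.lagrangianEnergy_eq hh hV hρ hKc hG, P.energy_eq hh hV hρ hKc hG]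
  refine lintegral_mono_ae ?_
  filter_upwards [D.ae_refDensity_mem_cell hρ, D.ae_refDensity_mem hρ] with ω hω hωK
  have h1 := P.cellStep_le_pushStep hρ hω
  rw [indicator_of_mem hωK]
  exact ENNReal.ofReal_le_ofReal
    (add_le_add_left (hh.div_self_mono (P.cellStep_nonneg hρ ω) h1) _)

lemma refDensity_absolutelyContinuous :
    densityMeasure (D.refDensity ρbar) ≪ volume := withDensity_absolutelyContinuous _ _

/-- Almost every point of the image has only one preimage. -/
lemma ae_notMem_image (hρ : IsProbDensity ρbar) (hK : (densityMeasure ρbar).support = K)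
    (hG : G ∈ D.ansatz) {N : Set (Space d)} (hN : volume N = 0) :
    ∀ᵐ ω ∂densityMeasure (D.refDensity ρbar), K.indicator G ω ∉ G '' (K ∩ N) := by
  obtain ⟨P⟩ := nonempty_affinePieces hG
  have hKc : IsClosed K := hK ▸ Measure.isClosed_support
  have h1 : (densityMeasure (D.refDensity ρbar)).map (K.indicator G) ≪ volume := by
    rw [P.map_refDensity hρ hKc hG]; exact withDensity_absolutelyContinuous _ _
  exact ae_of_ae_map (measurable_indicator_of_mem_ansatz hKc hG).aemeasurable
    (measure_eq_zero_iff_ae_notMem.1 (h1 (P.volume_image_null hK hN)))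

/-- Under injectivity up to null sets, almost no point sees an overlap, so the integrands agree
almost everywhere. -/
lemma energy_eq_lagrangianEnergy (hh : IsInternalEnergy h)
    (hV : Measurable V) (hρ : IsProbDensity ρbar)
    (hK : (densityMeasure ρbar).support = K) (hG : G ∈ D.ansatz)
    (hinj : ∃ N : Set (Space d), volume N = 0 ∧ InjOn G (K \ N)) :
    energy h V (pushDensity G (D.refDensity ρbar)) =
      lagrangianEnergy h V K (D.refDensity ρbar) G := by
  obtain ⟨P⟩ := nonempty_affinePieces hG
  obtain ⟨N, hN0, hN⟩ := hinj
  have hKc : IsClosed K := hK ▸ Measure.isClosed_support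
  rw [P.lagrangianEnergy_eq hh hV hρ hKc hG, P.energy_eq hh hV hρ hKc hG]
  refine lintegral_congr_ae ?_
  filter_upwards [D.ae_refDensity_mem_cell hρ, D.ae_refDensity_mem hρ,
    ae_notMem_image hρ hK hG hN0,
    refDensity_absolutelyContinuous.ae_le (measure_eq_zero_iff_ae_notMem.1 hN0)]
    with ω hω hωK hGω hωN
  rw [indicator_of_mem hωK] at hGω ⊢
  rw [P.cellStep_eq_pushStep hN hω hωN hGω]

/-- The velocity is almost everywhere determined by the Lagrangian maps. -/
lemma velocity_spec (hρ : IsProbDensity ρbar) (hK : (densityMeasure ρbar).support = K)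
    {G : ℕ → Space d → Space d} (hG : ∀ n, G n ∈ D.ansatz) (n : ℕ)
    (hinj : ∃ N : Set (Space d), volume N = 0 ∧ InjOn (G n) (K \ N)) :
    AEStronglyMeasurable (D.velocity G n)
      ((densityMeasure (D.refDensity ρbar)).map (K.indicator (G n))) ∧
    ∀ᵐ ω ∂densityMeasure (D.refDensity ρbar), D.velocity G n (K.indicator (G n) ω) =
      D.τ⁻¹ • (K.indicator (G n) ω - K.indicator (G (n - 1)) ω) := by
  obtain ⟨N₀, hN₀, hinj₀⟩ := hinj
  -- The exceptional set is enlarged to a measurable null set, so that its complement in `K` is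
  -- Borel.
  set N := toMeasurable volume N₀ with hNdef
  have hN : volume N = 0 := by rw [hNdef, measure_toMeasurable, hN₀]
  have hinj : InjOn (G n) (K \ N) :=
    hinj₀.mono (sdiff_subset_sdiff_right (subset_toMeasurable _ _))
  have hKc : IsClosed K := hK ▸ Measure.isClosed_support
  have hXm := fun n => measurable_indicator_of_mem_ansatz hKc (hG n)
  set S := K \ N with hS
  have hSm : MeasurableSet S := hKc.measurableSet.diff (measurableSet_toMeasurable _ _)
  have hSae : ∀ᵐ ω ∂densityMeasure (D.refDensity ρbar), ω ∈ S := by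
    filter_upwards [D.ae_refDensity_mem hρ,
      refDensity_absolutelyContinuous.ae_le (measure_eq_zero_iff_ae_notMem.1 hN)] with ω h1 h2
    exact ⟨h1, h2⟩
  have hinv : ∀ ω ∈ S, G n ω ∉ G n '' (K ∩ N) → D.velocity G n (G n ω) =
      D.τ⁻¹ • (K.indicator (G n) ω - K.indicator (G (n - 1)) ω) := by
    -- `invFunOn` picks some preimage in `K`; it is not in `N` because the image point is not hit
    -- from `N`, hence it is ω.
    intro ω hω hGω
    have hex : ∃ a ∈ K, G n a = G n ω := ⟨ω, hω.1, rfl⟩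
    have h1 : Function.invFunOn (G n) K (G n ω) ∈ K := Function.invFunOn_mem hex
    have h2 : G n (Function.invFunOn (G n) K (G n ω)) = G n ω := Function.invFunOn_eq hex
    have h3 : Function.invFunOn (G n) K (G n ω) = ω :=
      hinj ⟨h1, fun h => hGω ⟨_, ⟨h1, h⟩, h2⟩⟩ hω h2
    rw [velocity, h3, indicator_of_mem hω.1, indicator_of_mem hω.1]
  refine ⟨?_, ?_⟩
  · have hemb : MeasurableEmbedding (S.domRestrict (G n)) :=
      ((hG n).1.mono sdiff_subset).measurableEmbedding hSm hinj
    have hZ : Measurable fun ω =>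
        D.τ⁻¹ • (K.indicator (G n) ω - K.indicator (G (n - 1)) ω) :=
      ((hXm n).sub (hXm (n - 1))).const_smul D.τ⁻¹
    -- On `S` the map is a measurable embedding, so the difference quotient composed with its
    -- inverse extends to a Borel field `w`, a version of the velocity.
    obtain ⟨w, hw, hwG⟩ := hemb.exists_measurable_extend (hZ.comp measurable_subtype_coe)
      (fun _ => ⟨0⟩)
    have hGS : MeasurableSet (G n '' S) :=
      hSm.image_of_continuousOn_injOn ((hG n).1.mono sdiff_subset) hinj
    refine ⟨w, hw.stronglyMeasurable, ?_⟩
    have h1 : ∀ᵐ x ∂(densityMeasure (D.refDensity ρbar)).map (K.indicator (G n)),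
        x ∈ G n '' S := by
      refine (ae_map_iff (p := fun x => x ∈ G n '' S) (hXm n).aemeasurable hGS).2 ?_
      filter_upwards [hSae] with ω hω
      rw [indicator_of_mem hω.1]
      exact mem_image_of_mem _ hω
    have h2 : ∀ᵐ x ∂(densityMeasure (D.refDensity ρbar)).map (K.indicator (G n)),
        x ∉ G n '' (K ∩ N) := by
      obtain ⟨P⟩ := nonempty_affinePieces (hG n)
      rw [P.map_refDensity hρ hKc (hG n)]
      exact (withDensity_absolutelyContinuous _ _).ae_le
        (measure_eq_zero_iff_ae_notMem.1 (P.volume_image_null hK hN))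
    filter_upwards [h1, h2] with x hx1 hx2
    obtain ⟨ω, hω, rfl⟩ := hx1
    rw [hinv ω hω hx2]
    exact (congrFun hwG ⟨ω, hω⟩).symm
  · filter_upwards [hSae, ae_notMem_image hρ hK (hG n) hN] with ω hω hGω
    rw [indicator_of_mem hω.1] at hGω ⊢
    rw [hinv ω hω hGω, indicator_of_mem hω.1]

lemma lintegral_sq_refDensity (hρ : IsProbDensity ρbar) (hKc : IsClosed K)
    {G G' : Space d → Space d} (hG : G ∈ D.ansatz) (hG' : G' ∈ D.ansatz) :
    ∫⁻ ω in K, ENNReal.ofReal (‖G ω - G' ω‖ ^ 2 * D.refDensity ρbar ω) =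
      ∫⁻ ω, ‖K.indicator G ω - K.indicator G' ω‖ₑ ^ 2 ∂densityMeasure (D.refDensity ρbar) := by
  have hm : Measurable fun ω => ‖K.indicator G ω - K.indicator G' ω‖ₑ ^ 2 :=
    ((measurable_indicator_of_mem_ansatz hKc hG).sub
      (measurable_indicator_of_mem_ansatz hKc hG')).enorm.pow_const 2
  rw [lintegral_refDensity hm]
  refine setLIntegral_congr_fun hKc.measurableSet fun ω hω => ?_
  simp only [indicator_of_mem hω]
  rw [mul_comm, ENNReal.ofReal_mul (D.refDensity_nonneg hρ ω), ENNReal.ofReal_pow (norm_nonneg _),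
    ofReal_norm]

end Discretization

/-! ### Abstract discrete flows -/

/-- A discrete-time process on a probability space, with a time step. -/
structure DiscreteFlow (d : ℕ) where
  m : Measure (Space d)
  prob : IsProbabilityMeasure m
  X : ℕ → Space d → Space d
  measurable_X : ∀ n, Measurable (X n)
  τ : ℝ
  τ_pos : 0 < τ

namespace DiscreteFlow

variable {d : ℕ}

instance (F : DiscreteFlow d) : IsProbabilityMeasure F.m := F.prob

/-- The law of the process at the `n`-th time step. -/
noncomputable def law (F : DiscreteFlow d) (n : ℕ) : Measure (Space d) := F.m.map (F.X n)

/-- The total action of the process is bounded by `C`. -/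
def ActionBound (F : DiscreteFlow d) (C : ℝ≥0) : Prop :=
  ∀ N, ∑ n ∈ Finset.range N, ∫⁻ ω, ‖F.X (n + 1) ω - F.X n ω‖ₑ ^ 2 ∂F.m ≤
    C * ENNReal.ofReal F.τ

end DiscreteFlow

/-! ### Energy dissipation along the scheme -/

namespace Discretization

variable {d : ℕ} {K : Set (Space d)} {D : Discretization K} {ρbar : Space d → ℝ}
  {h : ℝ → ℝ} {V : Space d → ℝ}

/-- The previous map is an admissible competitor with zero distance term; its inequality telescopes.
The induction starts from the comparison of Lagrangian and Eulerian energy. -/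
lemma IsDiscreteSolution.energy_dissipation {G : ℕ → Space d → Space d} (hh : IsInternalEnergy h)
    (hV : Measurable V) (hρ : IsProbDensity ρbar) (hKc : IsClosed K)
    (hG : D.IsDiscreteSolution h V ρbar G) (N : ℕ) :
    ENNReal.ofReal (1 / (2 * D.τ)) * ∑ n ∈ Finset.range N,
      ∫⁻ ω, ‖K.indicator (G (n + 1)) ω - K.indicator (G n) ω‖ₑ ^ 2
        ∂densityMeasure (D.refDensity ρbar) +
      lagrangianEnergy h V K (D.refDensity ρbar) (G N) ≤ energy h V (D.density ρbar G 0) := by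
  induction N with
  | zero =>
    simpa [density] using lagrangianEnergy_le_energy hh hV hρ hKc (hG.mem_ansatz 0)
  | succ N ih =>
    have := hG.isMinimizer N (G N) (hG.mem_ansatz N)
    rw [functional, functional, lintegral_sq_refDensity hρ hKc (hG.mem_ansatz _) (hG.mem_ansatz _)]
      at this
    simp only [sub_self, norm_zero, ne_eq, OfNat.ofNat_ne_zero, not_false_eq_true, zero_pow,
      zero_mul, ENNReal.ofReal_zero, lintegral_zero, mul_zero, zero_add] at this
    rw [Finset.sum_range_succ, mul_add, add_assoc]
    exact (add_le_add_right this _).trans ih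

/-- The Lagrangian maps of a discrete solution, as a process. -/
noncomputable def flow (D : Discretization K) (ρbar : Space d → ℝ) (G : ℕ → Space d → Space d)
    (hρ : IsProbDensity ρbar) (hK : (densityMeasure ρbar).support = K)
    (hG : ∀ n, G n ∈ D.ansatz) : DiscreteFlow d where
  m := densityMeasure (D.refDensity ρbar)
  prob := D.isProbabilityMeasure_refDensity hρ hK
  X n := K.indicator (G n)
  measurable_X n := measurable_indicator_of_mem_ansatz (hK ▸ Measure.isClosed_support) (hG n)
  τ := D.τ
  τ_pos := D.τ_pos

lemma flow_law {G : ℕ → Space d → Space d}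
    (hρ : IsProbDensity ρbar) (hK : (densityMeasure ρbar).support = K)
    (hG : ∀ n, G n ∈ D.ansatz) (n : ℕ) :
    densityMeasure (D.density ρbar G n) = (D.flow ρbar G hρ hK hG).law n :=
  densityMeasure_pushDensity hρ (hK ▸ Measure.isClosed_support) (hG n)

lemma flow_actionBound {G : ℕ → Space d → Space d} (hh : IsInternalEnergy h)
    (hV : Measurable V)
    (hρ : IsProbDensity ρbar) (hK : (densityMeasure ρbar).support = K)
    (hG : D.IsDiscreteSolution h V ρbar G) {E : ℝ≥0} (hE : energy h V (D.density ρbar G 0) ≤ E) :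
    (D.flow ρbar G hρ hK hG.mem_ansatz).ActionBound (2 * E) := by
  intro N
  have h1 := le_trans (le_trans le_self_add
    (hG.energy_dissipation hh hV hρ (hK ▸ Measure.isClosed_support) N)) hE
  -- Clearing the factor 1/(2τ) is the origin of the constant 2E and of the factor τ in
  -- `ActionBound`.
  have h2 := mul_le_mul_right h1 (ENNReal.ofReal (2 * D.τ))
  have hτ := D.τ_pos
  rw [← mul_assoc, ← ENNReal.ofReal_mul (by positivity), mul_one_div_cancel (by positivity),
    ENNReal.ofReal_one, one_mul] at h2
  refine h2.trans_eq ?_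
  rw [ENNReal.ofReal_mul (by norm_num)]
  simp only [flow, ENNReal.ofReal_ofNat, ENNReal.coe_mul, ENNReal.coe_ofNat]
  ring

/-- Dissipation controls the Lagrangian energy; injectivity converts it back to the Eulerian one for
n ≥ 1. -/
lemma energy_density_le {G : ℕ → Space d → Space d} (hh : IsInternalEnergy h)
    (hV : Measurable V)
    (hρ : IsProbDensity ρbar) (hK : (densityMeasure ρbar).support = K)
    (hG : D.IsDiscreteSolution h V ρbar G)
    (hinj : ∀ n, 1 ≤ n → ∃ N : Set (Space d), volume N = 0 ∧ InjOn (G n) (K \ N)) (n : ℕ) :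
    energy h V (D.density ρbar G n) ≤ energy h V (D.density ρbar G 0) := by
  rcases Nat.eq_zero_or_pos n with rfl | hn
  · exact le_rfl
  rw [density, energy_eq_lagrangianEnergy hh hV hρ hK (hG.mem_ansatz n) (hinj n hn)]
  exact le_trans le_add_self
    (hG.energy_dissipation hh hV hρ (hK ▸ Measure.isClosed_support) n)

end Discretization

/-! ### Equicontinuity, tightness and compactness of the interpolated laws -/

namespace DiscreteFlow

variable {d : ℕ} (F : DiscreteFlow d)

instance (n : ℕ) : IsProbabilityMeasure (F.law n) :=
  Measure.isProbabilityMeasure_map (F.measurable_X n).aemeasurable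

/-- The index of the time step that contains `t`. -/
noncomputable def idx (t : ℝ) : ℕ := ⌈t / F.τ⌉₊

/-- The interpolated laws. -/
noncomputable def interp (t : ℝ) : ProbabilityMeasure (Space d) := ⟨F.law (F.idx t), inferInstance⟩

lemma coe_interp (t : ℝ) : (F.interp t : Measure (Space d)) = F.m.map (F.X (F.idx t)) := rfl

lemma measurable_idx : Measurable F.idx := Nat.measurable_ceil.comp (measurable_id.div_const _)

variable {F}

/-- Cauchy-Schwarz on the telescoping sum of increments costs the number of steps. -/
lemma ActionBound.lintegral_sq_le {C : ℝ≥0} (hF : F.ActionBound C) {i j : ℕ} (hij : i ≤ j) :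
    ∫⁻ ω, ‖F.X j ω - F.X i ω‖ₑ ^ 2 ∂F.m ≤ ((j - i : ℕ) : ℝ≥0∞) * (C * ENNReal.ofReal F.τ) := by
  have hpt : ∀ ω, ‖F.X j ω - F.X i ω‖ₑ ^ 2 ≤
      ((j - i : ℕ) : ℝ≥0∞) * ∑ n ∈ Finset.Ico i j, ‖F.X (n + 1) ω - F.X n ω‖ₑ ^ 2 := fun ω => by
    rw [← Finset.sum_Ico_sub (fun n => F.X n ω) hij]
    refine (pow_le_pow_left' (enorm_sum_le _ _) 2).trans ?_
    have := ENNReal.rpow_sum_le_const_mul_sum_rpow (Finset.Ico i j)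
      (fun n => ‖F.X (n + 1) ω - F.X n ω‖ₑ) (p := 2) one_le_two
    norm_num at this
    simpa using this
  have hm : ∀ n, Measurable fun ω => ‖F.X (n + 1) ω - F.X n ω‖ₑ ^ 2 := fun n =>
    ((F.measurable_X _).sub (F.measurable_X n)).enorm.pow_const 2
  calc ∫⁻ ω, ‖F.X j ω - F.X i ω‖ₑ ^ 2 ∂F.m
      ≤ ∫⁻ ω, ((j - i : ℕ) : ℝ≥0∞) * ∑ n ∈ Finset.Ico i j, ‖F.X (n + 1) ω - F.X n ω‖ₑ ^ 2 ∂F.m :=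
        lintegral_mono hpt
    _ = ((j - i : ℕ) : ℝ≥0∞) * ∑ n ∈ Finset.Ico i j,
          ∫⁻ ω, ‖F.X (n + 1) ω - F.X n ω‖ₑ ^ 2 ∂F.m := by
        rw [lintegral_const_mul _ (Finset.measurable_sum _ fun n _ => hm n),
          lintegral_finsetSum _ fun n _ => hm n]
    _ ≤ _ := by
        gcongr
        refine le_trans (Finset.sum_le_sum_of_subset ?_) (hF j)
        intro n hn
        simp only [Finset.mem_Ico, Finset.mem_range] at hn ⊢
        exact hn.2

/-- Rounding up loses at most one step. For t ≤ 0 both indices are 0 by the truncated ceiling. -/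
lemma idx_sub_le {s t : ℝ} (hst : s ≤ t) : ((F.idx t - F.idx s : ℕ) : ℝ) * F.τ ≤ t - s + F.τ := by
  have hτ := F.τ_pos
  rcases le_total (F.idx t) (F.idx s) with h | h
  · rw [Nat.sub_eq_zero_of_le h]
    push_cast
    linarith
  · rw [Nat.cast_sub h]
    have h1 : s / F.τ ≤ F.idx s := Nat.le_ceil _
    rcases le_total 0 t with ht | ht
    · have h2 : (F.idx t : ℝ) < t / F.τ + 1 := Nat.ceil_lt_add_one (by positivity)
      have h3 : ((F.idx t : ℝ) - F.idx s) ≤ t / F.τ + 1 - s / F.τ := by linarith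
      calc ((F.idx t : ℝ) - F.idx s) * F.τ ≤ (t / F.τ + 1 - s / F.τ) * F.τ := by gcongr
        _ = t - s + F.τ := by field_simp; ring
    · have h2 : F.idx t = 0 := Nat.ceil_eq_zero.2 (div_nonpos_of_nonpos_of_nonneg ht hτ.le)
      have h3 : F.idx s = 0 := by omega
      rw [h2, h3]
      push_cast
      linarith

lemma idx_mono {s t : ℝ} (hst : s ≤ t) : F.idx s ≤ F.idx t :=
  Nat.ceil_mono (div_le_div_of_nonneg_right hst F.τ_pos.le)

lemma ActionBound.lintegral_sq_idx_le {C : ℝ≥0} (hF : F.ActionBound C) (s t : ℝ) :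
    ∫⁻ ω, ‖F.X (F.idx t) ω - F.X (F.idx s) ω‖ₑ ^ 2 ∂F.m ≤
      C * ENNReal.ofReal (|t - s| + F.τ) := by
  wlog hst : s ≤ t generalizing s t
  · have := this t s (le_of_not_ge hst)
    rw [abs_sub_comm]
    simpa only [enorm_sub_rev] using this
  refine (hF.lintegral_sq_le (idx_mono hst)).trans ?_
  rw [mul_left_comm, ← ENNReal.ofReal_natCast, ← ENNReal.ofReal_mul (by positivity)]
  gcongr
  rw [abs_of_nonneg (sub_nonneg.2 hst)]
  exact idx_sub_le hst

lemma ActionBound.lintegral_enorm_idx_le {C : ℝ≥0} (hF : F.ActionBound C) (s t : ℝ) :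
    ∫⁻ ω, ‖F.X (F.idx t) ω - F.X (F.idx s) ω‖ₑ ∂F.m ≤
      (C * ENNReal.ofReal (|t - s| + F.τ)) ^ (1 / 2 : ℝ) := by
  have hm : Measurable fun ω => F.X (F.idx t) ω - F.X (F.idx s) ω :=
    (F.measurable_X _).sub (F.measurable_X _)
  have h1 := eLpNorm_le_eLpNorm_of_exponent_le (p := 1) (q := 2) one_le_two
    (μ := F.m) hm.aestronglyMeasurable
  rw [eLpNorm_one_eq_lintegral_enorm, eLpNorm_eq_lintegral_rpow_enorm_toReal (by simp) (by simp)]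
    at h1
  refine h1.trans ?_
  simp only [ENNReal.toReal_ofNat, ENNReal.rpow_ofNat]
  gcongr
  exact hF.lintegral_sq_idx_le s t

/-- Quantitative continuity of the interpolated laws in the bounded Lipschitz topology. -/
lemma ActionBound.dist_integral_le {C : ℝ≥0} (hF : F.ActionBound C) {f : Space d → ℝ} {L : ℝ≥0}
    (hf : LipschitzWith L f) (hfb : ∃ B, ∀ x, ‖f x‖ ≤ B) (s t : ℝ) :
    dist (∫ x, f x ∂(F.interp t : Measure (Space d))) (∫ x, f x ∂(F.interp s : Measure (Space d))) ≤
      L * Real.sqrt (C * (|t - s| + F.τ)) := by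
  have hfc := hf.continuous
  obtain ⟨B, hB⟩ := hfb
  have hint : ∀ n, Integrable (fun ω => f (F.X n ω)) F.m := fun n =>
    Integrable.of_bound (hfc.measurable.comp (F.measurable_X n)).aestronglyMeasurable B
      (ae_of_all _ fun ω => hB _)
  rw [coe_interp, coe_interp, integral_map (F.measurable_X _).aemeasurable
    hfc.aestronglyMeasurable, integral_map (F.measurable_X _).aemeasurable
    hfc.aestronglyMeasurable, dist_eq_norm, ← integral_sub (hint _) (hint _)]
  have hpos : 0 ≤ |t - s| + F.τ := add_nonneg (abs_nonneg _) F.τ_pos.le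
  rw [← ENNReal.ofReal_le_ofReal_iff (by positivity), ofReal_norm]
  refine (enorm_integral_le_lintegral_enorm _).trans ?_
  calc ∫⁻ ω, ‖f (F.X (F.idx t) ω) - f (F.X (F.idx s) ω)‖ₑ ∂F.m
      ≤ ∫⁻ ω, L * ‖F.X (F.idx t) ω - F.X (F.idx s) ω‖ₑ ∂F.m := by
        refine lintegral_mono fun ω => ?_
        rw [← edist_eq_enorm_sub, ← edist_eq_enorm_sub]
        exact hf _ _
    _ = L * ∫⁻ ω, ‖F.X (F.idx t) ω - F.X (F.idx s) ω‖ₑ ∂F.m :=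
        lintegral_const_mul _ ((F.measurable_X _).sub (F.measurable_X _)).enorm
    _ ≤ L * (C * ENNReal.ofReal (|t - s| + F.τ)) ^ (1 / 2 : ℝ) := by
        gcongr; exact hF.lintegral_enorm_idx_le s t
    _ = _ := by
        rw [ENNReal.ofReal_mul (by positivity), ENNReal.ofReal_coe_nnreal, Real.sqrt_eq_rpow,
          ← ENNReal.ofReal_rpow_of_nonneg (by positivity) (by norm_num),
          ENNReal.ofReal_mul (by positivity), ENNReal.ofReal_coe_nnreal]

/-- Tightness propagates from the initial laws. -/
lemma isTightMeasureSet_interp (F : ℕ → DiscreteFlow d) {C : ℝ≥0} (hF : ∀ k, (F k).ActionBound C)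
    {T : ℝ} (hτ : ∀ k, (F k).τ ≤ T) (h0 : IsTightMeasureSet (range fun k => (F k).law 0)) (t : ℝ) :
    IsTightMeasureSet (range fun k => ((F k).interp t : Measure (Space d))) := by
  rw [isTightMeasureSet_iff_exists_isCompact_measure_compl_le] at h0 ⊢
  intro ε hε
  have hε2 : ε / 2 ≠ 0 := (ENNReal.half_pos hε.ne').ne'
  obtain ⟨K, hK, hKε⟩ := h0 (ε / 2) (pos_iff_ne_zero.2 hε2)
  obtain ⟨R, hR⟩ := hK.isBounded.subset_closedBall 0
  -- n is chosen so that Chebyshev bounds by ε/2 the probability that the squared displacement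
  -- reaches n + 1.
  obtain ⟨n, hn⟩ := ENNReal.exists_nat_mul_gt (a := ε / 2)
    (b := C * ENNReal.ofReal (|t - 0| + T)) hε2 (ENNReal.mul_ne_top (by simp) (by simp))
  refine ⟨Metric.closedBall 0 (R + (n + 1)), isCompact_closedBall _ _, ?_⟩
  rintro _ ⟨k, rfl⟩
  have hX := (F k).measurable_X
  have hidx0 : (F k).idx 0 = 0 := by simp [idx]
  change ((F k).interp t : Measure (Space d)) _ ≤ ε
  rw [coe_interp, Measure.map_apply (hX _) Metric.isClosed_closedBall.measurableSet.compl]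
  set g : Space d → ℝ≥0∞ := fun ω => ‖(F k).X ((F k).idx t) ω - (F k).X ((F k).idx 0) ω‖ₑ ^ 2
  have hsub : (F k).X ((F k).idx t) ⁻¹' (Metric.closedBall 0 (R + (n + 1)))ᶜ ⊆
      (F k).X 0 ⁻¹' (Kᶜ) ∪ {ω | ((n + 1 : ℕ) : ℝ≥0∞) ≤ g ω} := by
    intro ω hω
    by_contra hno
    simp only [mem_union, mem_preimage, mem_compl_iff, not_or, not_not, mem_ofPred_eq, not_le]
      at hno
    refine hω ?_
    have h1 := hR hno.1
    rw [mem_closedBall_zero_iff] at h1 ⊢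
    have h2 : ‖(F k).X ((F k).idx t) ω - (F k).X 0 ω‖ ^ 2 < (n + 1 : ℕ) := by
      have := hno.2
      simp only [g, hidx0] at this
      rw [← ofReal_norm, ← ENNReal.ofReal_pow (norm_nonneg _), ← ENNReal.ofReal_natCast,
        ENNReal.ofReal_lt_ofReal_iff (by positivity)] at this
      exact this
    -- A square below n + 1 gives a norm at most n + 1, because n + 1 ≥ 1.
    have h3 : ‖(F k).X ((F k).idx t) ω - (F k).X 0 ω‖ ≤ n + 1 := by
      push_cast at h2
      nlinarith [norm_nonneg ((F k).X ((F k).idx t) ω - (F k).X 0 ω), n.cast_nonneg (α := ℝ)]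
    calc ‖(F k).X ((F k).idx t) ω‖ = ‖(F k).X 0 ω + ((F k).X ((F k).idx t) ω - (F k).X 0 ω)‖ := by
          rw [add_sub_cancel]
      _ ≤ R + (n + 1) := (norm_add_le _ _).trans (add_le_add h1 h3)
  have h1 : (F k).m ((F k).X 0 ⁻¹' (Kᶜ)) ≤ ε / 2 := by
    rw [← Measure.map_apply (hX 0) hK.isClosed.measurableSet.compl]
    exact hKε _ ⟨k, rfl⟩
  have h2 : (F k).m {ω | ((n + 1 : ℕ) : ℝ≥0∞) ≤ g ω} ≤ ε / 2 := by
    have h3 := mul_meas_ge_le_lintegral (μ := (F k).m) (f := g)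
      (((hX _).sub (hX _)).enorm.pow_const 2) ((n + 1 : ℕ) : ℝ≥0∞)
    have h4 : ∫⁻ ω, g ω ∂(F k).m ≤ ((n + 1 : ℕ) : ℝ≥0∞) * (ε / 2) := by
      refine ((hF k).lintegral_sq_idx_le 0 t).trans (le_trans ?_ (hn.le.trans ?_))
      · gcongr; exact hτ k
      · gcongr; simp
    exact (ENNReal.mul_le_mul_iff_right (by simp) (by simp)).1 (h3.trans h4)
  calc _ ≤ _ := measure_mono hsub
    _ ≤ _ := measure_union_le _ _
    _ ≤ ε / 2 + ε / 2 := add_le_add h1 h2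
    _ = ε := ENNReal.add_halves ε

/-- Compactness: a subsequence of the interpolated laws converges at each time. -/
theorem exists_tendsto_interp (F : ℕ → DiscreteFlow d) {C : ℝ≥0} (hF : ∀ k, (F k).ActionBound C)
    (hτ : Tendsto (fun k => (F k).τ) atTop (𝓝 0))
    (h0 : IsTightMeasureSet (range fun k => (F k).law 0)) :
    ∃ φ : ℕ → ℕ, StrictMono φ ∧ ∃ μ : ℝ → ProbabilityMeasure (Space d),
      ∀ t, Tendsto (fun j => (F (φ j)).interp t) atTop (𝓝 (μ t)) := by
  obtain ⟨T, hT⟩ := hτ.bddAbove_range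
  have hcomp : ∀ t, IsCompact (closure (range fun k => (F k).interp t)) := fun t => by
    refine isCompact_closure_of_isTightMeasureSet ?_
    convert isTightMeasureSet_interp F hF (fun k => hT (mem_range_self k)) h0 t using 1
    ext ν; simp
  -- One subsequence for all rational times, by compactness of a countable product.
  obtain ⟨ν, -, φ, hφ, hν⟩ := (isCompact_univ_pi fun q : ℚ => hcomp q).tendsto_subseq
    (x := fun k (q : ℚ) => (F k).interp q)
    (fun k => mem_univ_pi.2 fun q => subset_closure (mem_range_self k))
  rw [tendsto_pi_nhds] at hν
  have hτφ := hτ.comp hφ.tendsto_atTop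
  refine ⟨φ, hφ, ?_⟩
  suffices ∀ t, ∃ μ, Tendsto (fun j => (F (φ j)).interp t) atTop (𝓝 μ) by
    choose μ hμ using this
    exact ⟨μ, hμ⟩
  intro t
  have hcauchy : ∀ f : Space d → ℝ, (∃ B, ∀ x, ‖f x‖ ≤ B) → (∃ L, LipschitzWith L f) →
      CauchySeq fun j => ∫ x, f x ∂((F (φ j)).interp t : Measure (Space d)) := by
    rintro f hfb ⟨L, hL⟩
    rw [Metric.cauchySeq_iff]
    intro ε hε
    have hlim : Tendsto (fun r : ℝ => (L : ℝ) * Real.sqrt (C * r)) (𝓝 0) (𝓝 0) := by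
      have : Continuous fun r : ℝ => (L : ℝ) * Real.sqrt (C * r) := by fun_prop
      simpa using this.tendsto 0
    obtain ⟨δ, hδ, hδε⟩ := Metric.eventually_nhds_iff.1
      (hlim.eventually (gt_mem_nhds (show (0 : ℝ) < ε / 3 by positivity)))
    -- A rational time within δ/2 of t, together with τ < δ/2, makes |t - q| + τ < δ, uniformly in
    -- late j.
    obtain ⟨q, hq1, hq2⟩ := exists_rat_btwn (show t < t + δ / 2 by linarith)
    have h1 : ∀ᶠ j in atTop, (F (φ j)).τ < δ / 2 := hτφ.eventually_lt_const (by positivity)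
    obtain ⟨a, ha⟩ := eventually_atTop.1 h1
    have h2 : CauchySeq fun j => ∫ x, f x ∂((F (φ j)).interp q : Measure (Space d)) := by
      refine Tendsto.cauchySeq (x := ∫ x, f x ∂(ν q : Measure (Space d))) ?_
      obtain ⟨B, hB⟩ := hfb
      refine tendsto_iff_forall_lipschitz_integral_tendsto.1 (hν q) f ⟨B + B, fun x y => ?_⟩ ⟨L, hL⟩
      rw [dist_eq_norm]
      exact (norm_sub_le _ _).trans (add_le_add (hB x) (hB y))
    obtain ⟨b, hb⟩ := Metric.cauchySeq_iff.1 h2 (ε / 3) (by positivity)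
    have hnear : ∀ j, a ≤ j → dist (∫ x, f x ∂((F (φ j)).interp q : Measure (Space d)))
        (∫ x, f x ∂((F (φ j)).interp t : Measure (Space d))) < ε / 3 := fun j hj => by
      refine ((hF (φ j)).dist_integral_le hL hfb t q).trans_lt (hδε ?_)
      have hj' := ha j hj
      have hpos := (F (φ j)).τ_pos
      rw [dist_zero_right, Real.norm_eq_abs, abs_of_pos (sub_pos.2 hq1), abs_of_pos (by linarith)]
      linarith
    refine ⟨max a b, fun m hm n hn => ?_⟩
    have e1 := hnear m ((le_max_left _ _).trans hm)
    have e2 := hnear n ((le_max_left _ _).trans hn)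
    have e3 := hb m ((le_max_right _ _).trans hm) n ((le_max_right _ _).trans hn)
    rw [dist_comm] at e1
    exact (dist_triangle4 _ _ _ _).trans_lt (by linarith [e1, e2, e3])
  -- Tightness supplies a limit along a further subsequence; the Cauchy property of the integrals
  -- extends it to the whole sequence.
  obtain ⟨μ, -, ψ, hψ, hμ⟩ := (hcomp t).tendsto_subseq (x := fun j => (F (φ j)).interp t)
    (fun j => subset_closure (mem_range_self (φ j)))
  refine ⟨μ, tendsto_iff_forall_lipschitz_integral_tendsto.2 fun f hfd hfL => ?_⟩
  have hfb : ∃ B, ∀ x, ‖f x‖ ≤ B := by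
    obtain ⟨B, hB⟩ := hfd
    refine ⟨B + ‖f 0‖, fun x => ?_⟩
    have := hB x 0
    rw [dist_eq_norm] at this
    linarith [norm_le_norm_add_norm_sub' (f x) (f 0)]
  exact tendsto_nhds_of_cauchySeq_of_subseq (hcauchy f hfb hfL) hψ.tendsto_atTop
    (tendsto_iff_forall_lipschitz_integral_tendsto.1 hμ f hfd hfL)

end DiscreteFlow

variable {d : ℕ}

/-! ### Absolute continuity of limits -/

/-- Equi-integrability of densities with bounded energy. -/
lemma densityMeasure_le_of_energy {h : ℝ → ℝ} (hh : IsInternalEnergy h) {V : Space d → ℝ}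
    (hV0 : ∀ x, 0 ≤ V x) {R : ℝ} (hR : 0 < R) :
    ∃ s₀ : ℝ, 0 < s₀ ∧ ∀ σ : Space d → ℝ, (∀ x, 0 ≤ σ x) → ∀ U : Set (Space d), MeasurableSet U →
      densityMeasure σ U ≤ ENNReal.ofReal s₀ * volume U + ENNReal.ofReal R⁻¹ * energy h V σ := by
  obtain ⟨s₀, hs₀, hsh⟩ := hh.exists_mul_le R
  refine ⟨s₀, hs₀, fun σ hσ U hU => ?_⟩
  rw [densityMeasure, withDensity_apply _ hU]
  have hpt : ∀ x, ENNReal.ofReal (σ x) ≤ ENNReal.ofReal s₀ +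
      ENNReal.ofReal R⁻¹ * ENNReal.ofReal (h (σ x) + V x * σ x) := fun x => by
    have h1 := mul_nonneg (hV0 x) (hσ x)
    have h2 := hh.nonneg _ (hσ x)
    rw [← ENNReal.ofReal_mul (by positivity), ← ENNReal.ofReal_add hs₀.le (by positivity)]
    refine ENNReal.ofReal_le_ofReal ?_
    -- Either the density is at most s₀, or superlinearity bounds it by R⁻¹ times the energy
    -- density.
    rcases le_total (σ x) s₀ with hx | hx
    · have : 0 ≤ R⁻¹ * (h (σ x) + V x * σ x) := by positivity
      linarith
    · have h3 := hsh _ hx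
      have : σ x ≤ R⁻¹ * (h (σ x) + V x * σ x) := by
        rw [inv_mul_eq_div, le_div_iff₀ hR]; linarith
      linarith
  calc ∫⁻ x in U, ENNReal.ofReal (σ x)
      ≤ ∫⁻ x in U, ENNReal.ofReal s₀ +
          ENNReal.ofReal R⁻¹ * ENNReal.ofReal (h (σ x) + V x * σ x) := lintegral_mono hpt
    _ = ENNReal.ofReal s₀ * volume U +
          ENNReal.ofReal R⁻¹ * ∫⁻ x in U, ENNReal.ofReal (h (σ x) + V x * σ x) := by
        rw [lintegral_add_left measurable_const, lintegral_const, Measure.restrict_apply_univ,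
          lintegral_const_mul' _ _ ENNReal.ofReal_ne_top]
    _ ≤ _ := by
        gcongr
        exact setLIntegral_le_lintegral _ _

/-- A null set has open neighbourhoods of small volume, on which equi-integrability makes all the
approximating masses small. Lower semicontinuity on open sets passes this to the limit. -/
lemma absolutelyContinuous_of_tendsto {h : ℝ → ℝ} (hh : IsInternalEnergy h) {V : Space d → ℝ}
    (hV0 : ∀ x, 0 ≤ V x) {σ : ℕ → Space d → ℝ} (hσ : ∀ k x, 0 ≤ σ k x) {E : ℝ≥0}
    (hE : ∀ k, energy h V (σ k) ≤ E) {ν : ℕ → ProbabilityMeasure (Space d)}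
    (hν : ∀ k, densityMeasure (σ k) = ν k) {μ : ProbabilityMeasure (Space d)}
    (hμ : Tendsto ν atTop (𝓝 μ)) : (μ : Measure (Space d)) ≪ volume := by
  intro A hA
  refine le_antisymm (ENNReal.le_of_forall_pos_le_add fun ε hε _ => ?_) zero_le
  rw [zero_add]
  have hε2 : 0 < (ε : ℝ) / 2 := by positivity
  -- This R makes the energy term at most ε/2; E + 1 rather than E keeps R positive when E = 0.
  obtain ⟨s₀, hs₀, hle⟩ := densityMeasure_le_of_energy (d := d) hh hV0
    (R := (E + 1) / (ε / 2)) (by positivity)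
  obtain ⟨U, hAU, hU, hUle⟩ := A.exists_isOpen_le_add (volume : Measure (Space d))
    (ε := ENNReal.ofReal (ε / 2 / s₀)) (by simp; positivity)
  rw [hA, zero_add] at hUle
  have h1 : ∀ k, (ν k : Measure (Space d)) U ≤ ε := fun k => by
    rw [← hν k]
    refine (hle (σ k) (hσ k) U hU.measurableSet).trans ?_
    calc _ ≤ ENNReal.ofReal s₀ * ENNReal.ofReal (ε / 2 / s₀) +
          ENNReal.ofReal ((E + 1) / (ε / 2) : ℝ)⁻¹ * ENNReal.ofReal E := by
          gcongr
          simpa using hE k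
      _ = ENNReal.ofReal (s₀ * (ε / 2 / s₀) + ((E + 1) / (ε / 2) : ℝ)⁻¹ * E) := by
          rw [ENNReal.ofReal_add (by positivity) (by positivity), ENNReal.ofReal_mul hs₀.le,
            ENNReal.ofReal_mul (by positivity)]
      _ ≤ ENNReal.ofReal ε := by
          refine ENNReal.ofReal_le_ofReal ?_
          have e1 : s₀ * (ε / 2 / s₀) = (ε : ℝ) / 2 := by field_simp
          have e2 : ((E + 1) / (ε / 2) : ℝ)⁻¹ * E ≤ ε / 2 := by
            rw [inv_div, div_mul_eq_mul_div, div_le_iff₀ (by positivity)]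
            nlinarith
          linarith
      _ = ε := ENNReal.ofReal_coe_nnreal
  have h2 : (μ : Measure (Space d)) U ≤ liminf (fun k => (ν k : Measure (Space d)) U) atTop :=
    ProbabilityMeasure.le_liminf_measure_open_of_tendsto hμ hU
  calc (μ : Measure (Space d)) A ≤ (μ : Measure (Space d)) U := measure_mono hAU
    _ ≤ _ := h2
    _ ≤ ε := liminf_le_of_le (by isBoundedDefault) fun b hb => by
        obtain ⟨k, hk⟩ := hb.exists
        exact hk.trans (h1 k)

/-! ### Jointly measurable densities -/

/-- Closed sets form a generating π-system, and their indicators are limits of bounded continuous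
functions. -/
lemma measurable_of_forall_lintegral {α : Type*} [MeasurableSpace α]
    (μ : α → ProbabilityMeasure (Space d))
    (hμ : ∀ f : Space d →ᵇ ℝ≥0, Measurable fun a => ∫⁻ x, f x ∂(μ a : Measure (Space d))) :
    Measurable fun a => (μ a : Measure (Space d)) := by
  refine Measurable.measure_of_isPiSystem_of_isProbabilityMeasure (S := {s | IsClosed s})
    ((BorelSpace.measurable_eq (α := Space d)).trans borel_eq_generateFrom_isClosed)
    isPiSystem_isClosed fun s hs => ?_
  exact measurable_of_tendsto_metrizable (fun n => hμ (hs.apprSeq n))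
    (tendsto_pi_nhds.2 fun a => HasOuterApproxClosed.tendsto_lintegral_apprSeq hs _)

/-- Densities chosen separately for each t need not be jointly measurable. The kernel derivative
against a finite measure β equivalent to Lebesgue measure is, and the chain rule returns to Lebesgue
measure. -/
lemma exists_measurable_density (μ : ℝ → ProbabilityMeasure (Space d))
    (hμ : Measurable fun t => (μ t : Measure (Space d)))
    (hac : ∀ t, (μ t : Measure (Space d)) ≪ volume) :
    ∃ ρ : ℝ → Space d → ℝ, Measurable (Function.uncurry ρ) ∧ (∀ t x, 0 ≤ ρ t x) ∧
      ∀ t, densityMeasure (ρ t) = μ t := by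
  let κ : ProbabilityTheory.Kernel ℝ (Space d) := ⟨fun t => μ t, hμ⟩
  have : ProbabilityTheory.IsMarkovKernel κ :=
    ⟨fun t => inferInstanceAs (IsProbabilityMeasure (μ t : Measure (Space d)))⟩
  obtain ⟨β, _, hβ1, hβ2⟩ : ∃ β : Measure (Space d), IsFiniteMeasure β ∧ volume ≪ β ∧ β ≪ volume :=
    ⟨_, inferInstance, absolutelyContinuous_toFinite volume, toFinite_absolutelyContinuous volume⟩
  let η : ProbabilityTheory.Kernel ℝ (Space d) := .const ℝ β
  let w : ℝ → Space d → ℝ≥0∞ := fun t x => β.rnDeriv volume x * κ.rnDeriv η t x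
  have hw : Measurable fun p : ℝ × Space d => w p.1 p.2 :=
    ((Measure.measurable_rnDeriv _ _).comp measurable_snd).mul
      (ProbabilityTheory.Kernel.measurable_rnDeriv κ η)
  have hwt : ∀ t, Measurable (w t) := fun t => hw.comp measurable_prodMk_left
  have hμw : ∀ t, volume.withDensity (w t) = μ t := fun t => by
    have h1 : (μ t : Measure (Space d)) ≪ β := (hac t).trans hβ1
    have h2 : κ.rnDeriv η t =ᵐ[β] (μ t : Measure (Space d)).rnDeriv β :=
      ProbabilityTheory.Kernel.rnDeriv_eq_rnDeriv_measure
    have h3 : β = volume.withDensity (β.rnDeriv volume) :=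
      (Measure.withDensity_rnDeriv_eq _ _ hβ2).symm
    change volume.withDensity (β.rnDeriv volume * κ.rnDeriv η t) = μ t
    rw [withDensity_mul _ (Measure.measurable_rnDeriv _ _)
      (ProbabilityTheory.Kernel.measurable_rnDeriv_right κ η t), ← h3, withDensity_congr_ae h2]
    have : SFinite (μ t : Measure (Space d)) := inferInstance
    have : SigmaFinite β := inferInstance
    have h4 : (μ t : Measure (Space d)).HaveLebesgueDecomposition β := inferInstance
    exact Measure.withDensity_rnDeriv_eq _ _ h1
  refine ⟨fun t x => (w t x).toReal, hw.ennreal_toReal, fun t x => ENNReal.toReal_nonneg,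
    fun t => ?_⟩
  have hfin : ∀ᵐ x, w t x < ∞ := by
    refine ae_lt_top (hwt t) ?_
    rw [← setLIntegral_univ, ← withDensity_apply _ .univ, hμw]
    exact measure_ne_top _ _
  rw [← hμw t, densityMeasure]
  exact withDensity_congr_ae (hfin.mono fun x hx => ENNReal.ofReal_toReal hx.ne)

lemma isProbDensity_of_densityMeasure {ρ : Space d → ℝ} (hρ : Measurable ρ) (hρ0 : ∀ x, 0 ≤ ρ x)
    [IsProbabilityMeasure (densityMeasure ρ)] (h2 : ∫⁻ x, ‖x‖ₑ ^ 2 ∂densityMeasure ρ ≠ ∞) :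
    IsProbDensity ρ := by
  have h1 : ∫⁻ x, ENNReal.ofReal (ρ x) = 1 := by
    have := measure_univ (μ := densityMeasure ρ)
    rwa [densityMeasure, withDensity_apply _ .univ, setLIntegral_univ] at this
  refine ⟨⟨hρ.aestronglyMeasurable, ?_⟩, ae_of_all _ hρ0, ?_, ⟨?_, ?_⟩⟩
  · rw [hasFiniteIntegral_iff_ofReal (ae_of_all _ hρ0), h1]
    exact ENNReal.one_lt_top
  · rw [integral_eq_lintegral_of_nonneg_ae (ae_of_all _ hρ0) hρ.aestronglyMeasurable, h1,
      ENNReal.toReal_one]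
  · exact ((measurable_norm.pow_const 2).mul hρ).aestronglyMeasurable
  · rw [hasFiniteIntegral_iff_ofReal (ae_of_all _ fun x => mul_nonneg (by positivity) (hρ0 x))]
    rw [densityMeasure, lintegral_withDensity_eq_lintegral_mul _ hρ.ennreal_ofReal
      (measurable_enorm.pow_const 2)] at h2
    refine lt_of_eq_of_lt (lintegral_congr fun x => ?_) h2.lt_top
    rw [Pi.mul_apply, mul_comm, ENNReal.ofReal_mul (hρ0 x), ENNReal.ofReal_pow (norm_nonneg _),
      ofReal_norm]

/-! ### Limits of couplings -/

/-- A convergent sequence together with its limit is compact, and compactness implies tightness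
here. -/
lemma isTightMeasureSet_of_tendsto {ν : ℕ → ProbabilityMeasure (Space d)}
    {μ : ProbabilityMeasure (Space d)} (hμ : Tendsto ν atTop (𝓝 μ)) :
    IsTightMeasureSet (range fun k => (ν k : Measure (Space d))) := by
  have hc := hμ.isCompact_insert_range
  have := isTightMeasureSet_of_isCompact_closure (S := insert μ (range ν)) (by
    rwa [hc.isClosed.closure_eq])
  refine this.subset ?_
  rintro _ ⟨k, rfl⟩
  exact ⟨ν k, mem_insert_of_mem _ (mem_range_self k), rfl⟩

namespace DiscreteFlow

/-- The limits of the laws at two times have a coupling that inherits the action bound. -/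
lemma exists_coupling (F : ℕ → DiscreteFlow d) {C : ℝ≥0} (hF : ∀ k, (F k).ActionBound C)
    (hτ : Tendsto (fun k => (F k).τ) atTop (𝓝 0)) {μ : ℝ → ProbabilityMeasure (Space d)}
    (hμ : ∀ t, Tendsto (fun k => (F k).interp t) atTop (𝓝 (μ t))) (s t : ℝ) :
    ∃ π : Measure (Space d × Space d), π.map Prod.fst = μ s ∧ π.map Prod.snd = μ t ∧
      ∫⁻ z, ‖z.1 - z.2‖ₑ ^ 2 ∂π ≤ C * ENNReal.ofReal |t - s| := by
  have hm : ∀ k, Measurable fun ω => ((F k).X ((F k).idx s) ω, (F k).X ((F k).idx t) ω) := fun k =>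
    ((F k).measurable_X _).prodMk ((F k).measurable_X _)
  -- The joint law of the positions of one label at times s and t is a natural coupling.
  let π : ℕ → ProbabilityMeasure (Space d × Space d) := fun k =>
    ⟨(F k).m.map fun ω => ((F k).X ((F k).idx s) ω, (F k).X ((F k).idx t) ω),
      Measure.isProbabilityMeasure_map (hm k).aemeasurable⟩
  have hfst : ∀ k, (π k).map measurable_fst.aemeasurable = (F k).interp s := fun k =>
    Subtype.ext (Measure.map_map measurable_fst (hm k))
  have hsnd : ∀ k, (π k).map measurable_snd.aemeasurable = (F k).interp t := fun k =>
    Subtype.ext (Measure.map_map measurable_snd (hm k))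
  -- Couplings are tight because their two marginal sequences are.
  have htight : IsTightMeasureSet {x | ∃ μ ∈ range π, (μ : Measure (Space d × Space d)) = x} := by
    rw [isTightMeasureSet_iff_exists_isCompact_measure_compl_le]
    intro ε hε
    have hs := isTightMeasureSet_of_tendsto (hμ s)
    have ht := isTightMeasureSet_of_tendsto (hμ t)
    rw [isTightMeasureSet_iff_exists_isCompact_measure_compl_le] at hs ht
    obtain ⟨K, hK, hKε⟩ := hs (ε / 2) (ENNReal.half_pos hε.ne')
    obtain ⟨L, hL, hLε⟩ := ht (ε / 2) (ENNReal.half_pos hε.ne')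
    refine ⟨K ×ˢ L, hK.prod hL, ?_⟩
    rintro _ ⟨_, ⟨k, rfl⟩, rfl⟩
    have h1 : (π k : Measure (Space d × Space d)) (Prod.fst ⁻¹' Kᶜ) ≤ ε / 2 := by
      rw [← Measure.map_apply measurable_fst hK.isClosed.measurableSet.compl]
      have : ((F k).interp s : Measure (Space d)) Kᶜ ≤ ε / 2 := hKε _ ⟨k, rfl⟩
      rwa [← hfst k] at this
    have h2 : (π k : Measure (Space d × Space d)) (Prod.snd ⁻¹' Lᶜ) ≤ ε / 2 := by
      rw [← Measure.map_apply measurable_snd hL.isClosed.measurableSet.compl]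
      have : ((F k).interp t : Measure (Space d)) Lᶜ ≤ ε / 2 := hLε _ ⟨k, rfl⟩
      rwa [← hsnd k] at this
    calc _ ≤ (π k : Measure (Space d × Space d)) (Prod.fst ⁻¹' Kᶜ ∪ Prod.snd ⁻¹' Lᶜ) := by
          refine measure_mono fun z hz => ?_
          by_contra hno
          simp only [mem_union, mem_preimage, mem_compl_iff, not_or, not_not] at hno
          exact hz ⟨hno.1, hno.2⟩
      _ ≤ ε / 2 + ε / 2 := (measure_union_le _ _).trans (add_le_add h1 h2)
      _ = ε := ENNReal.add_halves ε
  obtain ⟨p, -, ψ, hψ, hp⟩ := (isCompact_closure_of_isTightMeasureSet htight).tendsto_subseq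
    (x := π) (fun k => subset_closure (mem_range_self k))
  refine ⟨p, ?_, ?_, ?_⟩
  · have h1 := ProbabilityMeasure.tendsto_map_of_tendsto_of_continuous _ _ hp continuous_fst
    have h2 : Tendsto (fun k => (F (ψ k)).interp s) atTop (𝓝 (p.map _)) :=
      h1.congr fun k => hfst (ψ k)
    have h3 := tendsto_nhds_unique h2 ((hμ s).comp hψ.tendsto_atTop)
    exact congrArg (fun q : ProbabilityMeasure (Space d) => (q : Measure (Space d))) h3
  · have h1 := ProbabilityMeasure.tendsto_map_of_tendsto_of_continuous _ _ hp continuous_snd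
    have h2 : Tendsto (fun k => (F (ψ k)).interp t) atTop (𝓝 (p.map _)) :=
      h1.congr fun k => hsnd (ψ k)
    have h3 := tendsto_nhds_unique h2 ((hμ t).comp hψ.tendsto_atTop)
    exact congrArg (fun q : ProbabilityMeasure (Space d) => (q : Measure (Space d))) h3
  · have hcost : ∀ z : Space d × Space d, ‖z.1 - z.2‖ₑ ^ 2 = ENNReal.ofReal (‖z.1 - z.2‖ ^ 2) :=
      fun z => by rw [ENNReal.ofReal_pow (norm_nonneg _), ofReal_norm]
    -- The cost is continuous and nonnegative but unbounded, so only lower semicontinuity holds;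
    -- this is the needed direction.
    have hlsc := lintegral_le_liminf_lintegral_of_forall_isOpen_measure_le_liminf_measure
      (μ := (p : Measure (Space d × Space d)))
      (μs := fun k => (π (ψ k) : Measure (Space d × Space d)))
      (f := fun z => ‖z.1 - z.2‖ ^ 2) (by fun_prop) (fun z => by positivity)
      fun U hU => ProbabilityMeasure.le_liminf_measure_open_of_tendsto hp hU
    simp only [← hcost] at hlsc
    have hbound : ∀ k, ∫⁻ z, ‖z.1 - z.2‖ₑ ^ 2 ∂(π (ψ k) : Measure (Space d × Space d)) ≤
        C * ENNReal.ofReal (|t - s| + (F (ψ k)).τ) := fun k => by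
      refine le_trans (le_of_eq ?_) ((hF (ψ k)).lintegral_sq_idx_le s t)
      change ∫⁻ z : Space d × Space d, ‖z.1 - z.2‖ₑ ^ 2 ∂((F (ψ k)).m.map fun ω =>
        ((F (ψ k)).X ((F (ψ k)).idx s) ω, (F (ψ k)).X ((F (ψ k)).idx t) ω)) = _
      rw [lintegral_map (by fun_prop) (hm _)]
      simp only [enorm_sub_rev]
    have hlim : Tendsto (fun k => C * ENNReal.ofReal (|t - s| + (F (ψ k)).τ)) atTop
        (𝓝 (C * ENNReal.ofReal |t - s|)) := by
      refine ENNReal.Tendsto.const_mul (ENNReal.tendsto_ofReal ?_) (Or.inr ENNReal.coe_ne_top)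
      simpa using (hτ.comp hψ.tendsto_atTop).const_add |t - s|
    calc _ ≤ _ := hlsc
      _ ≤ liminf (fun k => C * ENNReal.ofReal (|t - s| + (F (ψ k)).τ)) atTop :=
        liminf_le_liminf (Eventually.of_forall hbound)
      _ = _ := hlim.liminf_eq

/-- The finite second moment at time 0 is carried to time t by the coupling of finite cost. -/
lemma lintegral_sq_limit_ne_top (F : ℕ → DiscreteFlow d) {C : ℝ≥0}
    (hF : ∀ k, (F k).ActionBound C)
    (hτ : Tendsto (fun k => (F k).τ) atTop (𝓝 0)) {μ : ℝ → ProbabilityMeasure (Space d)}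
    (hμ : ∀ t, Tendsto (fun k => (F k).interp t) atTop (𝓝 (μ t)))
    (h0 : ∫⁻ x, ‖x‖ₑ ^ 2 ∂(μ 0 : Measure (Space d)) ≠ ∞) (t : ℝ) :
    ∫⁻ x, ‖x‖ₑ ^ 2 ∂(μ t : Measure (Space d)) ≠ ∞ := by
  obtain ⟨π, h1, h2, h3⟩ := exists_coupling F hF hτ hμ 0 t
  have hm : Measurable fun x : Space d => ‖x‖ₑ ^ 2 := measurable_enorm.pow_const 2
  rw [← h1, lintegral_map hm measurable_fst] at h0
  rw [← h2, lintegral_map hm measurable_snd]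
  have hpt : ∀ z : Space d × Space d, ‖z.2‖ₑ ^ 2 ≤ 2 * (‖z.1‖ₑ ^ 2 + ‖z.1 - z.2‖ₑ ^ 2) := by
    intro z
    have e1 : ‖z.2‖ₑ ≤ ‖z.1‖ₑ + ‖z.1 - z.2‖ₑ := by
      calc ‖z.2‖ₑ = ‖z.1 - (z.1 - z.2)‖ₑ := by rw [sub_sub_cancel]
        _ ≤ _ := enorm_sub_le
    have := ENNReal.rpow_add_le_mul_rpow_add_rpow ‖z.1‖ₑ ‖z.1 - z.2‖ₑ (p := 2) one_le_two
    norm_num at this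
    exact (pow_le_pow_left' e1 2).trans this
  refine ne_top_of_le_ne_top ?_ (lintegral_mono hpt)
  rw [lintegral_const_mul _ (by fun_prop), lintegral_add_left (by fun_prop)]
  refine ENNReal.mul_ne_top (by simp) (ENNReal.add_ne_top.2 ⟨h0, ?_⟩)
  exact ne_top_of_le_ne_top (ENNReal.mul_ne_top (by simp) (by simp)) h3

lemma wasserstein2_limit_le (F : ℕ → DiscreteFlow d) {C : ℝ≥0}
    (hF : ∀ k, (F k).ActionBound C)
    (hτ : Tendsto (fun k => (F k).τ) atTop (𝓝 0)) {μ : ℝ → ProbabilityMeasure (Space d)}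
    (hμ : ∀ t, Tendsto (fun k => (F k).interp t) atTop (𝓝 (μ t))) (s t : ℝ) :
    wasserstein2 (μ s : Measure (Space d)) (μ t) ≤
      NNReal.sqrt C * ENNReal.ofReal (|t - s| ^ (1 / 2 : ℝ)) := by
  obtain ⟨π, h1, h2, h3⟩ := exists_coupling F hF hτ hμ s t
  have : (NNReal.sqrt C : ℝ≥0∞) * ENNReal.ofReal (|t - s| ^ (1 / 2 : ℝ)) =
      (C * ENNReal.ofReal |t - s|) ^ (1 / 2 : ℝ) := by
    rw [ENNReal.mul_rpow_of_nonneg _ _ (by norm_num), NNReal.sqrt_eq_rpow,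
      ENNReal.coe_rpow_of_nonneg _ (by norm_num),
      ENNReal.ofReal_rpow_of_nonneg (abs_nonneg _) (by norm_num)]
  rw [this, wasserstein2]
  gcongr
  exact (iInf_le _ ⟨π, h1, h2⟩).trans h3

/-- Each interpolated law depends on t through an integer index only, so its integrals are
measurable in t; pointwise limits stay measurable. -/
lemma measurable_limit (F : ℕ → DiscreteFlow d) {μ : ℝ → ProbabilityMeasure (Space d)}
    (hμ : ∀ t, Tendsto (fun k => (F k).interp t) atTop (𝓝 (μ t))) :
    Measurable fun t => (μ t : Measure (Space d)) := by
  refine measurable_of_forall_lintegral μ fun f => ?_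
  have h1 : ∀ k, Measurable fun t => ∫⁻ x, f x ∂((F k).interp t : Measure (Space d)) := fun k =>
    (measurable_from_nat (f := fun n => ∫⁻ x, (f x : ℝ≥0∞) ∂(F k).law n)).comp (F k).measurable_idx
  exact measurable_of_tendsto_metrizable h1 (tendsto_pi_nhds.2 fun t =>
    ProbabilityMeasure.tendsto_iff_forall_lintegral_tendsto.1 (hμ t) f)

end DiscreteFlow

/-! ### Curves of probability densities and their space-time measures -/

/-- A jointly measurable curve of probability densities. -/
structure IsProbCurve (ρ : ℝ → Space d → ℝ) : Prop where
  measurable : Measurable (Function.uncurry ρ)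
  prob : ∀ t, IsProbabilityMeasure (densityMeasure (ρ t))

namespace IsProbCurve

variable {ρ : ℝ → Space d → ℝ}

lemma measurable_apply (hρ : IsProbCurve ρ) (t : ℝ) : Measurable (ρ t) :=
  hρ.measurable.comp measurable_prodMk_left

lemma measurable_ofReal (hρ : IsProbCurve ρ) :
    Measurable fun p : ℝ × Space d => ENNReal.ofReal (ρ p.1 p.2) :=
  hρ.measurable.ennreal_ofReal

lemma lintegral_spaceTime (hρ : IsProbCurve ρ) {f : ℝ × Space d → ℝ≥0∞} (hf : Measurable f) :
    ∫⁻ p, f p ∂spaceTimeMeasure ρ =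
      ∫⁻ t in Ioi (0 : ℝ), ∫⁻ x, f (t, x) ∂densityMeasure (ρ t) := by
  rw [spaceTimeMeasure, lintegral_withDensity_eq_lintegral_mul _ hρ.measurable_ofReal hf,
    lintegral_prod _ (hρ.measurable_ofReal.mul hf).aemeasurable]
  refine lintegral_congr fun t => ?_
  have hft : Measurable fun x => f (t, x) := hf.comp measurable_prodMk_left
  rw [densityMeasure, lintegral_withDensity_eq_lintegral_mul _
    (hρ.measurable_apply t).ennreal_ofReal hft]
  rfl

lemma spaceTimeMeasure_apply (hρ : IsProbCurve ρ) {A : Set (ℝ × Space d)} (hA : MeasurableSet A) :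
    spaceTimeMeasure ρ A =
      ∫⁻ t in Ioi (0 : ℝ), densityMeasure (ρ t) (Prod.mk t ⁻¹' A) := by
  rw [← lintegral_indicator_one hA, hρ.lintegral_spaceTime (measurable_one.indicator hA)]
  refine lintegral_congr fun t => ?_
  rw [← lintegral_indicator_one (measurable_prodMk_left hA)]
  rfl

lemma spaceTimeMeasure_Iio_lt_top (hρ : IsProbCurve ρ) (T : ℝ) :
    spaceTimeMeasure ρ (Iio T ×ˢ univ) < ∞ := by
  have := hρ.prob
  rw [hρ.spaceTimeMeasure_apply (measurableSet_Iio.prod .univ)]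
  calc _ ≤ ∫⁻ t in Ioi (0 : ℝ), (Iio T).indicator 1 t := by
        refine lintegral_mono fun t => ?_
        by_cases ht : t ∈ Iio T
        · rw [indicator_of_mem ht]
          exact prob_le_one
        · have : Prod.mk t ⁻¹' (Iio T ×ˢ (univ : Set (Space d))) = ∅ := by
            ext x
            simp only [mem_preimage, mem_prod, mem_univ, and_true, mem_empty_iff_false, iff_false]
            exact ht
          rw [this]; simp
    _ = volume (Iio T ∩ Ioi 0) := by
        rw [lintegral_indicator_one measurableSet_Iio, Measure.restrict_apply measurableSet_Iio]
    _ < ∞ := by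
        rw [inter_comm, Ioi_inter_Iio, Real.volume_Ioo]
        exact ENNReal.ofReal_lt_top

lemma isLocallyFiniteMeasure (hρ : IsProbCurve ρ) : IsLocallyFiniteMeasure (spaceTimeMeasure ρ) :=
  ⟨fun p => ⟨Iio (p.1 + 1) ×ˢ univ,
    (isOpen_Iio.prod isOpen_univ).mem_nhds ⟨by simp, mem_univ _⟩,
    hρ.spaceTimeMeasure_Iio_lt_top _⟩⟩

lemma integrable_of_bound (hρ : IsProbCurve ρ) {f : ℝ × Space d → ℝ} (hf : Measurable f)
    {B : ℝ} (hB : ∀ p, ‖f p‖ ≤ B) {T : ℝ} (hT : ∀ t x, T ≤ t → f (t, x) = 0) :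
    Integrable f (spaceTimeMeasure ρ) := by
  have hs : Function.support f ⊆ Iio T ×ˢ univ := fun p hp =>
    ⟨not_le.1 fun h => hp (hT p.1 p.2 h), mem_univ _⟩
  rw [← integrableOn_iff_integrable_of_support_subset hs]
  exact Measure.integrableOn_of_bounded (hρ.spaceTimeMeasure_Iio_lt_top T).ne
    hf.aestronglyMeasurable (ae_of_all _ hB)

lemma integral_spaceTime (hρ : IsProbCurve ρ) {f : ℝ × Space d → ℝ}
    (hf : Integrable f (spaceTimeMeasure ρ)) :
    ∫ p, f p ∂spaceTimeMeasure ρ =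
      ∫ t in Ioi (0 : ℝ), ∫ x, f (t, x) ∂densityMeasure (ρ t) := by
  have hint : Integrable (fun p => (ENNReal.ofReal (ρ p.1 p.2)).toReal • f p)
      ((volume.restrict (Ioi (0 : ℝ))).prod (volume : Measure (Space d))) :=
    (integrable_withDensity_iff_integrable_smul' hρ.measurable_ofReal
      (ae_of_all _ fun _ => ENNReal.ofReal_lt_top)).1 hf
  rw [spaceTimeMeasure, integral_withDensity_eq_integral_toReal_smul hρ.measurable_ofReal
    (ae_of_all _ fun _ => ENNReal.ofReal_lt_top), integral_prod _ hint]
  refine integral_congr_ae (ae_of_all _ fun t => ?_)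
  simp only
  rw [densityMeasure, integral_withDensity_eq_integral_toReal_smul
    (hρ.measurable_apply t).ennreal_ofReal (ae_of_all _ fun _ => ENNReal.ofReal_lt_top)]

lemma stronglyMeasurable_integral (hρ : IsProbCurve ρ) {f : ℝ × Space d → ℝ}
    (hf : Measurable f) :
    StronglyMeasurable fun t => ∫ x, f (t, x) ∂densityMeasure (ρ t) := by
  have h1 : Measurable fun p : ℝ × Space d => (ENNReal.ofReal (ρ p.1 p.2)).toReal • f p :=
    hρ.measurable_ofReal.ennreal_toReal.smul hf
  have := h1.stronglyMeasurable.integral_prod_right' (ν := (volume : Measure (Space d)))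
  convert this using 2 with t
  rw [densityMeasure, integral_withDensity_eq_integral_toReal_smul
    (hρ.measurable_apply t).ennreal_ofReal (ae_of_all _ fun _ => ENNReal.ofReal_lt_top)]

end IsProbCurve

/-- Narrow convergence at each time implies convergence of space-time integrals. -/
lemma tendsto_integral_spaceTime {ρ : ℕ → ℝ → Space d → ℝ} {σ : ℝ → Space d → ℝ}
    (hρ : ∀ k, IsProbCurve (ρ k)) (hσ : IsProbCurve σ)
    (hconv : ∀ t, 0 < t → NarrowTendsto (fun k => ρ k t) (σ t))
    (f : (ℝ × Space d) →ᵇ ℝ) {T : ℝ} (hT : ∀ t x, T ≤ t → f (t, x) = 0) :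
    Tendsto (fun k => ∫ p, f p ∂spaceTimeMeasure (ρ k)) atTop
      (𝓝 (∫ p, f p ∂spaceTimeMeasure σ)) := by
  have hfm : Measurable f := f.continuous.measurable
  have hint : ∀ {ρ : ℝ → Space d → ℝ}, IsProbCurve ρ → Integrable f (spaceTimeMeasure ρ) :=
    fun h => h.integrable_of_bound hfm f.norm_coe_le_norm hT
  simp_rw [(hρ _).integral_spaceTime (hint (hρ _)), hσ.integral_spaceTime (hint hσ)]
  -- Since every slice has mass one, ‖f‖ on times before T dominates.
  refine tendsto_integral_of_dominated_convergence ((Iio T).indicator fun _ => ‖f‖)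
    (fun k => ((hρ k).stronglyMeasurable_integral hfm).aestronglyMeasurable) ?_ ?_ ?_
  · rw [integrable_indicator_iff measurableSet_Iio]
    refine integrableOn_const ?_
    rw [Measure.restrict_apply measurableSet_Iio, inter_comm, Ioi_inter_Iio, Real.volume_Ioo]
    exact ENNReal.ofReal_ne_top
  · refine fun k => ae_of_all _ fun t => ?_
    by_cases ht : t ∈ Iio T
    · rw [indicator_of_mem ht]
      have := (hρ k).prob t
      refine (norm_integral_le_of_norm_le_const
        (ae_of_all _ fun x => f.norm_coe_le_norm _)).trans ?_
      simp
    · simp [hT t _ (not_lt.1 ht), ht]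
  · refine (ae_restrict_iff' measurableSet_Ioi).2 (ae_of_all _ fun t ht => ?_)
    exact hconv t ht (f.compContinuous ⟨fun x => (t, x), by fun_prop⟩)

/-! ### Test fields -/

/-- Bounded continuous vector fields on space-time that vanish for large times. -/
def testFields (d : ℕ) : Submodule ℝ ((ℝ × Space d) →ᵇ Space d) where
  carrier := {ψ | ∃ T : ℝ, ∀ t x, T ≤ t → ψ (t, x) = 0}
  zero_mem' := ⟨0, fun _ _ _ => rfl⟩
  add_mem' := by
    rintro ψ χ ⟨T, hT⟩ ⟨S, hS⟩
    refine ⟨max T S, fun t x ht => ?_⟩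
    rw [BoundedContinuousFunction.add_apply, hT t x ((le_max_left _ _).trans ht),
      hS t x ((le_max_right _ _).trans ht), add_zero]
  smul_mem' := by
    rintro c ψ ⟨T, hT⟩
    refine ⟨T, fun t x ht => ?_⟩
    rw [BoundedContinuousFunction.smul_apply, hT t x ht, smul_zero]

lemma IsProbCurve.memLp_testField {ρ : ℝ → Space d → ℝ} (hρ : IsProbCurve ρ) (ψ : testFields d) :
    MemLp (ψ : (ℝ × Space d) →ᵇ Space d) 2 (spaceTimeMeasure ρ) := by
  obtain ⟨ψ, T, hT⟩ := ψ
  rw [memLp_two_iff_integrable_sq_norm ψ.continuous.aestronglyMeasurable]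
  refine hρ.integrable_of_bound (B := ‖ψ‖ ^ 2) (T := T)
    (ψ.continuous.norm.pow 2).measurable (fun p => ?_) fun t x ht => by simp [hT t x ht]
  rw [Real.norm_of_nonneg (by positivity)]
  gcongr
  exact ψ.norm_coe_le_norm p

/-- The embedding of the test fields into the `L²` space of a curve of densities. -/
noncomputable def IsProbCurve.testEmbedding {ρ : ℝ → Space d → ℝ} (hρ : IsProbCurve ρ) :
    testFields d →ₗ[ℝ] Lp (Space d) 2 (spaceTimeMeasure ρ) where
  toFun ψ := (hρ.memLp_testField ψ).toLp _
  map_add' _ _ := rfl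
  map_smul' _ _ := rfl

lemma IsProbCurve.norm_testEmbedding_sq {ρ : ℝ → Space d → ℝ} (hρ : IsProbCurve ρ)
    (ψ : testFields d) :
    ‖hρ.testEmbedding ψ‖ ^ 2 = ∫ p, ‖(ψ : (ℝ × Space d) →ᵇ Space d) p‖ ^ 2 ∂spaceTimeMeasure ρ := by
  rw [← real_inner_self_eq_norm_sq, L2.inner_def]
  refine integral_congr_ae ?_
  filter_upwards [(hρ.memLp_testField ψ).coeFn_toLp] with p hp
  rw [← real_inner_self_eq_norm_sq]
  exact congrArg₂ _ hp hp

/-- The space-time measure is locally finite, so compactly supported continuous fields are dense in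
L²; these are bounded and vanish for large times. -/
lemma IsProbCurve.exists_testEmbedding_near {ρ : ℝ → Space d → ℝ} (hρ : IsProbCurve ρ)
    (u : Lp (Space d) 2 (spaceTimeMeasure ρ)) {r : ℝ} (hr : 0 < r) :
    ∃ ψ, ‖u - hρ.testEmbedding ψ‖ < r := by
  have := hρ.isLocallyFiniteMeasure
  obtain ⟨g, hgs, hgn, hgc, hgm⟩ := (Lp.memLp u).exists_hasCompactSupport_eLpNorm_sub_le
    (by simp) (ε := ENNReal.ofReal (r / 2)) (by simp; positivity)
  obtain ⟨B, hB⟩ := hgs.exists_bound_of_continuous hgc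
  obtain ⟨T, hT⟩ : ∃ T : ℝ, ∀ t x, T ≤ t → g (t, x) = 0 := by
    obtain ⟨T, hT⟩ := (hgs.isCompact.image continuous_fst).bddAbove
    refine ⟨T + 1, fun t x ht => image_eq_zero_of_notMem_tsupport fun hmem => ?_⟩
    have : t ≤ T := hT ⟨(t, x), hmem, rfl⟩
    linarith
  let ψ : testFields d := ⟨BoundedContinuousFunction.ofNormedAddCommGroup g hgc B hB, T, hT⟩
  refine ⟨ψ, ?_⟩
  have h1 : hρ.testEmbedding ψ = hgm.toLp g := rfl
  rw [h1, ← Lp.toLp_coeFn u (Lp.memLp u), ← MemLp.toLp_sub, Lp.norm_toLp]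
  have h2 := ENNReal.toReal_mono ENNReal.ofReal_ne_top hgn
  rw [ENNReal.toReal_ofReal (by positivity)] at h2
  linarith

lemma IsProbCurve.momentum_eq_inner {ρ : ℝ → Space d → ℝ} (hρ : IsProbCurve ρ)
    {v : ℝ → Space d → Space d} (hv : MemLp (Function.uncurry v) 2 (spaceTimeMeasure ρ))
    (ψ : testFields d) :
    momentum ρ v (ψ : (ℝ × Space d) →ᵇ Space d) = ⟪hv.toLp _, hρ.testEmbedding ψ⟫ := by
  rw [L2.inner_def]
  refine integral_congr_ae ?_
  filter_upwards [(hρ.memLp_testField ψ).coeFn_toLp, hv.coeFn_toLp] with p hp hp'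
  rw [hp', real_inner_comm]
  exact congrArg₂ _ rfl hp.symm

/-- The squared norm is the integral of the bounded continuous function ‖ψ‖², so narrow convergence
applies. This links the varying L² spaces. -/
lemma tendsto_norm_testEmbedding {ρ : ℕ → ℝ → Space d → ℝ} {σ : ℝ → Space d → ℝ}
    (hρ : ∀ k, IsProbCurve (ρ k)) (hσ : IsProbCurve σ)
    (hconv : ∀ t, 0 < t → NarrowTendsto (fun k => ρ k t) (σ t)) (ψ : testFields d) :
    Tendsto (fun k => ‖(hρ k).testEmbedding ψ‖) atTop (𝓝 ‖hσ.testEmbedding ψ‖) := by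
  obtain ⟨T, hT⟩ := ψ.2
  let f : (ℝ × Space d) →ᵇ ℝ := BoundedContinuousFunction.ofNormedAddCommGroup
    (fun p => ‖(ψ : (ℝ × Space d) →ᵇ Space d) p‖ ^ 2)
    ((ψ : (ℝ × Space d) →ᵇ Space d).continuous.norm.pow 2)
    (‖(ψ : (ℝ × Space d) →ᵇ Space d)‖ ^ 2) fun p => by
      rw [Real.norm_of_nonneg (by positivity)]
      gcongr
      exact BoundedContinuousFunction.norm_coe_le_norm _ p
  have h1 := tendsto_integral_spaceTime hρ hσ hconv f (T := T)
    (fun t x ht => by simp [f, hT t x ht])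
  have h2 : Tendsto (fun k => ‖(hρ k).testEmbedding ψ‖ ^ 2) atTop
      (𝓝 (‖hσ.testEmbedding ψ‖ ^ 2)) := by
    simp_rw [IsProbCurve.norm_testEmbedding_sq]
    exact h1
  simpa [Real.sqrt_sq (norm_nonneg _)] using h2.sqrt

/-- The momentum of a square integrable velocity, as a functional on test fields. -/
noncomputable def IsProbCurve.momentumFunctional {ρ : ℝ → Space d → ℝ} (hρ : IsProbCurve ρ)
    {v : ℝ → Space d → Space d} (hv : MemLp (Function.uncurry v) 2 (spaceTimeMeasure ρ)) :
    testFields d →ₗ[ℝ] ℝ :=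
  (innerₛₗ ℝ (hv.toLp (Function.uncurry v))).comp hρ.testEmbedding

lemma IsProbCurve.momentumFunctional_apply {ρ : ℝ → Space d → ℝ} (hρ : IsProbCurve ρ)
    {v : ℝ → Space d → Space d} (hv : MemLp (Function.uncurry v) 2 (spaceTimeMeasure ρ))
    (ψ : testFields d) :
    hρ.momentumFunctional hv ψ = momentum ρ v (ψ : (ℝ × Space d) →ᵇ Space d) :=
  (hρ.momentum_eq_inner hv ψ).symm

lemma IsProbCurve.abs_momentumFunctional_le {ρ : ℝ → Space d → ℝ} (hρ : IsProbCurve ρ)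
    {v : ℝ → Space d → Space d} (hv : MemLp (Function.uncurry v) 2 (spaceTimeMeasure ρ))
    {C : ℝ≥0} (hC : eLpNorm (Function.uncurry v) 2 (spaceTimeMeasure ρ) ≤ C) (ψ : testFields d) :
    |hρ.momentumFunctional hv ψ| ≤ C * ‖hρ.testEmbedding ψ‖ := by
  rw [hρ.momentumFunctional_apply, hρ.momentum_eq_inner hv]
  refine (abs_real_inner_le_norm _ _).trans ?_
  gcongr
  rw [Lp.norm_toLp]
  exact ENNReal.toReal_le_coe_of_le_coe hC

/-- Weak compactness of velocities along a converging sequence of curves. -/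
theorem exists_limit_velocity {ρ : ℕ → ℝ → Space d → ℝ} {σ : ℝ → Space d → ℝ}
    (hρ : ∀ k, IsProbCurve (ρ k)) (hσ : IsProbCurve σ)
    (hconv : ∀ t, 0 < t → NarrowTendsto (fun k => ρ k t) (σ t))
    (v : ℕ → ℝ → Space d → Space d)
    (hv : ∀ k, MemLp (Function.uncurry (v k)) 2 (spaceTimeMeasure (ρ k))) {C : ℝ≥0}
    (hC : ∀ k, eLpNorm (Function.uncurry (v k)) 2 (spaceTimeMeasure (ρ k)) ≤ C) :
    ∃ φ : ℕ → ℕ, StrictMono φ ∧ ∃ w : ℝ → Space d → Space d,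
      MemLp (Function.uncurry w) 2 (spaceTimeMeasure σ) ∧
      ∀ ψ ∈ testFields d, Tendsto (fun j => momentum (ρ (φ j)) (v (φ j)) ψ) atTop
        (𝓝 (momentum σ w ψ)) := by
  have := hσ.isLocallyFiniteMeasure
  have : Fact ((2 : ℝ≥0∞) ≠ ∞) := ⟨by simp⟩
  have hb : ∀ k (ψ : testFields d), |(hρ k).momentumFunctional (hv k) ψ| ≤
      (C : ℝ) * ‖(hρ k).testEmbedding ψ‖ := fun k ψ =>
    (hρ k).abs_momentumFunctional_le (hv k) (hC k) ψ
  have hN := tendsto_norm_testEmbedding hρ hσ hconv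
  set L : ℕ → testFields d →ₗ[ℝ] ℝ := fun k => (hρ k).momentumFunctional (hv k) with hL
  set N : ℕ → testFields d → ℝ := fun k ψ => ‖(hρ k).testEmbedding ψ‖ with hNdef
  have key := @exists_weak_limit (testFields d) (Lp (Space d) 2 (spaceTimeMeasure σ)) _ _ _ _ _ _
    hσ.testEmbedding
  have hd : ∀ u : Lp (Space d) 2 (spaceTimeMeasure σ), ∀ r > 0, ∃ ψ : testFields d,
    ‖u - hσ.testEmbedding ψ‖ < r := fun u r hr => hσ.exists_testEmbedding_near u hr
  obtain ⟨φ, hφ, u, hu⟩ := key hd L N C hb hN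
  have hw : MemLp (Function.uncurry fun t x => u (t, x)) 2 (spaceTimeMeasure σ) := Lp.memLp u
  refine ⟨φ, hφ, fun t x => u (t, x), hw, fun ψ hψ => ?_⟩
  have h1 := hu ⟨ψ, hψ⟩
  simp only [hL, IsProbCurve.momentumFunctional_apply] at h1
  have h3 : hw.toLp (Function.uncurry fun t x => u (t, x)) = u := Lp.toLp_coeFn u _
  have h2 := hσ.momentum_eq_inner hw ⟨ψ, hψ⟩
  rw [h3] at h2
  rw [h2]
  exact h1

/-! ### Velocities and the approximate continuity equation of a discrete flow -/

/-- Comparison of the transport along a segment with the transport at its end point. -/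
lemma norm_integral_fderiv_sub_le {E : Type*} [NormedAddCommGroup E] [NormedSpace ℝ E]
    {φ : ℝ × E → ℝ} (hφ : ContDiff ℝ 1 φ) {L : ℝ≥0} (hL : LipschitzWith L (fderiv ℝ φ))
    {τ : ℝ} (hτ : 0 < τ) (a : ℝ) (y₀ y₁ : E) :
    ‖(∫ t in a..(a + τ), fderiv ℝ φ (t, y₁) (1, τ⁻¹ • (y₁ - y₀))) -
        (φ (a + τ, y₁) - φ (a, y₀))‖ ≤ L * (τ ^ 2 / 2 + 3 / 2 * ‖y₁ - y₀‖ ^ 2) := by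
  have hφ' : Continuous (fderiv ℝ φ) := hφ.continuous_fderiv (by simp)
  let w : E := τ⁻¹ • (y₁ - y₀)
  -- The segment traversed at constant velocity from `y₀` at time a to `y₁` at time a + τ.
  let γ : ℝ → ℝ × E := fun t => (t, y₀ + (t - a) • w)
  have hγ : ∀ t, HasDerivAt γ (1, w) t := fun t => by
    have h1 : HasDerivAt (fun t : ℝ => y₀ + (t - a) • w) w t := by
      simpa using (((hasDerivAt_id t).sub_const a).smul_const w).const_add y₀
    exact (hasDerivAt_id t).prodMk h1
  have hγc : Continuous γ := by fun_prop
  have hd : ∀ t, HasDerivAt (φ ∘ γ) (fderiv ℝ φ (γ t) (1, w)) t := fun t =>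
    ((hφ.differentiable (by simp) (γ t)).hasFDerivAt).comp_hasDerivAt t (hγ t)
  have hi : IntervalIntegrable (fun t => fderiv ℝ φ (γ t) (1, w)) volume a (a + τ) :=
    ((hφ'.comp hγc).clm_apply continuous_const).intervalIntegrable _ _
  have hi' : IntervalIntegrable (fun t => fderiv ℝ φ (t, y₁) (1, w)) volume a (a + τ) :=
    ((hφ'.comp (by fun_prop)).clm_apply continuous_const).intervalIntegrable _ _
  have hftc := intervalIntegral.integral_eq_sub_of_hasDerivAt (fun t _ => hd t) hi
  have hend : γ (a + τ) = (a + τ, y₁) := by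
    simp only [γ, w, add_sub_cancel_left, smul_smul, mul_inv_cancel₀ hτ.ne', one_smul,
      add_sub_cancel]
  have hstart : γ a = (a, y₀) := by simp [γ]
  simp only [Function.comp_apply, hend, hstart] at hftc
  rw [← hftc, ← intervalIntegral.integral_sub hi' hi]
  have hw : τ * ‖w‖ = ‖y₁ - y₀‖ := by
    rw [norm_smul, norm_inv, Real.norm_of_nonneg hτ.le, mul_inv_cancel_left₀ hτ.ne']
  have hbound : ∀ t ∈ uIoc a (a + τ),
      ‖fderiv ℝ φ (t, y₁) (1, w) - fderiv ℝ φ (γ t) (1, w)‖ ≤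
        L * ‖y₁ - y₀‖ * (1 + ‖w‖) := by
    intro t ht
    rw [uIoc_of_le (by linarith)] at ht
    rw [← sub_apply]
    refine (ContinuousLinearMap.le_opNorm _ _).trans ?_
    have h1 : ‖((1 : ℝ), w)‖ ≤ 1 + ‖w‖ := by
      rw [Prod.norm_def]
      simp
    have h2 : ‖fderiv ℝ φ (t, y₁) - fderiv ℝ φ (γ t)‖ ≤ L * ‖y₁ - y₀‖ := by
      refine (hL.norm_sub_le _ _).trans ?_
      gcongr
      have h3 : y₁ = y₀ + τ • w := by
        simp only [w, smul_smul, mul_inv_cancel₀ hτ.ne', one_smul, add_sub_cancel]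
      have h4 : ((t, y₁) : ℝ × E) - γ t = (0, (τ - (t - a)) • w) := by
        simp only [γ, Prod.mk_sub_mk, sub_self, Prod.mk.injEq, true_and]
        rw [h3, sub_smul τ, add_sub_add_left_eq_sub]
      rw [h4, Prod.norm_def, ← hw, norm_zero, max_eq_right (norm_nonneg _), norm_smul,
        Real.norm_of_nonneg (by linarith [ht.2])]
      gcongr
      linarith [ht.1]
    gcongr
  refine (intervalIntegral.norm_integral_le_of_norm_le_const hbound).trans ?_
  rw [add_sub_cancel_left, abs_of_pos hτ]
  calc L * ‖y₁ - y₀‖ * (1 + ‖w‖) * τ = L * (‖y₁ - y₀‖ * (τ + τ * ‖w‖)) := by ring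
    _ = L * (‖y₁ - y₀‖ * (τ + ‖y₁ - y₀‖)) := by rw [hw]
    _ ≤ _ := by
        -- The constants come from δτ ≤ τ²/2 + δ²/2, with δ = ‖y₁ - y₀‖, plus the term δ².
        gcongr
        nlinarith [sq_nonneg (τ - ‖y₁ - y₀‖)]

namespace DiscreteFlow

variable {d : ℕ} (F : DiscreteFlow d)

/-- The measure on times and labels. -/
noncomputable def labelMeasure : Measure (ℝ × Space d) :=
  (volume.restrict (Ioi (0 : ℝ))).prod F.m

/-- Time and interpolated position. -/
noncomputable def position (p : ℝ × Space d) : ℝ × Space d := (p.1, F.X (F.idx p.1) p.2)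

/-- The interpolated speed. -/
noncomputable def speed (p : ℝ × Space d) : Space d :=
  F.τ⁻¹ • (F.X (F.idx p.1) p.2 - F.X (F.idx p.1 - 1) p.2)

lemma measurable_idx_apply {E : Type*} [MeasurableSpace E] {Y : ℕ → Space d → E}
    (hY : ∀ n, Measurable (Y n)) : Measurable fun p : ℝ × Space d => Y (F.idx p.1) p.2 :=
  (measurable_from_prod_countable_right (f := fun q : ℕ × Space d => Y q.1 q.2) hY).comp
    ((F.measurable_idx.comp measurable_fst).prodMk measurable_snd)

lemma measurable_position : Measurable F.position :=
  measurable_fst.prodMk (F.measurable_idx_apply F.measurable_X)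

lemma measurable_speed : Measurable F.speed :=
  F.measurable_idx_apply (Y := fun n ω => F.τ⁻¹ • (F.X n ω - F.X (n - 1) ω)) fun n =>
    ((F.measurable_X n).sub (F.measurable_X (n - 1))).const_smul F.τ⁻¹

/-- Space-time integrals become integrals over times and labels, where the velocity is an explicit
difference quotient. -/
lemma spaceTimeMeasure_eq_map {ρ : ℝ → Space d → ℝ} (hρ : IsProbCurve ρ)
    (hlaw : ∀ t, densityMeasure (ρ t) = F.law (F.idx t)) :
    spaceTimeMeasure ρ = F.labelMeasure.map F.position := Measure.ext fun A hA => by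
  rw [hρ.spaceTimeMeasure_apply hA, Measure.map_apply F.measurable_position hA, labelMeasure,
    Measure.prod_apply (F.measurable_position hA)]
  refine lintegral_congr fun t => ?_
  rw [hlaw, law, Measure.map_apply (F.measurable_X _) (measurable_prodMk_left hA)]
  rfl

lemma idx_pos {t : ℝ} (ht : 0 < t) : 1 ≤ F.idx t := Nat.ceil_pos.2 (div_pos ht F.τ_pos)

lemma idx_eq_succ {n : ℕ} {t : ℝ} (ht : t ∈ Ioc (n * F.τ) ((n + 1 : ℕ) * F.τ)) :
    F.idx t = n + 1 := by
  rw [idx, Nat.ceil_eq_iff (Nat.succ_ne_zero n), lt_div_iff₀ F.τ_pos, div_le_iff₀ F.τ_pos]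
  exact ⟨by simpa using ht.1, ht.2⟩

lemma iUnion_timeStep : ⋃ n : ℕ, Ioc (n * F.τ) ((n + 1 : ℕ) * F.τ) = Ioi 0 := by
  ext t
  simp only [mem_iUnion]
  constructor
  · rintro ⟨n, hn⟩
    exact lt_of_le_of_lt (mul_nonneg n.cast_nonneg F.τ_pos.le) hn.1
  · intro ht
    have h1 := F.idx_pos ht
    obtain ⟨n, hn⟩ := Nat.exists_eq_add_of_le' h1
    rw [idx, Nat.ceil_eq_iff (Nat.succ_ne_zero n), lt_div_iff₀ F.τ_pos, div_le_iff₀ F.τ_pos] at hn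
    exact ⟨n, by simpa using hn.1, hn.2⟩

lemma lintegral_idx (g : ℕ → ℝ≥0∞) :
    ∫⁻ t in Ioi 0, g (F.idx t) = ∑' n : ℕ, g (n + 1) * ENNReal.ofReal F.τ := by
  rw [← F.iUnion_timeStep, lintegral_iUnion (fun n => measurableSet_Ioc)]
  · refine tsum_congr fun n => ?_
    rw [setLIntegral_congr_fun measurableSet_Ioc
      (fun t ht => by rw [F.idx_eq_succ ht] : EqOn _ (fun _ => g (n + 1)) _),
      setLIntegral_const, Real.volume_Ioc]
    congr 2
    push_cast
    ring
  · intro i j hij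
    refine Set.disjoint_left.2 fun t hi hj => hij ?_
    have := (F.idx_eq_succ hi).symm.trans (F.idx_eq_succ hj)
    omega

variable {F}

/-- Each step lasts τ, so the factor τ⁻² of the squared speed becomes τ⁻¹ and cancels the τ of the
action bound. -/
lemma ActionBound.lintegral_speed_sq_le {C : ℝ≥0} (hF : F.ActionBound C) :
    ∫⁻ p, ‖F.speed p‖ₑ ^ 2 ∂F.labelMeasure ≤ C := by
  rw [labelMeasure, lintegral_prod _ (F.measurable_speed.enorm.pow_const 2).aemeasurable]
  change ∫⁻ t in Ioi 0, (fun n => ∫⁻ ω, ‖F.τ⁻¹ • (F.X n ω - F.X (n - 1) ω)‖ₑ ^ 2 ∂F.m) (F.idx t)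
    ≤ C
  rw [F.lintegral_idx fun n => ∫⁻ ω, ‖F.τ⁻¹ • (F.X n ω - F.X (n - 1) ω)‖ₑ ^ 2 ∂F.m]
  refine ENNReal.tsum_le_of_sum_range_le fun N => ?_
  have hτ := F.τ_pos
  have h1 : ENNReal.ofReal F.τ⁻¹ * ENNReal.ofReal F.τ = 1 := by
    rw [← ENNReal.ofReal_mul (by positivity), inv_mul_cancel₀ hτ.ne', ENNReal.ofReal_one]
  have hterm : ∀ n : ℕ, (∫⁻ ω, ‖F.τ⁻¹ • (F.X (n + 1) ω - F.X (n + 1 - 1) ω)‖ₑ ^ 2 ∂F.m) *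
      ENNReal.ofReal F.τ =
      ENNReal.ofReal F.τ⁻¹ * ∫⁻ ω, ‖F.X (n + 1) ω - F.X n ω‖ₑ ^ 2 ∂F.m := fun n => by
    simp only [enorm_smul, mul_pow, add_tsub_cancel_right]
    have hm : Measurable fun ω => F.X (n + 1) ω - F.X n ω :=
      (F.measurable_X _).sub (F.measurable_X n)
    rw [lintegral_const_mul _ (hm.enorm.pow_const 2),
      Real.enorm_of_nonneg (by positivity), mul_right_comm, sq, mul_assoc _ _ (ENNReal.ofReal F.τ),
      h1, mul_one]
  simp only [hterm]
  rw [← Finset.mul_sum]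
  calc _ ≤ ENNReal.ofReal F.τ⁻¹ * (C * ENNReal.ofReal F.τ) := by
        gcongr
        exact hF N
    _ = C := by rw [mul_left_comm, h1, mul_one]

variable (F)

/-- The properties need not be measurable, so exceptional sets pass to measurable hulls before the
product measure is evaluated. Index 0 is never visited at positive times. -/
lemma ae_labelMeasure {P : ℕ → Space d → Prop} (hP : ∀ n, 1 ≤ n → ∀ᵐ ω ∂F.m, P n ω) :
    ∀ᵐ p ∂F.labelMeasure, P (F.idx p.1) p.2 := by
  have hm : MeasurableSet {p : ℝ × Space d | p.2 ∈ toMeasurable F.m {ω | ¬ P (F.idx p.1) ω}} :=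
    F.measurable_idx_apply (Y := fun n ω => ω ∈ toMeasurable F.m {ω | ¬ P n ω})
      (fun n => measurable_mem.2 (measurableSet_toMeasurable _ _)) (measurableSet_singleton True)
      |> fun h => by simpa [preimage] using h
  refine measure_mono_null (t := {p : ℝ × Space d |
    p.2 ∈ toMeasurable F.m {ω | ¬ P (F.idx p.1) ω}})
    (fun p hp => subset_toMeasurable _ _ hp) ?_
  rw [labelMeasure, Measure.prod_apply hm]
  refine (setLIntegral_congr_fun measurableSet_Ioi fun t ht => ?_).trans lintegral_zero
  change F.m (toMeasurable F.m {ω | ¬ P (F.idx t) ω}) = 0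
  rw [measure_toMeasurable]
  exact hP _ (F.idx_pos ht)

variable {F}

section Velocity

variable {ρ : ℝ → Space d → ℝ} {v : ℕ → Space d → Space d}

lemma aestronglyMeasurable_velocity (hρ : IsProbCurve ρ)
    (hlaw : ∀ t, densityMeasure (ρ t) = F.law (F.idx t))
    (hv : ∀ n, 1 ≤ n → AEStronglyMeasurable (v n) (F.law n)) :
    AEStronglyMeasurable (fun p : ℝ × Space d => v (F.idx p.1) p.2) (spaceTimeMeasure ρ) := by
  have key : ∀ n, ∃ w : Space d → Space d, Measurable w ∧ ∃ N, MeasurableSet N ∧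
      (1 ≤ n → F.law n N = 0) ∧ ∀ x ∉ N, v n x = w x := fun n => by
    by_cases hn : 1 ≤ n
    · refine ⟨(hv n hn).mk, (hv n hn).stronglyMeasurable_mk.measurable,
        toMeasurable (F.law n) {x | ¬ v n x = (hv n hn).mk (v n) x},
        measurableSet_toMeasurable _ _, fun _ => ?_, fun x hx => ?_⟩
      · rw [measure_toMeasurable]
        exact (hv n hn).ae_eq_mk
      · by_contra h
        exact hx (subset_toMeasurable _ _ h)
    -- At index 0 nothing is known, and the whole space is declared exceptional; positive times
    -- never see it.
    · exact ⟨0, measurable_zero, univ, .univ, fun h => absurd h hn,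
        fun x hx => absurd (mem_univ x) hx⟩
  choose w hw N hN hN0 hwv using key
  refine ⟨fun p => w (F.idx p.1) p.2, (F.measurable_idx_apply hw).stronglyMeasurable, ?_⟩
  have hm : MeasurableSet {p : ℝ × Space d | p.2 ∈ N (F.idx p.1)} :=
    F.measurable_idx_apply (Y := fun n ω => ω ∈ N n)
      (fun n => measurable_mem.2 (hN n)) (measurableSet_singleton True)
      |> fun h => by simpa [preimage] using h
  refine measure_mono_null (t := {p : ℝ × Space d | p.2 ∈ N (F.idx p.1)})
    (fun p hp => by_contra fun h => hp (hwv _ _ h)) ?_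
  rw [hρ.spaceTimeMeasure_apply hm]
  refine (setLIntegral_congr_fun measurableSet_Ioi fun t ht => ?_).trans lintegral_zero
  rw [hlaw]
  exact hN0 _ (F.idx_pos ht)

lemma velocity_position_ae_eq
    (hv' : ∀ n, 1 ≤ n → ∀ᵐ ω ∂F.m, v n (F.X n ω) = F.τ⁻¹ • (F.X n ω - F.X (n - 1) ω)) :
    ∀ᵐ p ∂F.labelMeasure, v (F.idx (F.position p).1) (F.position p).2 = F.speed p :=
  F.ae_labelMeasure (P := fun n ω => v n (F.X n ω) = F.τ⁻¹ • (F.X n ω - F.X (n - 1) ω)) hv'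

lemma ActionBound.eLpNorm_speed_le {C : ℝ≥0} (hF : F.ActionBound C) :
    eLpNorm F.speed 2 F.labelMeasure ≤ NNReal.sqrt C := by
  rw [eLpNorm_eq_lintegral_rpow_enorm_toReal (by simp) (by simp), NNReal.sqrt_eq_rpow,
    ENNReal.coe_rpow_of_nonneg _ (by norm_num)]
  simp only [ENNReal.toReal_ofNat, ENNReal.rpow_ofNat]
  gcongr
  exact hF.lintegral_speed_sq_le

lemma ActionBound.eLpNorm_velocity_le {C : ℝ≥0} (hF : F.ActionBound C) (hρ : IsProbCurve ρ)
    (hlaw : ∀ t, densityMeasure (ρ t) = F.law (F.idx t))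
    (hv : ∀ n, 1 ≤ n → AEStronglyMeasurable (v n) (F.law n))
    (hv' : ∀ n, 1 ≤ n → ∀ᵐ ω ∂F.m, v n (F.X n ω) = F.τ⁻¹ • (F.X n ω - F.X (n - 1) ω)) :
    eLpNorm (fun p : ℝ × Space d => v (F.idx p.1) p.2) 2 (spaceTimeMeasure ρ) ≤
      NNReal.sqrt C := by
  have hm := aestronglyMeasurable_velocity hρ hlaw hv
  rw [F.spaceTimeMeasure_eq_map hρ hlaw] at hm ⊢
  rw [eLpNorm_map_measure hm F.measurable_position.aemeasurable]
  exact (eLpNorm_congr_ae (velocity_position_ae_eq hv')).trans_le hF.eLpNorm_speed_le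

end Velocity

section ContinuityEquation

variable {φ : ℝ × Space d → ℝ} {L : ℝ≥0} {T : ℝ}

/-- The increments of φ along the path of a label telescope to 0, since φ vanishes at time 0 and at
N τ ≥ T. Only the error of each step remains. -/
lemma norm_integral_path_le (hφ : ContDiff ℝ 1 φ) (hL : LipschitzWith L (fderiv ℝ φ))
    (hT : tsupport φ ⊆ Ioo 0 T ×ˢ univ) {N : ℕ} (hN : T ≤ N * F.τ) (ω : Space d) :
    ‖∫ t in Ioi 0, fderiv ℝ φ (F.position (t, ω)) (1, F.speed (t, ω))‖ ≤
      ∑ n ∈ Finset.range N, L * (F.τ ^ 2 / 2 + 3 / 2 * ‖F.X (n + 1) ω - F.X n ω‖ ^ 2) := by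
  have hφ' : Continuous (fderiv ℝ φ) := hφ.continuous_fderiv (by simp)
  have hτ := F.τ_pos
  set g : ℝ → ℝ := fun t => fderiv ℝ φ (F.position (t, ω)) (1, F.speed (t, ω)) with hg
  have h0 : ∀ t, T ≤ t → g t = 0 := fun t ht => by
    have : F.position (t, ω) ∉ tsupport φ := fun h => not_lt.2 ht (hT h).1.2
    simp only [hg, Function.notMem_support.1 fun h => this (support_fderiv_subset ℝ h),
      zero_apply]
  have hstep : ∀ n : ℕ, EqOn (fun t => fderiv ℝ φ (t, F.X (n + 1) ω)
      (1, F.τ⁻¹ • (F.X (n + 1) ω - F.X n ω))) g (uIoc (n * F.τ) ((n + 1 : ℕ) * F.τ)) := by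
    intro n t ht
    rw [uIoc_of_le (by push_cast; linarith)] at ht
    simp only [hg, position, speed, F.idx_eq_succ ht, add_tsub_cancel_right]
  have hint : ∀ n < N, IntervalIntegrable g volume (n * F.τ) ((n + 1 : ℕ) * F.τ) := fun n _ =>
    (((hφ'.comp (by fun_prop)).clm_apply continuous_const).intervalIntegrable _ _).congr
      (hstep n)
  have hsum : ∫ t in Ioi 0, g t =
      ∑ n ∈ Finset.range N, ∫ t in (n * F.τ)..((n + 1 : ℕ) * F.τ), g t := by
    rw [intervalIntegral.sum_integral_adjacent_intervals (a := fun n : ℕ => n * F.τ) hint,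
      Nat.cast_zero, zero_mul, intervalIntegral.integral_of_le (by positivity)]
    refine setIntegral_eq_of_subset_of_forall_sdiff_eq_zero measurableSet_Ioi
      Ioc_subset_Ioi_self fun t ht => h0 t ?_
    by_contra! h
    exact ht.2 ⟨ht.1, by linarith⟩
  have htel : ∑ n ∈ Finset.range N,
      (φ ((n + 1 : ℕ) * F.τ, F.X (n + 1) ω) - φ (n * F.τ, F.X n ω)) = 0 := by
    rw [Finset.sum_range_sub (fun n : ℕ => φ (n * F.τ, F.X n ω)),
      image_eq_zero_of_notMem_tsupport (fun h => not_lt.2 hN (hT h).1.2),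
      image_eq_zero_of_notMem_tsupport (fun h => absurd (hT h).1.1 (by simp)), sub_zero]
  rw [hsum, ← sub_zero (∑ n ∈ _, _), ← htel, ← Finset.sum_sub_distrib]
  refine norm_sum_le_of_le _ fun n _ => ?_
  have h1 := norm_integral_fderiv_sub_le hφ hL hτ (n * F.τ) (F.X n ω) (F.X (n + 1) ω)
  have h2 : (n : ℝ) * F.τ + F.τ = (n + 1 : ℕ) * F.τ := by push_cast; ring
  rw [h2] at h1
  rwa [← intervalIntegral.integral_congr_ae (ae_of_all _ fun t ht => hstep n ht)]

/-- Needed for Fubini: on times before T, the integrand is at most B(1 + |speed|) ≤ 2B + B|speed|².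
-/
lemma ActionBound.integrable_fderiv_speed {C : ℝ≥0} (hF : F.ActionBound C) (hφ : ContDiff ℝ 1 φ)
    (hc : HasCompactSupport φ) (hT : tsupport φ ⊆ Ioo 0 T ×ˢ univ) :
    Integrable (fun p => fderiv ℝ φ (F.position p) (1, F.speed p)) F.labelMeasure := by
  have hφ' : Continuous (fderiv ℝ φ) := hφ.continuous_fderiv (by simp)
  obtain ⟨B, hB⟩ := (hc.fderiv ℝ).exists_bound_of_continuous hφ'
  have hB0 : 0 ≤ B := (norm_nonneg _).trans (hB 0)
  have hspeed : MemLp F.speed 2 F.labelMeasure :=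
    ⟨F.measurable_speed.aestronglyMeasurable, hF.eLpNorm_speed_le.trans_lt ENNReal.coe_lt_top⟩
  have hfin : F.labelMeasure (Iio T ×ˢ univ) ≠ ∞ := by
    rw [labelMeasure, Measure.prod_prod, Measure.restrict_apply measurableSet_Iio, measure_univ,
      mul_one, inter_comm, Ioi_inter_Iio, Real.volume_Ioo]
    exact ENNReal.ofReal_ne_top
  have hdom : Integrable (fun p => (Iio T ×ˢ univ).indicator (fun _ => 2 * B) p +
      B * ‖F.speed p‖ ^ 2) F.labelMeasure := by
    refine ((integrable_indicator_iff (measurableSet_Iio.prod .univ)).2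
      (integrableOn_const hfin)).add ?_
    exact (hspeed.integrable_norm_pow (by simp)).const_mul B
  refine hdom.mono' ?_ (ae_of_all _ fun p => ?_)
  · exact (isBoundedBilinearMap_apply.continuous.comp_aestronglyMeasurable
      ((hφ'.measurable.comp F.measurable_position).aestronglyMeasurable.prodMk
        (measurable_const.prodMk F.measurable_speed).aestronglyMeasurable))
  · by_cases hp : p ∈ Iio T ×ˢ (univ : Set (Space d))
    · rw [indicator_of_mem hp]
      refine ((fderiv ℝ φ (F.position p)).le_of_opNorm_le (hB _) _).trans ?_
      have h1 : ‖((1 : ℝ), F.speed p)‖ ≤ 1 + ‖F.speed p‖ := by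
        rw [Prod.norm_def]
        simp
      nlinarith [mul_le_mul_of_nonneg_left h1 hB0,
        mul_nonneg hB0 (sq_nonneg (‖F.speed p‖ - 1))]
    · have : F.position p ∉ tsupport φ := fun h => hp ⟨(hT h).1.2, mem_univ _⟩
      rw [Function.notMem_support.1 fun h => this (support_fderiv_subset ℝ h)]
      rw [indicator_of_notMem hp]
      simp only [zero_apply, norm_zero]
      positivity

/-- The continuity equation holds approximately for a discrete flow. -/
lemma ActionBound.norm_integral_fderiv_le {C : ℝ≥0} (hF : F.ActionBound C)
    {ρ : ℝ → Space d → ℝ} {v : ℕ → Space d → Space d} (hρ : IsProbCurve ρ)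
    (hlaw : ∀ t, densityMeasure (ρ t) = F.law (F.idx t))
    (hv : ∀ n, 1 ≤ n → AEStronglyMeasurable (v n) (F.law n))
    (hv' : ∀ n, 1 ≤ n → ∀ᵐ ω ∂F.m, v n (F.X n ω) = F.τ⁻¹ • (F.X n ω - F.X (n - 1) ω))
    (hφ : ContDiff ℝ 1 φ) (hc : HasCompactSupport φ) (hL : LipschitzWith L (fderiv ℝ φ))
    (hT0 : 0 ≤ T) (hT : tsupport φ ⊆ Ioo 0 T ×ˢ univ) :
    ‖∫ p, fderiv ℝ φ p (1, v (F.idx p.1) p.2) ∂spaceTimeMeasure ρ‖ ≤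
      L * ((T + F.τ) / 2 + 3 / 2 * C) * F.τ := by
  have hτ := F.τ_pos
  have hφ' : Continuous (fderiv ℝ φ) := hφ.continuous_fderiv (by simp)
  have hm := aestronglyMeasurable_velocity hρ hlaw hv
  have hm' : AEStronglyMeasurable
      (fun p : ℝ × Space d => fderiv ℝ φ p (1, v (F.idx p.1) p.2)) (spaceTimeMeasure ρ) :=
    isBoundedBilinearMap_apply.continuous.comp_aestronglyMeasurable
      (hφ'.aestronglyMeasurable.prodMk (aestronglyMeasurable_const.prodMk hm))
  have hint := hF.integrable_fderiv_speed hφ hc hT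
  -- In label coordinates the order of integration is exchanged, so the estimate can be made path by
  -- path.
  have heq : ∫ p, fderiv ℝ φ p (1, v (F.idx p.1) p.2) ∂spaceTimeMeasure ρ =
      ∫ ω, (∫ t in Ioi 0, fderiv ℝ φ (F.position (t, ω)) (1, F.speed (t, ω))) ∂F.m := by
    rw [F.spaceTimeMeasure_eq_map hρ hlaw] at hm' ⊢
    rw [integral_map F.measurable_position.aemeasurable hm', ← integral_prod_symm _ hint]
    refine integral_congr_ae ?_
    filter_upwards [velocity_position_ae_eq hv'] with p hp
    rw [hp]
  set N := ⌈T / F.τ⌉₊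
  have hN : T ≤ N * F.τ := (div_le_iff₀ hτ).1 (Nat.le_ceil _)
  -- The N step errors τ²/2 thus add up to at most (T + τ)τ/2; the action bound turns the squared
  -- increments into a term (3/2)Cτ.
  have hN' : N * F.τ ≤ T + F.τ := by
    have := (Nat.ceil_lt_add_one (div_nonneg hT0 hτ.le)).le
    calc (N : ℝ) * F.τ ≤ (T / F.τ + 1) * F.τ := by gcongr
      _ = T + F.τ := by field_simp
  have hsq : ∀ n, ∫⁻ ω, ‖F.X (n + 1) ω - F.X n ω‖ₑ ^ 2 ∂F.m ≠ ∞ := fun n =>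
    ne_top_of_le_ne_top (ENNReal.mul_ne_top ENNReal.coe_ne_top ENNReal.ofReal_ne_top)
      ((Finset.single_le_sum (f := fun n => ∫⁻ ω, ‖F.X (n + 1) ω - F.X n ω‖ₑ ^ 2 ∂F.m)
        (fun _ _ => zero_le) (Finset.mem_range.2 n.lt_succ_self)).trans (hF (n + 1)))
  have hsm : ∀ n, Measurable fun ω => F.X (n + 1) ω - F.X n ω := fun n =>
    (F.measurable_X _).sub (F.measurable_X n)
  have hsqi : ∀ n, Integrable (fun ω => ‖F.X (n + 1) ω - F.X n ω‖ ^ 2) F.m := fun n => by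
    refine ⟨((hsm n).norm.pow_const 2).aestronglyMeasurable, ?_⟩
    rw [HasFiniteIntegral]
    simpa [enorm_pow] using (hsq n).lt_top
  have hsqe : ∀ n, ENNReal.ofReal (∫ ω, ‖F.X (n + 1) ω - F.X n ω‖ ^ 2 ∂F.m) =
      ∫⁻ ω, ‖F.X (n + 1) ω - F.X n ω‖ₑ ^ 2 ∂F.m := fun n => by
    rw [ofReal_integral_eq_lintegral_ofReal (hsqi n) (ae_of_all _ fun _ => by positivity)]
    refine lintegral_congr fun ω => ?_
    rw [ENNReal.ofReal_pow (norm_nonneg _), ofReal_norm]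
  have hact : ∑ n ∈ Finset.range N, ∫ ω, ‖F.X (n + 1) ω - F.X n ω‖ ^ 2 ∂F.m ≤ C * F.τ := by
    rw [← ENNReal.ofReal_le_ofReal_iff (by positivity), ENNReal.ofReal_sum_of_nonneg
      (fun n _ => integral_nonneg fun _ => by positivity), ENNReal.ofReal_mul C.coe_nonneg,
      ENNReal.ofReal_coe_nnreal]
    simp only [hsqe]
    exact hF N
  rw [heq]
  have hi : ∀ n ∈ Finset.range N, Integrable (fun ω => L * (F.τ ^ 2 / 2 + 3 / 2 *
      ‖F.X (n + 1) ω - F.X n ω‖ ^ 2)) F.m := fun n _ =>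
    ((integrable_const _).add ((hsqi n).const_mul _)).const_mul _
  refine (norm_integral_le_of_norm_le (integrable_finsetSum _ hi)
    (ae_of_all _ fun ω => norm_integral_path_le hφ hL hT hN ω)).trans ?_
  rw [integral_finsetSum _ hi]
  have hterm : ∀ n, ∫ ω, L * (F.τ ^ 2 / 2 + 3 / 2 * ‖F.X (n + 1) ω - F.X n ω‖ ^ 2) ∂F.m =
      L * (F.τ ^ 2 / 2 + 3 / 2 * ∫ ω, ‖F.X (n + 1) ω - F.X n ω‖ ^ 2 ∂F.m) := fun n => by
    rw [integral_const_mul, integral_add (integrable_const _) ((hsqi n).const_mul _),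
      integral_const_mul]
    simp
  simp only [hterm]
  rw [← Finset.mul_sum, Finset.sum_add_distrib, ← Finset.mul_sum, Finset.sum_const,
    Finset.card_range, nsmul_eq_mul, mul_assoc]
  gcongr
  nlinarith

end ContinuityEquation

end DiscreteFlow

/-! ### Passage to the limit in the continuity equation -/

lemma exists_tsupport_subset_Ioo_prod {E : Type*} [NormedAddCommGroup E] {φ : ℝ × E → ℝ}
    (hc : HasCompactSupport φ) (hs : tsupport φ ⊆ Ioi (0 : ℝ) ×ˢ univ) :
    ∃ T : ℝ, 0 ≤ T ∧ tsupport φ ⊆ Ioo 0 T ×ˢ univ := by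
  obtain ⟨T, hT⟩ := (hc.isCompact.image continuous_fst).bddAbove
  refine ⟨max T 0 + 1, by positivity, fun p hp => ⟨⟨(hs hp).1, ?_⟩, mem_univ _⟩⟩
  have : p.1 ≤ T := hT ⟨p, hp, rfl⟩
  linarith [le_max_left T 0]

/-- The spatial gradient of a function on space-time. -/
noncomputable def spatialGradient (φ : ℝ × Space d → ℝ) (p : ℝ × Space d) : Space d :=
  (InnerProductSpace.toDual ℝ (Space d)).symm
    ((fderiv ℝ φ p).comp (ContinuousLinearMap.inr ℝ ℝ (Space d)))

lemma fderiv_apply_eq_add_inner (φ : ℝ × Space d → ℝ) (p : ℝ × Space d) (w : Space d) :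
    fderiv ℝ φ p (1, w) = fderiv ℝ φ p (1, 0) + ⟪spatialGradient φ p, w⟫ := by
  rw [spatialGradient, InnerProductSpace.toDual_symm_apply, ContinuousLinearMap.comp_apply,
    ContinuousLinearMap.inr_apply, ← map_add]
  simp

section TestFunction

variable {φ : ℝ × Space d → ℝ}

lemma exists_boundedContinuousFunction_fderiv (hφ : ContDiff ℝ 1 φ) (hc : HasCompactSupport φ)
    {T : ℝ} (hT : tsupport φ ⊆ Ioo 0 T ×ˢ univ) :
    ∃ f : (ℝ × Space d) →ᵇ ℝ, (∀ p, f p = fderiv ℝ φ p (1, 0)) ∧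
      ∀ t x, T ≤ t → f (t, x) = 0 := by
  have hφ' : Continuous (fderiv ℝ φ) := hφ.continuous_fderiv (by simp)
  have hcont : Continuous fun p => fderiv ℝ φ p (1, 0) := hφ'.clm_apply continuous_const
  have hz : ∀ p ∉ tsupport φ, fderiv ℝ φ p (1, 0) = 0 := fun p hp => by
    rw [Function.notMem_support.1 fun h => hp (support_fderiv_subset ℝ h), zero_apply]
  obtain ⟨B, hB⟩ := (HasCompactSupport.intro hc.isCompact hz).exists_bound_of_continuous hcont
  exact ⟨.ofNormedAddCommGroup _ hcont B hB, fun _ => rfl,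
    fun t x ht => hz _ fun h => not_lt.2 ht (hT h).1.2⟩

lemma exists_testField_spatialGradient (hφ : ContDiff ℝ 1 φ) (hc : HasCompactSupport φ)
    {T : ℝ} (hT : tsupport φ ⊆ Ioo 0 T ×ˢ univ) :
    ∃ ψ ∈ testFields d, ∀ p, ψ p = spatialGradient φ p := by
  have hφ' : Continuous (fderiv ℝ φ) := hφ.continuous_fderiv (by simp)
  have hcont : Continuous (spatialGradient φ) :=
    (InnerProductSpace.toDual ℝ (Space d)).symm.continuous.comp (hφ'.clm_comp continuous_const)
  have hz : ∀ p ∉ tsupport φ, spatialGradient φ p = 0 := fun p hp => by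
    rw [spatialGradient, Function.notMem_support.1 fun h => hp (support_fderiv_subset ℝ h),
      ContinuousLinearMap.zero_comp, map_zero]
  obtain ⟨B, hB⟩ := (HasCompactSupport.intro hc.isCompact hz).exists_bound_of_continuous hcont
  exact ⟨.ofNormedAddCommGroup _ hcont B hB,
    ⟨T, fun t x ht => hz _ fun h => not_lt.2 ht (hT h).1.2⟩, fun _ => rfl⟩

/-- The time derivative tests the density and the gradient tests the momentum; each part has its own
convergence. -/
lemma IsProbCurve.integral_fderiv_eq {ρ : ℝ → Space d → ℝ} (hρ : IsProbCurve ρ)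
    {v : ℝ → Space d → Space d} (hv : MemLp (Function.uncurry v) 2 (spaceTimeMeasure ρ))
    {f : (ℝ × Space d) →ᵇ ℝ} (hf : ∀ p, f p = fderiv ℝ φ p (1, 0)) {T : ℝ}
    (hT : ∀ t x, T ≤ t → f (t, x) = 0) {ψ : (ℝ × Space d) →ᵇ Space d} (hψ : ψ ∈ testFields d)
    (hψφ : ∀ p, ψ p = spatialGradient φ p) :
    ∫ p, fderiv ℝ φ p (1, v p.1 p.2) ∂spaceTimeMeasure ρ =
      ∫ p, f p ∂spaceTimeMeasure ρ + momentum ρ v ψ := by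
  have h1 : Integrable f (spaceTimeMeasure ρ) :=
    hρ.integrable_of_bound f.continuous.measurable f.norm_coe_le_norm hT
  have h2 : Integrable (fun p => ⟪ψ p, v p.1 p.2⟫) (spaceTimeMeasure ρ) := by
    refine (L2.integrable_inner (𝕜 := ℝ) ((hρ.memLp_testField ⟨ψ, hψ⟩).toLp _)
      (hv.toLp _)).congr ?_
    filter_upwards [(hρ.memLp_testField ⟨ψ, hψ⟩).coeFn_toLp, hv.coeFn_toLp] with p hp hp'
    rw [hp, hp']
    rfl
  rw [momentum, ← integral_add h1 h2]
  refine integral_congr_ae (ae_of_all _ fun p => ?_)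
  simp only [fderiv_apply_eq_add_inner φ p (v p.1 p.2), hf, hψφ]

end TestFunction

/-- The continuity equation is stable under convergence of the densities and the momenta. -/
theorem continuityEquation_of_tendsto {ρ : ℕ → ℝ → Space d → ℝ} {σ : ℝ → Space d → ℝ}
    (hρ : ∀ k, IsProbCurve (ρ k)) (hσ : IsProbCurve σ)
    (hconv : ∀ t, 0 < t → NarrowTendsto (fun k => ρ k t) (σ t))
    {v : ℕ → ℝ → Space d → Space d} {w : ℝ → Space d → Space d}
    (hv : ∀ k, MemLp (Function.uncurry (v k)) 2 (spaceTimeMeasure (ρ k)))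
    (hw : MemLp (Function.uncurry w) 2 (spaceTimeMeasure σ))
    (hmom : ∀ ψ ∈ testFields d,
      Tendsto (fun k => momentum (ρ k) (v k) ψ) atTop (𝓝 (momentum σ w ψ)))
    (herr : ∀ φ : ℝ × Space d → ℝ, ContDiff ℝ (⊤ : ℕ∞) φ → HasCompactSupport φ →
      tsupport φ ⊆ Ioi (0 : ℝ) ×ˢ (univ : Set (Space d)) →
      Tendsto (fun k => ∫ p, fderiv ℝ φ p ((1 : ℝ), v k p.1 p.2) ∂spaceTimeMeasure (ρ k)) atTop
        (𝓝 0)) :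
    ContinuityEquation σ w := by
  intro φ hφ hc hs
  obtain ⟨T, -, hT⟩ := exists_tsupport_subset_Ioo_prod hc hs
  have hφ1 : ContDiff ℝ 1 φ := hφ.of_le (by exact_mod_cast le_top)
  obtain ⟨f, hf, hfT⟩ := exists_boundedContinuousFunction_fderiv hφ1 hc hT
  obtain ⟨ψ, hψ, hψφ⟩ := exists_testField_spatialGradient hφ1 hc hT
  have h1 := herr φ hφ hc hs
  simp_rw [fun k => (hρ k).integral_fderiv_eq (hv k) hf hfT hψ hψφ] at h1
  rw [hσ.integral_fderiv_eq hw hf hfT hψ hψφ]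
  exact tendsto_nhds_unique
    ((tendsto_integral_spaceTime hρ hσ hconv f hfT).add (hmom ψ hψ)) h1

namespace Discretization

variable {K : Set (Space d)} {D : Discretization K} {ρbar : Space d → ℝ}
  {G : ℕ → Space d → Space d}

lemma isProbCurve_densityInterp (hρ : IsProbDensity ρbar)
    (hK : (densityMeasure ρbar).support = K) (hG : ∀ n, G n ∈ D.ansatz) :
    IsProbCurve (D.densityInterp ρbar G) where
  measurable := (D.flow ρbar G hρ hK hG).measurable_idx_apply (Y := D.density ρbar G)
    fun _ => (Measure.measurable_rnDeriv _ _).ennreal_toReal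
  prob t := by
    rw [densityInterp, flow_law hρ hK hG]
    infer_instance

end Discretization

lemma tendsto_probabilityMeasure_of_narrowTendsto {ρ : ℕ → Space d → ℝ} {σ : Space d → ℝ}
    {μ : ℕ → ProbabilityMeasure (Space d)} {ν : ProbabilityMeasure (Space d)}
    (hμ : ∀ k, densityMeasure (ρ k) = μ k) (hν : densityMeasure σ = ν) :
    NarrowTendsto ρ σ ↔ Tendsto μ atTop (𝓝 ν) := by
  simp only [NarrowTendsto, ProbabilityMeasure.tendsto_iff_forall_integral_tendsto, hμ, hν]

lemma IsProbDensity.isProbabilityMeasure {ρ : Space d → ℝ} (hρ : IsProbDensity ρ) :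
    IsProbabilityMeasure (densityMeasure ρ) := ⟨by
  rw [densityMeasure, withDensity_apply _ .univ, setLIntegral_univ,
    ← ofReal_integral_eq_lintegral_ofReal hρ.integrable hρ.nonneg, hρ.mass, ENNReal.ofReal_one]⟩

lemma IsProbDensity.lintegral_sq_ne_top {ρ : Space d → ℝ} (hρ : IsProbDensity ρ) :
    ∫⁻ x, ‖x‖ₑ ^ 2 ∂densityMeasure ρ ≠ ∞ := by
  have h0 : AEMeasurable (fun x => ENNReal.ofReal (ρ x)) volume :=
    hρ.integrable.aestronglyMeasurable.aemeasurable.ennreal_ofReal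
  rw [densityMeasure, lintegral_withDensity_eq_lintegral_mul₀ h0
    (measurable_enorm.pow_const 2).aemeasurable]
  have h1 := hρ.second_moment.lintegral_lt_top.ne
  refine ne_of_eq_of_ne (lintegral_congr fun x => ?_) h1
  rw [Pi.mul_apply, ENNReal.ofReal_mul (by positivity), ENNReal.ofReal_pow (norm_nonneg _),
    ofReal_norm, mul_comm]

end LagrangianScheme

/-! ### Assembly of the main theorem -/

theorem mainTheorem1 {d : ℕ} (hd : 1 ≤ d)
    -- internal energy density and potential
    (h : ℝ → ℝ) (hh : LagrangianScheme.IsInternalEnergy h)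
    (V : LagrangianScheme.Space d → ℝ) (hV : ContDiff ℝ 2 V) (hV0 : ∀ x, 0 ≤ V x)
    -- reference density, with convex and compact support, and initial density
    (ρbar : LagrangianScheme.Space d → ℝ) (hρbar : LagrangianScheme.IsProbDensity ρbar)
    (K : Set (LagrangianScheme.Space d))
    (hK : (LagrangianScheme.densityMeasure ρbar).support = K)
    (hKconvex : Convex ℝ K) (hKcompact : IsCompact K)
    (ρ₀ : LagrangianScheme.Space d → ℝ) (hρ₀ : LagrangianScheme.IsProbDensity ρ₀)
    -- a vanishing sequence of discretizations, with discrete solutions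
    (D : ℕ → LagrangianScheme.Discretization K)
    (hτ : Tendsto (fun k => (D k).τ) atTop (𝓝 0))
    (hmesh : Tendsto (fun k => (D k).meshSize) atTop (𝓝 0))
    (G : ℕ → ℕ → LagrangianScheme.Space d → LagrangianScheme.Space d)
    (hG : ∀ k, (D k).IsDiscreteSolution h V ρbar (G k))
    -- the inverse maps that enter the discrete velocities exist, up to null sets
    (hinj : ∀ k n, 1 ≤ n → ∃ N : Set (LagrangianScheme.Space d),
      volume N = 0 ∧ InjOn (G k n) (K \ N))
    -- approximation of the initial condition
    (hinit : LagrangianScheme.NarrowTendsto (fun k => (D k).density ρbar (G k) 0) ρ₀)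
    (henergy : ⨆ k, LagrangianScheme.energy h V ((D k).density ρbar (G k) 0) < ⊤) :
    ∃ φ : ℕ → ℕ, StrictMono φ ∧
    ∃ (ρs : ℝ → LagrangianScheme.Space d → ℝ)
      (vs : ℝ → LagrangianScheme.Space d → LagrangianScheme.Space d),
      -- the limit curve consists of probability densities with finite second moment
      Measurable (Function.uncurry ρs) ∧
      (∀ t, 0 ≤ t → LagrangianScheme.IsProbDensity (ρs t)) ∧
      -- narrow convergence at each time
      (∀ t, 0 ≤ t → LagrangianScheme.NarrowTendsto
        (fun j => (D (φ j)).densityInterp ρbar (G (φ j)) t) (ρs t)) ∧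
      -- Hölder continuity with exponent 1/2
      (∃ C : ℝ≥0, ∀ s t, 0 ≤ s → 0 ≤ t →
        LagrangianScheme.wasserstein2 (LagrangianScheme.densityMeasure (ρs s))
          (LagrangianScheme.densityMeasure (ρs t)) ≤
            C * ENNReal.ofReal (|t - s| ^ (1 / 2 : ℝ))) ∧
      -- the limit velocity is square integrable
      MemLp (Function.uncurry vs) 2 (LagrangianScheme.spaceTimeMeasure ρs) ∧
      -- weak-* convergence of the momenta
      (∀ (ψ : (ℝ × LagrangianScheme.Space d) →ᵇ LagrangianScheme.Space d) (T : ℝ),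
        (∀ t x, T ≤ t → ψ (t, x) = 0) →
        Tendsto (fun j => LagrangianScheme.momentum
            ((D (φ j)).densityInterp ρbar (G (φ j))) ((D (φ j)).velocityInterp (G (φ j))) ψ)
          atTop (𝓝 (LagrangianScheme.momentum ρs vs ψ))) ∧
      -- continuity equation
      LagrangianScheme.ContinuityEquation ρs vs := by
  have hVm : Measurable V := hV.continuous.measurable
  set E : ℝ≥0 := (⨆ k, LagrangianScheme.energy h V ((D k).density ρbar (G k) 0)).toNNReal
  have hE : ∀ k, LagrangianScheme.energy h V ((D k).density ρbar (G k) 0) ≤ E := fun k => by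
    rw [ENNReal.coe_toNNReal henergy.ne]
    exact le_iSup (fun k => LagrangianScheme.energy h V ((D k).density ρbar (G k) 0)) k
  set C : ℝ≥0 := 2 * E
  let F : ℕ → LagrangianScheme.DiscreteFlow d := fun k =>
    (D k).flow ρbar (G k) hρbar hK (hG k).mem_ansatz
  have hF : ∀ k, (F k).ActionBound C := fun k =>
    LagrangianScheme.Discretization.flow_actionBound hh hVm hρbar hK (hG k) (hE k)
  have hlaw : ∀ k t, LagrangianScheme.densityMeasure ((D k).densityInterp ρbar (G k) t) =
      (F k).law ((F k).idx t) := fun k t =>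
    LagrangianScheme.Discretization.flow_law hρbar hK (hG k).mem_ansatz _
  have hidx0 : ∀ k, (F k).idx 0 = 0 := fun k => by simp [LagrangianScheme.DiscreteFlow.idx]
  have hcurve : ∀ k, LagrangianScheme.IsProbCurve ((D k).densityInterp ρbar (G k)) := fun k =>
    LagrangianScheme.Discretization.isProbCurve_densityInterp hρbar hK (hG k).mem_ansatz
  -- convergence of the densities
  let ν₀ : ProbabilityMeasure (LagrangianScheme.Space d) := ⟨_, hρ₀.isProbabilityMeasure⟩
  have hν₀ : Tendsto (fun k => (F k).interp 0) atTop (𝓝 ν₀) := by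
    refine (LagrangianScheme.tendsto_probabilityMeasure_of_narrowTendsto (fun k => ?_) rfl).1 hinit
    rw [LagrangianScheme.DiscreteFlow.coe_interp, hidx0]
    exact LagrangianScheme.Discretization.flow_law hρbar hK (hG k).mem_ansatz 0
  have htight : IsTightMeasureSet (range fun k => (F k).law 0) := by
    convert LagrangianScheme.isTightMeasureSet_of_tendsto hν₀ using 3 with k
    rw [LagrangianScheme.DiscreteFlow.coe_interp, hidx0]
    rfl
  obtain ⟨φ₁, hφ₁, μ, hμ⟩ := LagrangianScheme.DiscreteFlow.exists_tendsto_interp F hF hτ htight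
  have hτ₁ : Tendsto (fun j => (F (φ₁ j)).τ) atTop (𝓝 0) := hτ.comp hφ₁.tendsto_atTop
  -- Identifying the limit at time 0 supplies the finite second moment that is propagated to later
  -- times.
  have hμ0 : μ 0 = ν₀ := tendsto_nhds_unique (hμ 0) (hν₀.comp hφ₁.tendsto_atTop)
  have hac : ∀ t, (μ t : Measure (LagrangianScheme.Space d)) ≪ volume := fun t =>
    LagrangianScheme.absolutelyContinuous_of_tendsto hh hV0
      (σ := fun j => (D (φ₁ j)).densityInterp ρbar (G (φ₁ j)) t)
      (fun j x => ENNReal.toReal_nonneg)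
      (fun j => (LagrangianScheme.Discretization.energy_density_le hh hVm hρbar hK (hG _)
        (hinj _) _).trans (hE _))
      (fun j => hlaw _ t) (hμ t)
  obtain ⟨ρs, hρsm, hρs0, hρs⟩ := LagrangianScheme.exists_measurable_density μ
    (LagrangianScheme.DiscreteFlow.measurable_limit (fun j => F (φ₁ j)) hμ) hac
  have hσ : LagrangianScheme.IsProbCurve ρs := ⟨hρsm, fun t => by rw [hρs t]; infer_instance⟩
  have hdens : ∀ t, LagrangianScheme.IsProbDensity (ρs t) := fun t => by
    have := hσ.prob t
    refine LagrangianScheme.isProbDensity_of_densityMeasure (hσ.measurable_apply t) (hρs0 t) ?_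
    rw [hρs t]
    refine LagrangianScheme.DiscreteFlow.lintegral_sq_limit_ne_top (fun j => F (φ₁ j))
      (fun j => hF _) hτ₁ hμ ?_ t
    rw [hμ0]
    exact hρ₀.lintegral_sq_ne_top
  have hnarrow : ∀ t, LagrangianScheme.NarrowTendsto
      (fun j => (D (φ₁ j)).densityInterp ρbar (G (φ₁ j)) t) (ρs t) := fun t =>
    (LagrangianScheme.tendsto_probabilityMeasure_of_narrowTendsto (fun j => hlaw _ t)
      (hρs t)).2 (hμ t)
  -- convergence of the velocities
  have hvel := fun k n hn => LagrangianScheme.Discretization.velocity_spec hρbar hK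
    (hG k).mem_ansatz n (hinj k n hn)
  have hvC : ∀ k, eLpNorm (Function.uncurry ((D k).velocityInterp (G k))) 2
      (LagrangianScheme.spaceTimeMeasure ((D k).densityInterp ρbar (G k))) ≤ NNReal.sqrt C :=
    fun k => (hF k).eLpNorm_velocity_le (hcurve k) (hlaw k) (fun n hn => (hvel k n hn).1)
      (fun n hn => (hvel k n hn).2)
  have hv : ∀ k, MemLp (Function.uncurry ((D k).velocityInterp (G k))) 2
      (LagrangianScheme.spaceTimeMeasure ((D k).densityInterp ρbar (G k))) := fun k =>
    ⟨LagrangianScheme.DiscreteFlow.aestronglyMeasurable_velocity (F := F k) (hcurve k) (hlaw k)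
      (fun n hn => (hvel k n hn).1), (hvC k).trans_lt ENNReal.coe_lt_top⟩
  obtain ⟨φ₂, hφ₂, vs, hvs, hmom⟩ := LagrangianScheme.exists_limit_velocity
    (fun j => hcurve (φ₁ j)) hσ (fun t _ => hnarrow t)
    (fun j => (D (φ₁ j)).velocityInterp (G (φ₁ j))) (fun j => hv _) (fun j => hvC _)
  refine ⟨φ₁ ∘ φ₂, hφ₁.comp hφ₂, ρs, vs, hρsm, fun t _ => hdens t,
    fun t _ f => (hnarrow t f).comp hφ₂.tendsto_atTop, ⟨NNReal.sqrt C, fun s t _ _ => ?_⟩, hvs,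
    fun ψ T hT => hmom ψ ⟨T, hT⟩, ?_⟩
  · rw [hρs, hρs]
    exact LagrangianScheme.DiscreteFlow.wasserstein2_limit_le (fun j => F (φ₁ j))
      (fun j => hF _) hτ₁ hμ s t
  -- the continuity equation
  refine LagrangianScheme.continuityEquation_of_tendsto (fun j => hcurve (φ₁ (φ₂ j))) hσ
    (fun t _ f => (hnarrow t f).comp hφ₂.tendsto_atTop) (fun j => hv (φ₁ (φ₂ j))) hvs hmom
    fun φ hφ hc hs => ?_
  obtain ⟨T, hT0, hT⟩ := LagrangianScheme.exists_tsupport_subset_Ioo_prod hc hs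
  -- A compactly supported C¹ derivative is Lipschitz, as the error estimate requires.
  have hφ1 : ContDiff ℝ 1 (fderiv ℝ φ) := hφ.fderiv_right (by norm_cast)
  obtain ⟨L, hL⟩ := hφ1.lipschitzWith_of_hasCompactSupport (hc.fderiv ℝ) (by simp)
  refine squeeze_zero_norm (fun j => (hF (φ₁ (φ₂ j))).norm_integral_fderiv_le (hcurve _) (hlaw _)
    (fun n hn => (hvel _ n hn).1) (fun n hn => (hvel _ n hn).2)
    (hφ.of_le (by exact_mod_cast le_top)) hc hL hT0 hT) ?_
  have hτ₂ : Tendsto (fun j => (F (φ₁ (φ₂ j))).τ) atTop (𝓝 0) := hτ₁.comp hφ₂.tendsto_atTop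
  have := ((((hτ₂.const_add T).div_const 2).add_const (3 / 2 * (C : ℝ))).const_mul (L : ℝ)).mul hτ₂
  simpa using this
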